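/- **Setting.** A $k$-clause on $n$ variables is an ordered $k$-tuple of literals with distinct variables; $\sigma(C)\in\{0,1\}^k$ denotes the values that an assignment $\sigma\in\{0,1\}^n$ gives to the literals of $C$, and $U_k$ is the uniform distribution on $k$-clauses. A probability distribution $Q$ on $\{0,1\}^k$ has complexity $r$ if it is $(r-1)$-wise uniform but not $r$-wise uniform. Put $Q_\sigma(C)=Q(\sigma(C))/\sum_{C'}Q(\sigma(C'))$ and $Q_\sigma^\eta=(1-\eta)Q_\sigma+\eta U_k$. *CSP hardness conjecture (Feldman, Perkins, Vempala).* Let $Q$ have complexity $r$ and let $0<\eta<1$. Every polynomial-time randomized algorithm that, given independent clauses drawn from $D$, where $D=U_k$ or $D=Q_\sigma^\eta$ for some $\sigma\in\{0,1\}^n$, decides correctly with probability at least $2/3$ which is the case needs $\tilde\Omega(n^{r/2})$ clauses. *Prediction error.* For a hidden Markov model (HMM) with outputs $x_0,x_1,\dots$ and a predictor $\mathcal A$, which maps the most recent outputs to a distribution $\mathcal A_t$ of the next one, let $P_t=\Pr(x_t=\cdot\mid x_0,\dots,x_{t-1})$ be the optimal prediction. The average error of $\mathcal A$ is the limit of the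 averages over $N$ consecutive times $t$, as $N\to\infty$, of $\mathbb E[F(P_t,\mathcal A_t)]$. Here $F(P,Q)$ is $\sum_a P(a)\log\frac{P(a)}{Q(a)}$ (KL-error), $\sum_a|P(a)-Q(a)|$ ($\ell_1$ error), or $\max_a P(a)-P(\hat a)$ with $\hat a$ the (first) letter of maximal probability under $Q$ (relative zero-one error). A prediction algorithm is a randomized algorithm that obtains a predictor from a sequence of outputs of the HMM; its number of samples counts the outputs that it reads in this training sequence together with those past outputs that it looks at for a prediction. **Theorem.** Assume the CSP hardness conjecture. There are absolute constants $c,c'>0$ and $T_0$ such that for all integers $T\ge T_0$ and all $\epsilon$ with $1/T^c<\epsilon\le 0.1$ there is a family of HMMs with $T$ hidden states, containing for each $n\ge1$ a nonempty finite collection of HMMs with output alphabet of size $n$, with the following property. Let $f,g$ be any functions, and consider any prediction algorithm that runs in time $f(T,\epsilon)\cdot n^{g(T,\epsilon)}$ and that, for all sufficiently large $n$, achieves average KL-error, average $\ell_1$ error or average relative zero-one error less than $\epsilon$ with probability greater than $2/3$ (over a uniformly random HMM of the family with alphabet size $n$, the training sequence, and the randomness of the algorithm). Then this algorithm requires at least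 $n^{c'\log T/\epsilon}$ samples from the HMM, for all sufficiently large $n$. -/

import Mathlib

open Filter
open scoped ENNReal

namespace SeqPred

/-! ### Randomized algorithms with a step count

Programs act on finitely many registers, each holding a stack of natural numbers. One step is one
elementary instruction or one test. The arithmetic consists of constants, addition and truncated
subtraction (no multiplication), so that the numbers met in `t` steps have at most `O(t)` more bits
than the inputs, and time is polynomially equivalent to Turing machine time. -/

/-- The read-only streams which a program can read, one entry at a time:
fair coin tosses, samples, and (for predictors) the most recent past, latest observation first. -/
inductive Source
  | coin
  | sample
  | past
  deriving DecidableEq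

/-- Programs. The top of an empty stack counts as `0`. -/
inductive Prog
  | skip : Prog
  /-- push the constant `c` on register `v` -/
  | push (v c : ℕ) : Prog
  /-- remove the top of register `v` -/
  | pop (v : ℕ) : Prog
  /-- push the top of register `v` on register `w` -/
  | copy (v w : ℕ) : Prog
  /-- add the top of register `v` to the top of register `w` -/
  | add (v w : ℕ) : Prog
  /-- subtract the top of register `v` from the top of register `w` (truncated at `0`) -/
  | sub (v w : ℕ) : Prog
  /-- push the next entry of the stream `src` on register `v` -/
  | read (src : Source) (v : ℕ) : Prog
  | seq (p q : Prog) : Prog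
  /-- run `p` if the top of register `v` is nonzero, otherwise run `q` -/
  | ite (v : ℕ) (p q : Prog) : Prog
  /-- run `p` as long as the top of register `v` is nonzero -/
  | loop (v : ℕ) (p : Prog) : Prog

/-- A memory state: the contents of the registers and, for each stream, the number of entries
that have been read. -/
structure MState where
  reg : ℕ → List ℕ
  pos : Source → ℕ

/-- The top of register `v`. -/
def MState.top (st : MState) (v : ℕ) : ℕ := (st.reg v).headD 0

/-- Replace the contents of register `v`. -/
def MState.set (st : MState) (v : ℕ) (l : List ℕ) : MState :=
  { st with reg := Function.update st.reg v l }

/-- One step. The first component of a configuration is the list of programs still to be run. -/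
def step (env : Source → ℕ → ℕ) : List Prog × MState → List Prog × MState
  | ([], st) => ([], st)
  | (Prog.skip :: ks, st) => (ks, st)
  | (Prog.push v c :: ks, st) => (ks, st.set v (c :: st.reg v))
  | (Prog.pop v :: ks, st) => (ks, st.set v (st.reg v).tail)
  | (Prog.copy v w :: ks, st) => (ks, st.set w (st.top v :: st.reg w))
  | (Prog.add v w :: ks, st) => (ks, st.set w ((st.top w + st.top v) :: (st.reg w).tail))
  | (Prog.sub v w :: ks, st) => (ks, st.set w ((st.top w - st.top v) :: (st.reg w).tail))
  | (Prog.read src v :: ks, st) =>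
      (ks, { reg := Function.update st.reg v (env src (st.pos src) :: st.reg v),
             pos := Function.update st.pos src (st.pos src + 1) })
  | (Prog.seq p q :: ks, st) => (p :: q :: ks, st)
  | (Prog.ite v p q :: ks, st) => (if st.top v ≠ 0 then p :: ks else q :: ks, st)
  | (Prog.loop v p :: ks, st) => (if st.top v ≠ 0 then p :: Prog.loop v p :: ks else ks, st)

/-- The initial state on input `n`: register `0` holds `n`, everything else is empty. -/
def MState.init (n : ℕ) : MState where
  reg := fun v => if v = 0 then [n] else []
  pos := fun _ => 0

/-- The configuration reached from input `n` after `t` steps. -/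
def exec (p : Prog) (env : Source → ℕ → ℕ) (n t : ℕ) : List Prog × MState :=
  (step env)^[t] ([p], MState.init n)

/-- `p` halts on input `n` after at most `t` steps. -/
def HaltsWithin (p : Prog) (env : Source → ℕ → ℕ) (n t : ℕ) : Prop :=
  (exec p env n t).1 = []

/-- A finite list as a stream, continued by zeros. -/
def streamOf (l : List ℕ) : ℕ → ℕ := fun j => l.getD j 0

/-- The streams made of `t` coin tosses, a list of samples, and a list of past data. -/
def mkEnv {t : ℕ} (coins : Fin t → Bool) (samples past : List ℕ) : Source → ℕ → ℕ
  | Source.coin => streamOf ((List.ofFn coins).map Bool.toNat)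
  | Source.sample => streamOf samples
  | Source.past => streamOf past

/-! ### Planted constraint satisfaction problems -/

/-- A `k`-clause on `n` variables: an ordered `k`-tuple of literals with distinct variables,
given by the variables and by which of them are negated. -/
abbrev Clause (k n : ℕ) : Type := (Fin k ↪ Fin n) × (Fin k → Bool)

/-- `σ(C)`: the values that the assignment `σ` gives to the literals of `C`. -/
def Clause.value {k n : ℕ} (C : Clause k n) (σ : Fin n → Bool) : Fin k → Bool :=
  fun i => xor (σ (C.1 i)) (C.2 i)

/-- The literals of a clause as numbers: `2 j` is the variable `j`, and `2 j + 1` its negation. -/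
def Clause.codes {k n : ℕ} (C : Clause k n) : List ℕ :=
  List.ofFn fun i => 2 * (C.1 i : ℕ) + (C.2 i).toNat

/-- `Q` is a probability distribution on `{0,1}^k`. -/
def IsDistribution {k : ℕ} (Q : (Fin k → Bool) → ℝ) : Prop :=
  (∀ v, 0 ≤ Q v) ∧ ∑ v, Q v = 1

/-- `Q` is `d`-wise uniform: its marginal on any at most `d` coordinates is uniform. -/
def WiseUniform {k : ℕ} (Q : (Fin k → Bool) → ℝ) (d : ℕ) : Prop :=
  ∀ S : Finset (Fin k), S.card ≤ d → ∀ a : Fin k → Bool,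
    (∑ v with ∀ i ∈ S, v i = a i, Q v) = (1 / 2 : ℝ) ^ S.card

/-- `Q` has complexity `r`: it is `(r-1)`-wise uniform but not `r`-wise uniform. -/
def HasComplexity {k : ℕ} (Q : (Fin k → Bool) → ℝ) (r : ℕ) : Prop :=
  1 ≤ r ∧ WiseUniform Q (r - 1) ∧ ¬ WiseUniform Q r

/-- The uniform distribution `U_k` on `k`-clauses. -/
noncomputable def uniformClause (k n : ℕ) : Clause k n → ℝ :=
  fun _ => 1 / (Fintype.card (Clause k n) : ℝ)

/-- The planted distribution `Q_σ`. -/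
noncomputable def planted {k n : ℕ} (Q : (Fin k → Bool) → ℝ) (σ : Fin n → Bool) :
    Clause k n → ℝ :=
  fun C => Q (C.value σ) / ∑ C' : Clause k n, Q (C'.value σ)

/-- The noisy planted distribution `(1 - η) Q_σ + η U_k`. -/
noncomputable def noisyPlanted {k n : ℕ} (Q : (Fin k → Bool) → ℝ) (η : ℝ) (σ : Fin n → Bool) :
    Clause k n → ℝ :=
  fun C => (1 - η) * planted Q σ C + η * uniformClause k n C

/-- The streams of a run with `s` clauses; the clauses are written one after the other. -/
def clauseEnv {k n t s : ℕ} (coins : Fin t → Bool) (Cs : Fin s → Clause k n) :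
    Source → ℕ → ℕ :=
  mkEnv coins ((List.ofFn Cs).flatMap Clause.codes) []

/-- The answer of a decision algorithm is "planted". -/
def AnswersPlanted (p : Prog) (env : Source → ℕ → ℕ) (n t : ℕ) : Prop :=
  (exec p env n t).2.top 0 ≠ 0

open Classical in
/-- The probability, over `t` coin tosses and `s` independent clauses drawn from `D`, that the
program `p`, stopped at time `t`, answers "planted". -/
noncomputable def plantedProb {k n : ℕ} (p : Prog) (t s : ℕ) (D : Clause k n → ℝ) : ℝ :=
  ∑ coins : Fin t → Bool, ∑ Cs : Fin s → Clause k n,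
    (1 / 2 : ℝ) ^ t * (∏ i, D (Cs i)) *
      (if AnswersPlanted p (clauseEnv coins Cs) n t then 1 else 0)

/-- On `n` variables, the program `p` runs in time at most `t`, uses at most `s` clauses, and
decides correctly with probability at least `2/3` whether the clauses come from the uniform
distribution or from a noisy planted distribution, whatever the planted assignment is. -/
structure Distinguishes (p : Prog) {k : ℕ} (Q : (Fin k → Bool) → ℝ) (η : ℝ) (n t s : ℕ) :
    Prop where
  halts : ∀ (coins : Fin t → Bool) (Cs : Fin s → Clause k n),
    HaltsWithin p (clauseEnv coins Cs) n t
  reads : ∀ (coins : Fin t → Bool) (Cs : Fin s → Clause k n),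
    (exec p (clauseEnv coins Cs) n t).2.pos Source.sample ≤ k * s
  uniform : 2 / 3 ≤ 1 - plantedProb p t s (uniformClause k n)
  planted : ∀ σ : Fin n → Bool, 2 / 3 ≤ plantedProb p t s (noisyPlanted Q η σ)

/-- The conjecture of Feldman, Perkins and Vempala: for `Q` of complexity `r` and noise level
`0 < η < 1`, a polynomial-time randomized algorithm which distinguishes the uniform from the noisy
planted distributions needs `Ω̃(n^(r/2))` clauses. -/
def CSPHardness : Prop :=
  ∀ (k : ℕ) (Q : (Fin k → Bool) → ℝ) (r : ℕ) (η : ℝ),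
    IsDistribution Q → HasComplexity Q r → 0 < η → η < 1 →
    ∀ (p : Prog) (a b : ℕ) (s : ℕ → ℕ),
      (∀ᶠ n in atTop, Distinguishes p Q η n (a * n ^ b) (s n)) →
      ∃ (c : ℝ) (e : ℕ), 0 < c ∧
        ∀ᶠ n : ℕ in atTop, c * (n : ℝ) ^ ((r : ℝ) / 2) / Real.log n ^ e ≤ s n

/-! ### Hidden Markov models and prediction errors -/

/-- A hidden Markov model with `T` hidden states and output alphabet of size `n`. -/
structure HMM (T n : ℕ) where
  init : Fin T → ℝ
  trans : Fin T → Fin T → ℝ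
  emit : Fin T → Fin n → ℝ
  init_nonneg : ∀ h, 0 ≤ init h
  trans_nonneg : ∀ h h', 0 ≤ trans h h'
  emit_nonneg : ∀ h a, 0 ≤ emit h a
  init_sum : ∑ h, init h = 1
  trans_sum : ∀ h, ∑ h', trans h h' = 1
  emit_sum : ∀ h, ∑ a, emit h a = 1

/-- The probability that the outputs from now on begin with a given word, if the current hidden
state is `h`. A state emits a letter, then moves on. -/
def HMM.probFrom {T n : ℕ} (M : HMM T n) : Fin T → List (Fin n) → ℝ
  | _, [] => 1
  | h, a :: w => M.emit h a * ∑ h', M.trans h h' * M.probFrom h' w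

/-- The probability that the output sequence `x₀, x₁, …` begins with the word `w`. -/
def HMM.prob {T n : ℕ} (M : HMM T n) (w : List (Fin n)) : ℝ :=
  ∑ h, M.init h * M.probFrom h w

/-- The prediction of the optimal predictor: the conditional distribution of the next output
given that the outputs so far are `w`. -/
noncomputable def HMM.next {T n : ℕ} (M : HMM T n) (w : List (Fin n)) : Fin n → ℝ :=
  fun a => M.prob (w ++ [a]) / M.prob w

/-- The three measures of distance of a predicted from the optimal distribution. -/
inductive Loss
  | kl
  | l1
  | zeroOne

/-- The Kullback-Leibler divergence of `P` from `Q` (natural logarithm). -/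
noncomputable def klLoss {n : ℕ} (P Q : Fin n → ℝ) : ℝ≥0∞ :=
  open Classical in
  if ∀ a, Q a = 0 → P a = 0 then ENNReal.ofReal (∑ a, P a * Real.log (P a / Q a)) else ⊤

/-- `a` is the letter that a predicted distribution `Q` bets on: the first one of maximal
probability. -/
def IsMode {n : ℕ} (Q : Fin n → ℝ) (a : Fin n) : Prop :=
  ∀ b, Q b ≤ Q a ∧ (b < a → Q b < Q a)

open Classical in
/-- The probability under `P` of the letter that `Q` bets on. -/
noncomputable def hitProb {n : ℕ} (P Q : Fin n → ℝ) : ℝ :=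
  ∑ a with IsMode Q a, P a

/-- The distance of the predicted distribution `Q` from the optimal prediction `P`. The relative
zero-one loss is `(1 - hitProb P Q) - (1 - max P)`. -/
noncomputable def Loss.eval {n : ℕ} : Loss → (Fin n → ℝ) → (Fin n → ℝ) → ℝ≥0∞
  | Loss.kl, P, Q => klLoss P Q
  | Loss.l1, P, Q => ENNReal.ofReal (∑ a, |P a - Q a|)
  | Loss.zeroOne, P, Q => ENNReal.ofReal ((⨆ a, P a) - hitProb P Q)

/-- The expected loss, at time `t`, of a predictor `A`, which maps the past outputs to a predicted
distribution of the next output. -/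
noncomputable def errorAt {T n : ℕ} (L : Loss) (M : HMM T n) (A : List (Fin n) → Fin n → ℝ)
    (t : ℕ) : ℝ≥0∞ :=
  ∑ x : Fin t → Fin n,
    ENNReal.ofReal (M.prob (List.ofFn x)) * L.eval (M.next (List.ofFn x)) (A (List.ofFn x))

/-- The average loss of a predictor that looks back at most `s` outputs: the limit of its average
over `N` consecutive times, from time `s` on, when `s` past outputs are available. The limit is
taken as a lower limit so that it is always defined; with this, having a small average loss is the
least demanding. -/
noncomputable def avgError {T n : ℕ} (L : Loss) (M : HMM T n) (A : List (Fin n) → Fin n → ℝ)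
    (s : ℕ) : ℝ≥0∞ :=
  liminf (fun N : ℕ => (∑ t ∈ Finset.range N, errorAt L M A (s + t)) / (N : ℝ≥0∞)) atTop

/-- The distribution with given weights (uniform if all weights are zero). -/
noncomputable def ofWeights {n : ℕ} (w : Fin n → ℕ) : Fin n → ℝ :=
  fun a => if ∑ b, w b = 0 then 1 / (n : ℝ) else (w a : ℝ) / ((∑ b, w b : ℕ) : ℝ)

/-- The streams of a run of a prediction algorithm that has been given the training sequence `u`
and makes a prediction when the outputs so far are `x` (the latest output is read first). -/
def predEnv {n t s : ℕ} (coins : Fin t → Bool) (u : Fin s → Fin n) (x : List (Fin n)) :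
    Source → ℕ → ℕ :=
  mkEnv coins ((List.ofFn u).map Fin.val) (x.reverse.map Fin.val)

/-- The predictor that the algorithm `p` obtains from its coin tosses and its training sequence.
The predicted weights of the `n` letters are the first `n` entries of register `0`. -/
noncomputable def predictor (p : Prog) {n t s : ℕ} (coins : Fin t → Bool) (u : Fin s → Fin n)
    (x : List (Fin n)) : Fin n → ℝ :=
  ofWeights fun a => ((exec p (predEnv coins u x) n t).2.reg 0).getD a 0

/-- A family of hidden Markov models with `T` hidden states: for every alphabet size `n ≥ 1` a
nonempty finite (indexed) family. -/
structure HMMFamily (T : ℕ) where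
  Index : ℕ → Type
  fintypeIndex : ∀ n, Fintype (Index n)
  nonemptyIndex : ∀ n, 1 ≤ n → Nonempty (Index n)
  model : ∀ n, Index n → HMM T n

attribute [instance] HMMFamily.fintypeIndex

open Classical in
/-- The probability that `p` has average error less than `ε`, over a uniformly random member of
the family with alphabet size `n`, over its first `s` outputs as training sequence, and over `t`
coin tosses. -/
noncomputable def successProb (p : Prog) (L : Loss) {T : ℕ} (𝓗 : HMMFamily T) (ε : ℝ)
    (n t s : ℕ) : ℝ :=
  ∑ i : 𝓗.Index n, ∑ coins : Fin t → Bool, ∑ u : Fin s → Fin n,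
    (1 / (Fintype.card (𝓗.Index n) : ℝ)) * (1 / 2 : ℝ) ^ t *
      (𝓗.model n i).prob (List.ofFn u) *
      (if avgError L (𝓗.model n i) (predictor p coins u) s < ENNReal.ofReal ε then 1 else 0)

/-- For alphabet size `n`, the prediction algorithm `p` runs in time at most `t`, looks at no more
than `s` outputs altogether (in the training sequence and in the recent past) for a prediction, and
has average error less than `ε` with probability greater than `2/3` on a random member of the
family. -/
structure Predicts (p : Prog) (L : Loss) {T : ℕ} (𝓗 : HMMFamily T) (ε : ℝ) (n t s : ℕ) :
    Prop where
  halts : ∀ (coins : Fin t → Bool) (u : Fin s → Fin n) (x : List (Fin n)),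
    HaltsWithin p (predEnv coins u x) n t
  reads : ∀ (coins : Fin t → Bool) (u : Fin s → Fin n) (x : List (Fin n)),
    (exec p (predEnv coins u x) n t).2.pos Source.sample +
      (exec p (predEnv coins u x) n t).2.pos Source.past ≤ s
  success : 2 / 3 < successProb p L 𝓗 ε n t s

end SeqPred

/-! A sequence in which short parity-check puzzles are posed and then answered is easy to describe
by a small hidden Markov model, but an algorithm that predicts the answers must know a hidden
assignment. Detecting that such an assignment exists is what the conjecture makes hard.

Take a random matrix of `2 M` by `k` bits, with columns in `Syn M`. By the Gilbert–Varshamov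
argument (`exists_code`) it can be chosen so that every nonzero combination of its rows has weight
greater than `d`. The uniform distribution on its kernel, `codeDist`, is then `d`-wise uniform, but
not `k`-wise uniform, so its complexity exceeds `d` (`exists_hasComplexity`).

The model emits independent blocks. A block consists of `k` literals with uniform values `v`, the
`i`-th one on a variable of the `i`-th group, followed by `M` letters from `{0,1,2,3}` which spell
the syndrome of `v`, replaced by a uniform syndrome at noise rate `1/2000`. The hidden state has to
remember only the position, the next value and the partial syndrome, so `(k + M)(2 * 4 ^ M + 1)`
states suffice. At a block boundary the chain restarts (`blockModel_prob_append`).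

Noisy planted clauses can be turned into blocks of this model exactly (`mean_genTree`). Keep a
clause only if its variables lie in the right groups, pick a uniform `w`, flip the literals by `w`
and append the syndrome of `w`. If the literals of the clause have values `v`, those of the block
have values `v + w`, which are uniform, and the appended syndrome is that of `v + w` plus the noise
`syn v`. If no clause is kept in `B` attempts, a default block results, and the model includes
default blocks with precisely this probability. A random table of sign changes makes the assignment
uniform, so a predictor that succeeds on a random member of the family can be used for every planted
assignment (`mean_trialTree`).

If the average error is below `ε`, the errors in one block sum to at most `(k + M) ε`, hence to at
most `0.35 M`. Comparison with a predictor that knows the assignment (`errorAt_ge`,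
`success_mul_le`) shows that at least `0.466 M` of the `M` syndrome letters are then predicted
correctly in the mean, and at least `0.31 M` when the success probability `2/3` is included. With
uniform clauses, however, the syndrome letters are independent of everything before them, and nobody
hits more than a quarter of them, up to default blocks (`blockHit_one_le`). Syndromes come in pairs
of bits because the guessing probability `1/2` of single bits would not lie below `0.31`. A constant
number of trials and Chebyshev's inequality separate the cases (`distinguishes_mainProg`).

The distinguisher must be an actual program. Computations with coins and draws are described by
`Tree`, for which means are easily computed; the `reach_` lemmas show that the program carries out
the same computation in polynomial time. It uses a constant multiple of `s + 1` clauses, so the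
conjecture bounds `s` from below by `n ^ (r / 2)` up to logarithms, and the parameters are chosen so
that `r / 2` exceeds `log T / (30000 ε)`. -/

namespace SeqPred

/-! ### Runs of programs -/

/-- The configuration `c'` is reached from `c` within `t` steps. -/
def Reach (env : Source → ℕ → ℕ) (c : List Prog × MState) (t : ℕ) (c' : List Prog × MState) :
    Prop :=
  ∃ t' ≤ t, (step env)^[t'] c = c'

theorem Reach.refl (env : Source → ℕ → ℕ) (c : List Prog × MState) : Reach env c 0 c :=
  ⟨0, le_rfl, rfl⟩

theorem Reach.mono {env : Source → ℕ → ℕ} {c c' : List Prog × MState} {t t' : ℕ}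
    (h : Reach env c t c') (ht : t ≤ t') : Reach env c t' c' := by
  obtain ⟨u, hu, e⟩ := h
  exact ⟨u, hu.trans ht, e⟩

theorem Reach.trans {env : Source → ℕ → ℕ} {c c' c'' : List Prog × MState} {t t' : ℕ}
    (h : Reach env c t c') (h' : Reach env c' t' c'') : Reach env c (t + t') c'' := by
  obtain ⟨u, hu, e⟩ := h
  obtain ⟨u', hu', e'⟩ := h'
  refine ⟨u' + u, by omega, ?_⟩
  rw [Function.iterate_add_apply, e, e']

theorem Reach.of_step {env : Source → ℕ → ℕ} {c c' : List Prog × MState}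
    (h : step env c = c') : Reach env c 1 c' :=
  ⟨1, le_rfl, h⟩

theorem Reach.head {env : Source → ℕ → ℕ} {c c' c'' : List Prog × MState} {t : ℕ}
    (h : step env c = c') (h' : Reach env c' t c'') : Reach env c (t + 1) c'' :=
  ((Reach.of_step h).trans h').mono (by omega)

@[simp] theorem MState.set_reg_self (st : MState) (v : ℕ) (l : List ℕ) :
    (st.set v l).reg v = l := by
  simp [MState.set]

theorem MState.set_reg_of_ne (st : MState) {v w : ℕ} (l : List ℕ) (h : w ≠ v) :
    (st.set v l).reg w = st.reg w := by
  simp [MState.set, h]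

@[simp] theorem MState.set_pos (st : MState) (v : ℕ) (l : List ℕ) :
    (st.set v l).pos = st.pos := rfl

theorem step_pos_le (env : Source → ℕ → ℕ) (c : List Prog × MState) (src : Source) :
    c.2.pos src ≤ (step env c).2.pos src := by
  obtain ⟨ks, st⟩ := c
  rcases ks with _ | ⟨q, ks⟩
  · exact le_rfl
  · cases q with
    | read s v =>
      by_cases h : src = s <;> simp [step, Function.update, h]
    | ite v p q => simp only [step]; exact le_rfl
    | loop v p => simp only [step]; exact le_rfl
    | _ => simp [step]

theorem step_pos_le_succ (env : Source → ℕ → ℕ) (c : List Prog × MState) (src : Source) :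
    (step env c).2.pos src ≤ c.2.pos src + 1 := by
  obtain ⟨ks, st⟩ := c
  rcases ks with _ | ⟨q, ks⟩
  · exact Nat.le_succ _
  · cases q with
    | read s v =>
      by_cases h : src = s <;> simp [step, Function.update, h]
    | ite v p q => simp only [step]; exact Nat.le_succ _
    | loop v p => simp only [step]; exact Nat.le_succ _
    | _ => simp [step]

theorem iterate_pos_le (env : Source → ℕ → ℕ) (c : List Prog × MState) (src : Source) (t : ℕ) :
    ((step env)^[t] c).2.pos src ≤ c.2.pos src + t := by
  induction t with
  | zero => exact le_rfl
  | succ t ih =>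
    rw [Function.iterate_succ_apply']
    exact (step_pos_le_succ _ _ _).trans (by omega)

/-- A run depends only on the entries it has consumed, and since positions never decrease these are
the ones below the final positions. This allows finite data to be exchanged for infinite streams. -/
theorem iterate_congr {env env' : Source → ℕ → ℕ} {c : List Prog × MState} {t : ℕ}
    (h : ∀ src i, i < ((step env')^[t] c).2.pos src → env src i = env' src i) :
    (step env)^[t] c = (step env')^[t] c := by
  induction t with
  | zero => rfl
  | succ t ih =>
    rw [Function.iterate_succ_apply'] at h
    have e := ih fun src i hi => h src i (hi.trans_le (step_pos_le _ _ _))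
    rw [Function.iterate_succ_apply', Function.iterate_succ_apply', e]
    revert h
    generalize (step env')^[t] c = d
    intro h
    obtain ⟨ks, st⟩ := d
    rcases ks with _ | ⟨q, ks⟩
    · rfl
    · cases q with
      | read s v =>
        have := h s (st.pos s) (by simp [step])
        simp [step, this]
      | _ => rfl

theorem iterate_nil (env : Source → ℕ → ℕ) (st : MState) (t : ℕ) :
    (step env)^[t] ([], st) = ([], st) := by
  induction t with
  | zero => rfl
  | succ t ih => rw [Function.iterate_succ_apply']; rw [ih]; rfl

/-- Halted configurations are fixed by `step`, so a bound for the running time may be used as the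
exact number of steps. -/
theorem iterate_eq_of_reach_nil {env : Source → ℕ → ℕ} {c : List Prog × MState} {t : ℕ}
    {st : MState} (h : Reach env c t ([], st)) : (step env)^[t] c = ([], st) := by
  obtain ⟨u, hu, e⟩ := h
  obtain ⟨v, rfl⟩ := Nat.exists_eq_add_of_le hu
  rw [Nat.add_comm, Function.iterate_add_apply, e, iterate_nil]

/-- Rename the registers of a program. -/
def Prog.map (φ : ℕ → ℕ) : Prog → Prog
  | .skip => .skip
  | .push v c => .push (φ v) c
  | .pop v => .pop (φ v)
  | .copy v w => .copy (φ v) (φ w)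
  | .add v w => .add (φ v) (φ w)
  | .sub v w => .sub (φ v) (φ w)
  | .read s v => .read s (φ v)
  | .seq p q => .seq (p.map φ) (q.map φ)
  | .ite v p q => .ite (φ v) (p.map φ) (q.map φ)
  | .loop v p => .loop (φ v) (p.map φ)

/-- `st` contains the registers of `lst`, renamed by `φ`, and the other registers of `st₀`. -/
structure Renamed (φ : ℕ → ℕ) (st₀ lst st : MState) : Prop where
  reg : ∀ v, st.reg (φ v) = lst.reg v
  pos : st.pos = lst.pos
  frame : ∀ v, v ∉ Set.range φ → st.reg v = st₀.reg v

theorem Renamed.set {φ : ℕ → ℕ} (hφ : Function.Injective φ) {st₀ lst st : MState}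
    (h : Renamed φ st₀ lst st) (v : ℕ) (l : List ℕ) :
    Renamed φ st₀ (lst.set v l) (st.set (φ v) l) := by
  refine ⟨fun w => ?_, h.pos, fun w hw => ?_⟩
  · by_cases e : w = v
    · subst e; simp
    · rw [MState.set_reg_of_ne _ _ e, MState.set_reg_of_ne _ _ (fun h => e (hφ h)), h.reg]
  · rw [MState.set_reg_of_ne _ _ (by rintro rfl; exact hw ⟨v, rfl⟩), h.frame w hw]

theorem Renamed.step {φ : ℕ → ℕ} (hφ : Function.Injective φ) {env : Source → ℕ → ℕ}
    {st₀ lst st : MState} (h : Renamed φ st₀ lst st) (ks rest : List Prog) :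
    ∃ st', Reach env (ks.map (Prog.map φ) ++ rest, st) 1
        ((SeqPred.step env (ks, lst)).1.map (Prog.map φ) ++ rest, st') ∧
      Renamed φ st₀ (SeqPred.step env (ks, lst)).2 st' := by
  rcases ks with _ | ⟨q, ks⟩
  · exact ⟨st, (Reach.refl _ _).mono zero_le_one, h⟩
  · have top : ∀ v, st.top (φ v) = lst.top v := fun v => by simp [MState.top, h.reg]
    cases q with
    | skip => exact ⟨st, .of_step rfl, h⟩
    | push v c => exact ⟨_, .of_step rfl, by simpa [SeqPred.step, h.reg] using h.set hφ v (c :: lst.reg v)⟩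
    | pop v => exact ⟨_, .of_step rfl, by simpa [SeqPred.step, h.reg] using h.set hφ v (lst.reg v).tail⟩
    | copy v w =>
      exact ⟨_, .of_step rfl, by simpa [SeqPred.step, h.reg, top] using h.set hφ w (lst.top v :: lst.reg w)⟩
    | add v w =>
      exact ⟨_, .of_step rfl, by
        simpa [SeqPred.step, h.reg, top] using h.set hφ w ((lst.top w + lst.top v) :: (lst.reg w).tail)⟩
    | sub v w =>
      exact ⟨_, .of_step rfl, by
        simpa [SeqPred.step, h.reg, top] using h.set hφ w ((lst.top w - lst.top v) :: (lst.reg w).tail)⟩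
    | read s v =>
      refine ⟨_, .of_step rfl, ?_⟩
      have := h.set hφ v (env s (lst.pos s) :: lst.reg v)
      refine ⟨fun w => ?_, ?_, fun w hw => ?_⟩
      · simpa [SeqPred.step, MState.set, h.pos, h.reg] using this.reg w
      · simp [SeqPred.step, h.pos]
      · simpa [SeqPred.step, MState.set, h.pos, h.reg] using this.frame w hw
    | seq p q => exact ⟨st, .of_step rfl, h⟩
    | ite v p q =>
      refine ⟨st, .of_step ?_, h⟩
      by_cases e : lst.top v = 0 <;> simp [SeqPred.step, Prog.map, top, e]
    | loop v p =>
      refine ⟨st, .of_step ?_, h⟩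
      by_cases e : lst.top v = 0 <;> simp [SeqPred.step, Prog.map, top, e]

theorem Renamed.iterate {φ : ℕ → ℕ} (hφ : Function.Injective φ) {env : Source → ℕ → ℕ}
    {st₀ : MState} (rest : List Prog) (t : ℕ) : ∀ {lst st : MState}, Renamed φ st₀ lst st →
    ∀ ks, ∃ st', Reach env (ks.map (Prog.map φ) ++ rest, st) t
        (((SeqPred.step env)^[t] (ks, lst)).1.map (Prog.map φ) ++ rest, st') ∧
      Renamed φ st₀ ((SeqPred.step env)^[t] (ks, lst)).2 st' := by
  induction t with
  | zero => exact fun {lst st} h ks => ⟨st, Reach.refl _ _, h⟩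
  | succ t ih =>
    intro lst st h ks
    obtain ⟨st₁, hr, h₁⟩ := h.step hφ (env := env) ks rest
    obtain ⟨st₂, hr₂, h₂⟩ := ih h₁ (SeqPred.step env (ks, lst)).1
    exact ⟨st₂, (hr.trans hr₂).mono (by omega), h₂⟩

/-- This serves to repeat a trial: each copy of its code works on its own registers as if in fresh
memory, and leaves all other registers untouched. -/
theorem Renamed.reach {φ : ℕ → ℕ} (hφ : Function.Injective φ) {env : Source → ℕ → ℕ}
    {st₀ lst lst' st : MState} (h : Renamed φ st₀ lst st) {q : Prog} {t : ℕ}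
    (hr : Reach env ([q], lst) t ([], lst')) (rest : List Prog) :
    ∃ st', Reach env (q.map φ :: rest, st) t (rest, st') ∧ Renamed φ st₀ lst' st' := by
  obtain ⟨st', h₁, h₂⟩ := Renamed.iterate hφ (env := env) rest t h [q]
  rw [iterate_eq_of_reach_nil hr] at h₁ h₂
  exact ⟨st', h₁, h₂⟩

end SeqPred

namespace SeqPred

/-! ### Random computations

A computation asks for fair coins and for independent draws from a distribution on `B`; the draws
come from two streams. -/

inductive Tree (B α : Type) : Type
  | ret (a : α) : Tree B α
  | coin (f : Bool → Tree B α) : Tree B α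
  | drawS (f : B → Tree B α) : Tree B α
  | drawP (f : B → Tree B α) : Tree B α

/-- The numbers of entries read from the three streams. -/
@[ext] structure Pos where
  c : ℕ
  s : ℕ
  p : ℕ

namespace Tree

variable {B B' α β : Type}

def bind : Tree B α → (α → Tree B β) → Tree B β
  | ret a, g => g a
  | coin f, g => coin fun b => (f b).bind g
  | drawS f, g => drawS fun b => (f b).bind g
  | drawP f, g => drawP fun b => (f b).bind g

/-- Replace the draws by computations. -/
def subst : Tree B α → Tree B' B → Tree B' α
  | ret a, _ => ret a
  | coin f, g => coin fun b => (f b).subst g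
  | drawS f, g => g.bind fun b => (f b).subst g
  | drawP f, g => g.bind fun b => (f b).subst g

/-- The result on given streams, when reading starts at given positions. -/
def run (ω : ℕ → Bool) (x y : ℕ → B) : Tree B α → Pos → α × Pos
  | ret a, P => (a, P)
  | coin f, P => (f (ω P.c)).run ω x y ⟨P.c + 1, P.s, P.p⟩
  | drawS f, P => (f (x P.s)).run ω x y ⟨P.c, P.s + 1, P.p⟩
  | drawP f, P => (f (y P.p)).run ω x y ⟨P.c, P.s, P.p + 1⟩

theorem run_bind (ω : ℕ → Bool) (x y : ℕ → B) (t : Tree B α) (g : α → Tree B β) (P : Pos) :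
    (t.bind g).run ω x y P = (g (t.run ω x y P).1).run ω x y (t.run ω x y P).2 := by
  induction t generalizing P with
  | ret a => rfl
  | coin f ih => exact ih _ _
  | drawS f ih => exact ih _ _
  | drawP f ih => exact ih _ _

/-- The stream which starts with `a` and continues with `x`. -/
def cons {γ : Type} (a : γ) (x : ℕ → γ) : ℕ → γ
  | 0 => a
  | i + 1 => x i

/-- Entries before the reading position are irrelevant, so an additional first entry only shifts the
positions. The same holds for the other two streams. -/
theorem run_cons_coin (b : Bool) (ω : ℕ → Bool) (x y : ℕ → B) (t : Tree B α) (P : Pos) :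
    t.run (cons b ω) x y ⟨P.c + 1, P.s, P.p⟩ =
      ((t.run ω x y P).1, ⟨(t.run ω x y P).2.c + 1, (t.run ω x y P).2.s, (t.run ω x y P).2.p⟩) := by
  induction t generalizing P with
  | ret a => rfl
  | coin f ih => exact ih _ _
  | drawS f ih => exact ih _ ⟨P.c, P.s + 1, P.p⟩
  | drawP f ih => exact ih _ ⟨P.c, P.s, P.p + 1⟩

theorem run_cons_drawS (b : B) (ω : ℕ → Bool) (x y : ℕ → B) (t : Tree B α) (P : Pos) :
    t.run ω (cons b x) y ⟨P.c, P.s + 1, P.p⟩ =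
      ((t.run ω x y P).1, ⟨(t.run ω x y P).2.c, (t.run ω x y P).2.s + 1, (t.run ω x y P).2.p⟩) := by
  induction t generalizing P with
  | ret a => rfl
  | coin f ih => exact ih _ ⟨P.c + 1, P.s, P.p⟩
  | drawS f ih => exact ih _ _
  | drawP f ih => exact ih _ ⟨P.c, P.s, P.p + 1⟩

theorem run_cons_drawP (b : B) (ω : ℕ → Bool) (x y : ℕ → B) (t : Tree B α) (P : Pos) :
    t.run ω x (cons b y) ⟨P.c, P.s, P.p + 1⟩ =
      ((t.run ω x y P).1, ⟨(t.run ω x y P).2.c, (t.run ω x y P).2.s, (t.run ω x y P).2.p + 1⟩) := by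
  induction t generalizing P with
  | ret a => rfl
  | coin f ih => exact ih _ ⟨P.c + 1, P.s, P.p⟩
  | drawS f ih => exact ih _ ⟨P.c, P.s + 1, P.p⟩
  | drawP f ih => exact ih _ _

/-- The mean of a function of the result, if the draws have distribution `μ`. -/
noncomputable def mean [Fintype B] (μ : B → ℝ) : Tree B α → (α → ℝ) → ℝ
  | ret a, F => F a
  | coin f, F => ∑ b, 1 / 2 * (f b).mean μ F
  | drawS f, F => ∑ b, μ b * (f b).mean μ F
  | drawP f, F => ∑ b, μ b * (f b).mean μ F

theorem mean_bind [Fintype B] (μ : B → ℝ) (t : Tree B α) (g : α → Tree B β) (F : β → ℝ) :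
    (t.bind g).mean μ F = t.mean μ fun a => (g a).mean μ F := by
  induction t with
  | ret a => rfl
  | _ f ih => simp only [bind, mean, ih]

/-- Each draw is made by a fresh, independent run of `g`, whose result has distribution `μ`. Hence a
simulation with generated blocks has the same law as one with blocks of the model. -/
theorem mean_subst [Fintype B] [Fintype B'] {μ : B → ℝ} {μ' : B' → ℝ} {g : Tree B' B}
    (hg : ∀ G : B → ℝ, g.mean μ' G = ∑ b, μ b * G b) (t : Tree B α) (F : α → ℝ) :
    (t.subst g).mean μ' F = t.mean μ F := by
  induction t with
  | ret a => rfl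
  | coin f ih => simp only [subst, mean, ih]
  | drawS f ih => simp only [subst, mean, mean_bind, hg, ih]
  | drawP f ih => simp only [subst, mean, mean_bind, hg, ih]

theorem mean_add [Fintype B] (μ : B → ℝ) (t : Tree B α) (F G : α → ℝ) :
    (t.mean μ fun a => F a + G a) = t.mean μ F + t.mean μ G := by
  induction t with
  | ret a => rfl
  | _ f ih => simp only [mean, ih, mul_add, Finset.sum_add_distrib]

theorem mean_mul_left [Fintype B] (μ : B → ℝ) (t : Tree B α) (c : ℝ) (F : α → ℝ) :
    (t.mean μ fun a => c * F a) = c * t.mean μ F := by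
  induction t with
  | ret a => rfl
  | _ f ih =>
    simp only [mean, ih, Finset.mul_sum]
    exact Finset.sum_congr rfl fun b _ => by ring

theorem mean_const [Fintype B] {μ : B → ℝ} (hμ : ∑ b, μ b = 1) (t : Tree B α) (c : ℝ) :
    (t.mean μ fun _ => c) = c := by
  induction t with
  | ret a => rfl
  | coin f ih => simp [mean, ih]
  | drawS f ih => simp only [mean, ih]; rw [← Finset.sum_mul, hμ, one_mul]
  | drawP f ih => simp only [mean, ih]; rw [← Finset.sum_mul, hμ, one_mul]

theorem mean_mono [Fintype B] {μ : B → ℝ} (hμ : ∀ b, 0 ≤ μ b) (t : Tree B α) {F G : α → ℝ}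
    (h : ∀ a, F a ≤ G a) : t.mean μ F ≤ t.mean μ G := by
  induction t with
  | ret a => exact h a
  | coin f ih => exact Finset.sum_le_sum fun b _ => mul_le_mul_of_nonneg_left (ih b) (by norm_num)
  | drawS f ih => exact Finset.sum_le_sum fun b _ => mul_le_mul_of_nonneg_left (ih b) (hμ b)
  | drawP f ih => exact Finset.sum_le_sum fun b _ => mul_le_mul_of_nonneg_left (ih b) (hμ b)

/-- If the draws are made by `g`, then the result is one for some streams of draws. The position
in the first stream of `g` grows by at most `N` for each draw. -/
theorem exists_run_subst {g : Tree B' B} {N : ℕ} [Inhabited B] (ω : ℕ → Bool) (x y : ℕ → B')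
    (hg : ∀ P, (g.run ω x y P).2.s ≤ P.s + N) (t : Tree B α) (P : Pos) :
    ∃ (ω' : ℕ → Bool) (x' y' : ℕ → B),
      ((t.subst g).run ω x y P).1 = (t.run ω' x' y' ⟨0, 0, 0⟩).1 ∧
      ((t.subst g).run ω x y P).2.s ≤
        P.s + N * ((t.run ω' x' y' ⟨0, 0, 0⟩).2.s + (t.run ω' x' y' ⟨0, 0, 0⟩).2.p) := by
  induction t generalizing P with
  | ret a => exact ⟨fun _ => false, fun _ => default, fun _ => default, rfl, by simp [subst, run]⟩
  | coin f ih =>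
    obtain ⟨ω', x', y', h₁, h₂⟩ := ih (ω P.c) ⟨P.c + 1, P.s, P.p⟩
    refine ⟨cons (ω P.c) ω', x', y', ?_⟩
    have e := run_cons_coin (ω P.c) ω' x' y' (f (ω P.c)) ⟨0, 0, 0⟩
    simp only [subst, run, cons]
    rw [zero_add] at e
    rw [zero_add, e]
    exact ⟨h₁, h₂⟩
  | drawS f ih =>
    simp only [subst, run_bind]
    obtain ⟨ω', x', y', h₁, h₂⟩ := ih (g.run ω x y P).1 (g.run ω x y P).2
    refine ⟨ω', cons (g.run ω x y P).1 x', y', ?_⟩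
    have e := run_cons_drawS (g.run ω x y P).1 ω' x' y' (f (g.run ω x y P).1) ⟨0, 0, 0⟩
    simp only [run, cons]
    rw [zero_add] at e
    rw [zero_add, e]
    refine ⟨h₁, h₂.trans ?_⟩
    have := hg P
    simp only
    nlinarith
  | drawP f ih =>
    simp only [subst, run_bind]
    obtain ⟨ω', x', y', h₁, h₂⟩ := ih (g.run ω x y P).1 (g.run ω x y P).2
    refine ⟨ω', x', cons (g.run ω x y P).1 y', ?_⟩
    have e := run_cons_drawP (g.run ω x y P).1 ω' x' y' (f (g.run ω x y P).1) ⟨0, 0, 0⟩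
    simp only [run, cons]
    rw [zero_add] at e
    rw [zero_add, e]
    refine ⟨h₁, h₂.trans ?_⟩
    have := hg P
    simp only
    nlinarith

end Tree

/-! ### Averages over streams of independent entries -/

theorem sum_cons {γ : Type} [Fintype γ] {N : ℕ} (f : (Fin (N + 1) → γ) → ℝ) :
    ∑ x, f x = ∑ a, ∑ x : Fin N → γ, f (Fin.cons a x) := by
  rw [← Fintype.sum_prod_type']
  exact (Fintype.sum_equiv (Fin.consEquiv fun _ => γ) _ _ fun _ => rfl).symm

/-- Continue a finite sequence by `default`. -/
def extend {γ : Type} [Inhabited γ] {N : ℕ} (x : Fin N → γ) : ℕ → γ :=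
  fun i => if h : i < N then x ⟨i, h⟩ else default

theorem extend_cons {γ : Type} [Inhabited γ] {N : ℕ} (a : γ) (x : Fin N → γ) :
    extend (Fin.cons a x : Fin (N + 1) → γ) = Tree.cons a (extend x) := by
  funext i
  rcases i with _ | i
  · simp [extend, Tree.cons]
  · by_cases h : i < N
    · have h' : i + 1 < N + 1 := by omega
      simp only [extend, Tree.cons, h, h', dif_pos]
      rfl
    · simp [extend, Tree.cons, h]

/-- The mean of a function of a stream whose first `N` entries are independent with distribution
`μ` and whose other entries are `default`. -/
noncomputable def streamMean {γ : Type} [Fintype γ] [Inhabited γ] (μ : γ → ℝ) :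
    ℕ → ((ℕ → γ) → ℝ) → ℝ
  | 0, G => G fun _ => default
  | N + 1, G => ∑ a, μ a * streamMean μ N fun x => G (Tree.cons a x)

section streamMean

variable {γ δ : Type} [Fintype γ] [Inhabited γ] [Fintype δ] [Inhabited δ]

theorem streamMean_sum {ι : Type} (μ : γ → ℝ) (N : ℕ) (s : Finset ι) (c : ι → ℝ)
    (G : ι → (ℕ → γ) → ℝ) :
    (streamMean μ N fun x => ∑ i ∈ s, c i * G i x) = ∑ i ∈ s, c i * streamMean μ N (G i) := by
  induction N generalizing G with
  | zero => rfl
  | succ N ih =>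
    simp only [streamMean, ih, Finset.mul_sum]
    rw [Finset.sum_comm]
    exact Finset.sum_congr rfl fun i _ => Finset.sum_congr rfl fun a _ => by ring

theorem streamMean_const {μ : γ → ℝ} (hμ : ∑ a, μ a = 1) (N : ℕ) (c : ℝ) :
    (streamMean μ N fun _ => c) = c := by
  induction N with
  | zero => rfl
  | succ N ih => simp only [streamMean, ih, ← Finset.sum_mul, hμ, one_mul]

theorem streamMean_congr (μ : γ → ℝ) (N : ℕ) {G G' : (ℕ → γ) → ℝ}
    (h : ∀ x, G x = G' x) : streamMean μ N G = streamMean μ N G' := by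
  rw [funext h]

theorem streamMean_eq_sum (μ : γ → ℝ) (N : ℕ) (G : (ℕ → γ) → ℝ) :
    streamMean μ N G = ∑ x : Fin N → γ, (∏ i, μ (x i)) * G (extend x) := by
  induction N generalizing G with
  | zero =>
    simp only [streamMean, Finset.univ_unique, Finset.univ_eq_empty, Finset.prod_empty, one_mul,
      Finset.sum_singleton]
    congr 1
  | succ N ih =>
    rw [sum_cons]
    simp only [streamMean, ih, Fin.prod_univ_succ, Fin.cons_zero, Fin.cons_succ, extend_cons,
      Finset.mul_sum]
    exact Finset.sum_congr rfl fun a _ => Finset.sum_congr rfl fun x _ => by ring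

end streamMean

/-- The distribution of a fair coin. -/
noncomputable def fair : Bool → ℝ := fun _ => 1 / 2

theorem sum_fair : ∑ b, fair b = 1 := by simp [fair]

/-- The mean can be computed by making all draws beforehand. -/
theorem Tree.mean_eq_streamMean {B α : Type} [Fintype B] [Inhabited B] {μ : B → ℝ}
    (hμ : ∑ b, μ b = 1) (F : α → ℝ) (t : Tree B α) : ∀ (Nc Ns Np : ℕ)
    (_ : ∀ ω x y, (t.run ω x y ⟨0, 0, 0⟩).2.c ≤ Nc ∧ (t.run ω x y ⟨0, 0, 0⟩).2.s ≤ Ns ∧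
      (t.run ω x y ⟨0, 0, 0⟩).2.p ≤ Np),
    t.mean μ F = streamMean fair Nc fun ω => streamMean μ Ns fun x => streamMean μ Np fun y =>
      F (t.run ω x y ⟨0, 0, 0⟩).1 := by
  induction t with
  | ret a =>
    intro Nc Ns Np h
    simp only [mean, run, streamMean_const hμ, streamMean_const sum_fair]
  | coin f ih =>
    intro Nc Ns Np h
    have key : ∀ b ω x y, (coin f).run (cons b ω) x y ⟨0, 0, 0⟩ =
        (((f b).run ω x y ⟨0, 0, 0⟩).1, ⟨((f b).run ω x y ⟨0, 0, 0⟩).2.c + 1,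
          ((f b).run ω x y ⟨0, 0, 0⟩).2.s, ((f b).run ω x y ⟨0, 0, 0⟩).2.p⟩) :=
      fun b ω x y => run_cons_coin b ω x y (f b) ⟨0, 0, 0⟩
    -- The bound cannot be zero, because a coin is read; the first coin is split off and the
    -- remaining stream serves the continuation.
    obtain _ | Nc := Nc
    · have := (h (cons true fun _ => true) (fun _ => default) fun _ => default).1
      rw [key] at this
      simp at this
    · simp only [mean, streamMean, key]
      refine Finset.sum_congr rfl fun b _ => ?_
      rw [ih b Nc Ns Np fun ω x y => ?_]
      · rfl
      · have := h (cons b ω) x y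
        rw [key] at this
        exact ⟨by simpa using this.1, this.2⟩
  | drawS f ih =>
    intro Nc Ns Np h
    have key : ∀ b ω x y, (drawS f).run ω (cons b x) y ⟨0, 0, 0⟩ =
        (((f b).run ω x y ⟨0, 0, 0⟩).1, ⟨((f b).run ω x y ⟨0, 0, 0⟩).2.c,
          ((f b).run ω x y ⟨0, 0, 0⟩).2.s + 1, ((f b).run ω x y ⟨0, 0, 0⟩).2.p⟩) :=
      fun b ω x y => run_cons_drawS b ω x y (f b) ⟨0, 0, 0⟩
    obtain _ | Ns := Ns
    · have := (h (fun _ => true) (cons default fun _ => default) fun _ => default).2.1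
      rw [key] at this
      simp at this
    · simp only [mean, streamMean, key, streamMean_sum]
      refine Finset.sum_congr rfl fun b _ => ?_
      rw [ih b Nc Ns Np fun ω x y => ?_]
      have := h ω (cons b x) y
      rw [key] at this
      exact ⟨this.1, by simpa using this.2.1, this.2.2⟩
  | drawP f ih =>
    intro Nc Ns Np h
    have key : ∀ b ω x y, (drawP f).run ω x (cons b y) ⟨0, 0, 0⟩ =
        (((f b).run ω x y ⟨0, 0, 0⟩).1, ⟨((f b).run ω x y ⟨0, 0, 0⟩).2.c,
          ((f b).run ω x y ⟨0, 0, 0⟩).2.s, ((f b).run ω x y ⟨0, 0, 0⟩).2.p + 1⟩) :=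
      fun b ω x y => run_cons_drawP b ω x y (f b) ⟨0, 0, 0⟩
    obtain _ | Np := Np
    · have := (h (fun _ => true) (fun _ => default) (cons default fun _ => default)).2.2
      rw [key] at this
      simp at this
    · simp only [mean, streamMean, key, streamMean_sum]
      refine Finset.sum_congr rfl fun b _ => ?_
      rw [ih b Nc Ns Np fun ω x y => ?_]
      have := h ω x (cons b y)
      rw [key] at this
      exact ⟨this.1, this.2.1, by simpa using this.2.2⟩

/-! ### Sums of independent results and Chebyshev's inequality -/

/-- The sum of the results of independent computations. -/
def sumTree {B : Type} (X : ℕ → Tree B ℕ) : ℕ → Tree B ℕ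
  | 0 => .ret 0
  | N + 1 => (sumTree X N).bind fun a => (X N).bind fun h => .ret (a + h)

/-- Variances add: given the partial sum, the next summand still has mean `m N`, so the cross term
vanishes, and its variance is at most its second moment. -/
theorem sumTree_mean_sq_le {B : Type} [Fintype B] {μ : B → ℝ} (hμ : ∑ b, μ b = 1)
    (hμ₀ : ∀ b, 0 ≤ μ b) (X : ℕ → Tree B ℕ) (m : ℕ → ℝ) (N : ℕ)
    (hm : ∀ i < N, (X i).mean μ (fun h => (h : ℝ)) = m i)
    (hv : ∀ i < N, (X i).mean μ (fun h => (h : ℝ) ^ 2) ≤ 1) :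
    (sumTree X N).mean μ (fun a => ((a : ℝ) - ∑ i ∈ Finset.range N, m i) ^ 2) ≤ N := by
  induction N with
  | zero => simp [sumTree, Tree.mean]
  | succ N ih =>
    have ih := ih (fun i hi => hm i (by omega)) (fun i hi => hv i (by omega))
    have e : ∀ a : ℕ, ((X N).bind fun h => Tree.ret (a + h)).mean μ
        (fun a => ((a : ℝ) - ∑ i ∈ Finset.range (N + 1), m i) ^ 2) ≤
        ((a : ℝ) - ∑ i ∈ Finset.range N, m i) ^ 2 + 1 := by
      intro a
      rw [Tree.mean_bind]
      set u := (a : ℝ) - ∑ i ∈ Finset.range N, m i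
      have : ∀ h : ℕ, (Tree.ret (a + h) : Tree B ℕ).mean μ
          (fun a => ((a : ℝ) - ∑ i ∈ Finset.range (N + 1), m i) ^ 2) =
          (h : ℝ) ^ 2 + (2 * (u - m N) * h + (u - m N) ^ 2) := by
        intro h
        simp only [Tree.mean, Finset.sum_range_succ, u]
        push_cast
        ring
      simp only [this, Tree.mean_add, Tree.mean_mul_left, Tree.mean_const hμ]
      rw [hm N (by omega)]
      have := hv N (by omega)
      nlinarith [sq_nonneg (m N)]
    rw [sumTree, Tree.mean_bind]
    refine (Tree.mean_mono hμ₀ _ e).trans ?_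
    rw [Tree.mean_add, Tree.mean_const hμ]
    push_cast
    linarith

/-- Chebyshev's inequality. -/
theorem Tree.mean_indicator_le {B : Type} [Fintype B] {μ : B → ℝ} (hμ₀ : ∀ b, 0 ≤ μ b)
    (t : Tree B ℕ) (p : ℕ → Prop) [DecidablePred p] {c V g : ℝ} (hg : 0 < g)
    (hV : t.mean μ (fun a => ((a : ℝ) - c) ^ 2) ≤ V)
    (hp : ∀ a, p a → g ≤ |(a : ℝ) - c|) :
    t.mean μ (fun a => if p a then 1 else 0) ≤ V / g ^ 2 := by
  have h : t.mean μ (fun a => if p a then (1 : ℝ) else 0) ≤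
      t.mean μ (fun a => (1 / g ^ 2) * ((a : ℝ) - c) ^ 2) := by
    refine Tree.mean_mono hμ₀ _ fun a => ?_
    split_ifs with h
    · have := hp a h
      rw [← sq_abs ((a : ℝ) - c), one_div, inv_mul_eq_div, le_div_iff₀ (by positivity), one_mul]
      exact pow_le_pow_left₀ hg.le this 2
    · positivity
  rw [Tree.mean_mul_left] at h
  refine h.trans ?_
  rw [one_div, inv_mul_eq_div]
  gcongr

end SeqPred

namespace SeqPred

/-! ### Parity check codes and planted distributions -/

/-- Syndromes: `M` pairs of bits. -/
abbrev Syn (M : ℕ) : Type := Fin M → ZMod 2 × ZMod 2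

theorem Syn.add_self {M : ℕ} (z : Syn M) : z + z = 0 := by
  funext j
  exact Prod.ext (CharTwo.add_self_eq_zero _) (CharTwo.add_self_eq_zero _)

theorem card_syn (M : ℕ) : Fintype.card (Syn M) = 4 ^ M := by
  simp

/-- The sign of a bit. -/
noncomputable def sg (x : ZMod 2) : ℝ := if x = 0 then 1 else -1

theorem zmod_two_eq (x : ZMod 2) : x = 0 ∨ x = 1 := by
  revert x; decide

theorem sg_add (x y : ZMod 2) : sg (x + y) = sg x * sg y := by
  have h : (1 : ZMod 2) + 1 = 0 := rfl
  rcases zmod_two_eq x with rfl | rfl <;> rcases zmod_two_eq y with rfl | rfl <;> simp [sg, h]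

/-- The standard bilinear form. -/
def pr {M : ℕ} (u z : Syn M) : ZMod 2 := ∑ j, ((u j).1 * (z j).1 + (u j).2 * (z j).2)

theorem pr_add_left {M : ℕ} (u u' z : Syn M) : pr (u + u') z = pr u z + pr u' z := by
  simp only [pr, ← Finset.sum_add_distrib]
  exact Finset.sum_congr rfl fun j _ => by simp; ring

theorem pr_comm {M : ℕ} (u z : Syn M) : pr u z = pr z u := by
  simp only [pr, mul_comm]

theorem pr_add_right {M : ℕ} (u z z' : Syn M) : pr u (z + z') = pr u z + pr u z' := by
  rw [pr_comm, pr_add_left, pr_comm z, pr_comm z']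

theorem pr_zero_left {M : ℕ} (z : Syn M) : pr 0 z = 0 := by simp [pr]

theorem exists_pr_eq_one {M : ℕ} {z : Syn M} (hz : z ≠ 0) : ∃ u, pr u z = 1 := by
  obtain ⟨j, hj⟩ := Function.ne_iff.1 hz
  have key : ∀ a b : ZMod 2, (a, b) ≠ 0 → ∃ e : ZMod 2 × ZMod 2, e.1 * a + e.2 * b = 1 := by
    decide
  obtain ⟨e, he⟩ := key _ _ hj
  refine ⟨Pi.single j e, ?_⟩
  rw [pr, Finset.sum_eq_single j]
  · simpa using he
  · intro i _ hi
    simp [Pi.single_eq_of_ne hi]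
  · simp

/-- Orthogonality of characters: for `z ≠ 0` a shift of `u` by some `e` with `pr e z = 1` changes
the sign of the sum. -/
theorem sum_sg_pr {M : ℕ} (z : Syn M) : ∑ u, sg (pr u z) = if z = 0 then (4 : ℝ) ^ M else 0 := by
  split_ifs with hz
  · subst hz
    simp only [pr_comm _ 0, pr_zero_left]
    simp [sg]
  · obtain ⟨e, he⟩ := exists_pr_eq_one hz
    have h : ∑ u, sg (pr u z) = ∑ u, sg (pr (u + e) z) :=
      (Fintype.sum_equiv (Equiv.addRight e) _ _ fun _ => rfl).symm
    simp only [pr_add_left, he, sg_add] at h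
    rw [← Finset.sum_mul] at h
    have : sg 1 = -1 := by simp [sg]
    rw [this] at h
    linarith

/-- A function of one bit is an affine function of its sign, and the signs cancel by orthogonality.
-/
theorem sum_pr {M : ℕ} {u : Syn M} (hu : u ≠ 0) (f : ZMod 2 → ℝ) :
    ∑ z, f (pr u z) = 4 ^ M / 2 * (f 0 + f 1) := by
  have h : ∀ x, f x = (f 0 + f 1) / 2 + (f 0 - f 1) / 2 * sg x := by
    intro x
    rcases zmod_two_eq x with rfl | rfl <;> simp [sg] <;> ring
  have h₀ : ∑ z, sg (pr u z) = 0 := by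
    simp only [pr_comm u]
    rw [sum_sg_pr, if_neg hu]
  calc ∑ z, f (pr u z) = ∑ z, ((f 0 + f 1) / 2 + (f 0 - f 1) / 2 * sg (pr u z)) :=
        Finset.sum_congr rfl fun z _ => h _
    _ = _ := by
        rw [Finset.sum_add_distrib, ← Finset.mul_sum, h₀, Finset.sum_const, Finset.card_univ,
          card_syn]
        simp
        ring

/-- The Gilbert–Varshamov bound. -/
theorem exists_code {M k d : ℕ} (h : 4 ^ M * 17 ^ k * 16 ^ d < 32 ^ k) :
    ∃ col : Fin k → Syn M, ∀ u ≠ 0, d < (Finset.univ.filter fun i => pr u (col i) ≠ 0).card := by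
  -- An exponential moment: the product of these factors over the columns is `16 ^ (-weight)`. Each
  -- factor has mean `(1 + 1/16) / 2 = 17/32` for random columns, so some matrix makes the sum over
  -- all nonzero `u` smaller than `16 ^ (-d)`, and then no term can belong to a weight of at most
  -- `d`.
  let g : ZMod 2 → ℝ := fun x => if x ≠ 0 then 1 / 16 else 1
  have hg : ∀ x, 0 ≤ g x := fun x => by simp only [g]; split_ifs <;> norm_num
  have h1 : ∑ col : Fin k → Syn M, ∑ u ∈ Finset.univ.filter (fun u : Syn M => u ≠ 0),
      ∏ i, g (pr u (col i)) ≤ 4 ^ M * (4 ^ M * (17 / 32)) ^ k := by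
    rw [Finset.sum_comm]
    have : ∀ u ∈ Finset.univ.filter (fun u : Syn M => u ≠ 0),
        ∑ col : Fin k → Syn M, ∏ i, g (pr u (col i)) = (4 ^ M * (17 / 32)) ^ k := by
      intro u hu
      have hu : u ≠ 0 := by simpa using hu
      rw [← Fintype.piFinset_univ, ← Finset.prod_univ_sum (fun _ => Finset.univ)
        (fun _ z => g (pr u z))]
      rw [Finset.prod_const, sum_pr hu]
      simp [g]
      congr 1
      ring
    rw [Finset.sum_congr rfl this, Finset.sum_const, nsmul_eq_mul]
    refine mul_le_mul_of_nonneg_right ?_ (by positivity)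
    have := Finset.card_filter_le (Finset.univ : Finset (Syn M)) (fun u => u ≠ 0)
    rw [Finset.card_univ, card_syn] at this
    exact_mod_cast this
  have h2 : (4 : ℝ) ^ M * (4 ^ M * (17 / 32)) ^ k < (4 ^ M) ^ k * (1 / 16) ^ d := by
    have h' : (4 : ℝ) ^ M * 17 ^ k * 16 ^ d < 32 ^ k := by exact_mod_cast h
    rw [mul_pow, div_pow, div_pow, one_pow, mul_one_div, lt_div_iff₀ (by positivity)]
    have : (4 : ℝ) ^ M * ((4 ^ M) ^ k * (17 ^ k / 32 ^ k)) * 16 ^ d =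
        (4 ^ M) ^ k * ((4 ^ M * 17 ^ k * 16 ^ d) / 32 ^ k) := by ring
    rw [this]
    refine mul_lt_of_lt_one_right (by positivity) ?_
    rwa [div_lt_one (by positivity)]
  obtain ⟨col, -, hcol⟩ : ∃ col ∈ (Finset.univ : Finset (Fin k → Syn M)),
      ∑ u ∈ Finset.univ.filter (fun u : Syn M => u ≠ 0), ∏ i, g (pr u (col i)) < (1 / 16) ^ d := by
    refine Finset.exists_lt_of_sum_lt (h1.trans_lt (h2.trans_le (le_of_eq ?_)))
    simp
  refine ⟨col, fun u hu => ?_⟩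
  have h3 : ∏ i, g (pr u (col i)) < (1 / 16) ^ d :=
    (Finset.single_le_sum (f := fun u => ∏ i, g (pr u (col i)))
      (fun u _ => Finset.prod_nonneg fun i _ => hg _)
      (by simpa using hu)).trans_lt hcol
  simp only [g, Finset.prod_ite, Finset.prod_const, one_pow, mul_one] at h3
  by_contra hc
  exact absurd h3 (not_lt.2 (pow_le_pow_of_le_one (by norm_num) (by norm_num) (not_lt.1 hc)))

section Syndrome

variable {M k : ℕ} (col : Fin k → Syn M)

/-- The syndrome of a bit vector with respect to the parity check matrix with columns `col`. -/
def syn (v : Fin k → Bool) : Syn M := ∑ i, if v i then col i else 0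

theorem syn_xor (v w : Fin k → Bool) :
    syn col (fun i => xor (v i) (w i)) = syn col v + syn col w := by
  simp only [syn, ← Finset.sum_add_distrib]
  refine Finset.sum_congr rfl fun i _ => ?_
  by_cases hv : v i = true <;> by_cases hw : w i = true <;> simp [hv, hw, Syn.add_self]

theorem syn_single (i : Fin k) : syn col (fun l => decide (l = i)) = col i := by
  simp [syn]

theorem xor_involutive {k : ℕ} (w : Fin k → Bool) :
    Function.Involutive fun (v : Fin k → Bool) i => xor (v i) (w i) :=
  fun v => by funext i; simp

theorem sum_xor {k : ℕ} (w : Fin k → Bool) (F : (Fin k → Bool) → ℝ) :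
    ∑ v : Fin k → Bool, F (fun i => xor (v i) (w i)) = ∑ v, F v :=
  Fintype.sum_equiv (xor_involutive w).toPerm _ _ fun _ => rfl

variable {col} {d : ℕ}

/-- Fixing at most `d` bits leaves the syndrome uniform, because each nontrivial character of the
syndrome depends on more than `d` bits and hence on a free one. The proof expands `F` in characters.
-/
theorem sum_syn (hcol : ∀ u ≠ 0, d < (Finset.univ.filter fun i => pr u (col i) ≠ 0).card)
    {S : Finset (Fin k)} (hS : S.card ≤ d) (a : Fin k → Bool) (F : Syn M → ℝ) :
    ∑ v with ∀ i ∈ S, v i = a i, F (syn col v) =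
      2 ^ k * (1 / 2) ^ S.card / 4 ^ M * ∑ z, F z := by
  have h4 : (4 : ℝ) ^ M ≠ 0 := by positivity
  have hF : ∀ z, F z = ∑ z', F z' * (1 / 4 ^ M * ∑ u, sg (pr u (z + z'))) := by
    intro z
    rw [Finset.sum_eq_single z]
    · rw [sum_sg_pr, if_pos (Syn.add_self z)]
      field_simp
    · intro z' _ hz'
      rw [sum_sg_pr, if_neg, mul_zero, mul_zero]
      intro h
      apply hz'
      calc z' = z + (z + z') := by rw [← add_assoc, Syn.add_self, zero_add]
        _ = z := by rw [h, add_zero]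
    · simp
  have hchar : ∀ u : Syn M, ∑ v with ∀ i ∈ S, v i = a i, sg (pr u (syn col v)) =
      if u = 0 then 2 ^ k * (1 / 2) ^ S.card else 0 := by
    intro u
    split_ifs with hu
    · subst hu
      have e : Finset.univ.filter (fun v : Fin k → Bool => ∀ i ∈ S, v i = a i) =
          Fintype.piFinset fun i => if i ∈ S then {a i} else Finset.univ := by
        ext v
        simp only [Finset.mem_filter, Finset.mem_univ, true_and, Fintype.mem_piFinset]
        refine forall_congr' fun i => ?_
        split_ifs with h <;> simp [h]
      simp only [pr_zero_left]
      rw [Finset.sum_const, e, Fintype.card_piFinset, nsmul_eq_mul]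
      have e2 : ∀ i : Fin k, ((if i ∈ S then {a i} else Finset.univ : Finset Bool)).card =
          if i ∈ S then 1 else 2 := by
        intro i; split_ifs <;> simp
      simp only [e2, Finset.prod_ite, Finset.prod_const, one_pow, one_mul]
      have e3 : (2 : ℝ) ^ k = 2 ^ (Finset.univ.filter fun i => i ∉ S).card * 2 ^ S.card := by
        rw [← pow_add]
        congr 1
        have := Finset.card_compl_add_card S
        rw [Fintype.card_fin] at this
        refine this.symm.trans ?_
        congr 2
        ext i; simp
      rw [e3, mul_assoc, ← mul_pow]
      simp [sg]
    -- A coordinate outside `S` on which the character depends: flipping it preserves the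
    -- constraints and changes the sign of every term.
    · obtain ⟨i, hi, hiS⟩ := Finset.exists_mem_notMem_of_card_lt_card (hS.trans_lt (hcol u hu))
      have hi : pr u (col i) = 1 := (zmod_two_eq _).resolve_left (by simpa using hi)
      have hflip : ∑ v : Fin k → Bool with ∀ i ∈ S, v i = a i, sg (pr u (syn col v)) =
          ∑ v : Fin k → Bool with ∀ i ∈ S, v i = a i,
            sg (pr u (syn col fun l => xor (v l) (decide (l = i)))) := by
        refine Finset.sum_nbij' (fun v l => xor (v l) (decide (l = i)))
          (fun v l => xor (v l) (decide (l = i))) ?_ ?_ ?_ ?_ ?_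
        · intro v hv
          simp only [Finset.mem_filter, Finset.mem_univ, true_and] at hv ⊢
          intro l hl
          have : l ≠ i := fun e => hiS (e ▸ hl)
          simp [this, hv l hl]
        · intro v hv
          simp only [Finset.mem_filter, Finset.mem_univ, true_and] at hv ⊢
          intro l hl
          have : l ≠ i := fun e => hiS (e ▸ hl)
          simp [this, hv l hl]
        · intro v _; funext l; simp
        · intro v _; funext l; simp
        · intro v _
          congr 3
          funext l; simp
      simp only [syn_xor, syn_single, pr_add_right, sg_add, hi] at hflip
      rw [← Finset.sum_mul] at hflip
      have : sg 1 = -1 := by simp [sg]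
      rw [this] at hflip
      linarith
  calc ∑ v with ∀ i ∈ S, v i = a i, F (syn col v)
      = ∑ v with ∀ i ∈ S, v i = a i, ∑ z', ∑ u, F z' * (1 / 4 ^ M) * sg (pr u z') *
          sg (pr u (syn col v)) := by
        refine Finset.sum_congr rfl fun v _ => ?_
        rw [hF]
        refine Finset.sum_congr rfl fun z' _ => ?_
        rw [Finset.mul_sum, Finset.mul_sum]
        refine Finset.sum_congr rfl fun u _ => ?_
        rw [pr_add_right, sg_add]
        ring
    _ = ∑ z', ∑ u, F z' * (1 / 4 ^ M) * sg (pr u z') *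
          ∑ v with ∀ i ∈ S, v i = a i, sg (pr u (syn col v)) := by
        rw [Finset.sum_comm]
        refine Finset.sum_congr rfl fun z' _ => ?_
        rw [Finset.sum_comm]
        refine Finset.sum_congr rfl fun u _ => ?_
        rw [Finset.mul_sum]
    _ = _ := by
        simp only [hchar, mul_ite, mul_zero, Finset.sum_ite_eq', Finset.mem_univ, if_true,
          pr_zero_left]
        rw [Finset.mul_sum]
        refine Finset.sum_congr rfl fun z _ => ?_
        simp only [sg, if_true]
        ring

/-! ### The planted distribution given by a code, and its noisy syndrome -/

variable (col) in
/-- The uniform distribution on the vectors with syndrome `0`. -/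
noncomputable def codeDist (v : Fin k → Bool) : ℝ := if syn col v = 0 then 4 ^ M / 2 ^ k else 0

theorem sum_codeDist (hcol : ∀ u ≠ 0, d < (Finset.univ.filter fun i => pr u (col i) ≠ 0).card)
    {S : Finset (Fin k)} (hS : S.card ≤ d) (a : Fin k → Bool) :
    ∑ v with ∀ i ∈ S, v i = a i, codeDist col v = (1 / 2) ^ S.card := by
  have := sum_syn hcol hS a fun z => if z = 0 then (4 : ℝ) ^ M / 2 ^ k else 0
  simp only [Finset.sum_ite_eq', Finset.mem_univ, if_true] at this
  simp only [codeDist, this]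
  field_simp

theorem isDistribution_codeDist
    (hcol : ∀ u ≠ 0, d < (Finset.univ.filter fun i => pr u (col i) ≠ 0).card) :
    IsDistribution (codeDist col) := by
  refine ⟨fun v => ?_, ?_⟩
  · unfold codeDist; split_ifs <;> positivity
  · simpa using sum_codeDist hcol (S := ∅) (by simp) fun _ => false

/-- Uniformity on all `k` coordinates fails, since the zero vector has mass `4 ^ M / 2 ^ k`, too
much when `M > 0`. The complexity is the first order at which uniformity fails; it exceeds `d`
because all orders up to `d` are uniform. -/
theorem exists_hasComplexity (hM : 0 < M)
    (hcol : ∀ u ≠ 0, d < (Finset.univ.filter fun i => pr u (col i) ≠ 0).card) :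
    ∃ r, d < r ∧ HasComplexity (codeDist col) r := by
  classical
  have hex : ∃ r, ¬ WiseUniform (codeDist col) r := by
    refine ⟨k, fun h => ?_⟩
    have h1 := h Finset.univ (by simp) fun _ => false
    have h2 : Finset.univ.filter (fun v : Fin k → Bool => ∀ i ∈ Finset.univ, v i = false) =
        {fun _ => false} := by
      ext v; simp [funext_iff]
    rw [h2, Finset.sum_singleton] at h1
    have h3 : syn col (fun _ => false) = 0 := by simp [syn]
    rw [codeDist, if_pos h3, Finset.card_univ, Fintype.card_fin, one_div, inv_pow,
      div_eq_mul_inv] at h1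
    have h4 : (4 : ℝ) ^ M = 1 := by
      have : ((2 : ℝ) ^ k)⁻¹ ≠ 0 := by positivity
      exact mul_right_cancel₀ this (by rw [h1, one_mul])
    have h5 : (1 : ℝ) < 4 ^ M := one_lt_pow₀ (by norm_num) hM.ne'
    linarith
  have hle : ∀ d' ≤ d, WiseUniform (codeDist col) d' := fun d' hd' S hS a =>
    sum_codeDist hcol (hS.trans hd') a
  have hd : d < Nat.find hex := by
    by_contra hc
    exact Nat.find_spec hex (hle _ (not_lt.1 hc))
  exact ⟨Nat.find hex, hd, by omega, not_not.1 (Nat.find_min hex (by omega)), Nat.find_spec hex⟩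

/-- The distribution of the syndrome of a noisy codeword. -/
noncomputable def noise (M : ℕ) (η : ℝ) (z : Syn M) : ℝ :=
  (1 - η) * (if z = 0 then 1 else 0) + η * (1 / 4 ^ M)

theorem noise_nonneg {η : ℝ} (h₀ : 0 ≤ η) (h₁ : η ≤ 1) (z : Syn M) : 0 ≤ noise M η z := by
  unfold noise
  have : (0 : ℝ) ≤ if z = 0 then 1 else 0 := by split_ifs <;> norm_num
  have := mul_nonneg (sub_nonneg.2 h₁) this
  positivity

theorem sum_noise (M : ℕ) (η : ℝ) : ∑ z, noise M η z = 1 := by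
  simp only [noise, Finset.sum_add_distrib, ← Finset.mul_sum]
  simp

/-- The syndrome is zero on the support of `codeDist` and uniform for a uniform vector, so the noise
of the clause distribution becomes the noise of the syndrome at the same rate. -/
theorem sum_noisy_codeDist
    (hcol : ∀ u ≠ 0, d < (Finset.univ.filter fun i => pr u (col i) ≠ 0).card) (η : ℝ)
    (F : Syn M → ℝ) :
    ∑ v, ((1 - η) * codeDist col v + η * (1 / 2) ^ k) * F (syn col v) =
      ∑ z, noise M η z * F z := by
  have h1 := sum_syn hcol (S := ∅) (by simp) (fun _ => false)
    fun z => (if z = 0 then (4 : ℝ) ^ M / 2 ^ k else 0) * F z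
  have h2 := sum_syn hcol (S := ∅) (by simp) (fun _ => false) F
  simp only [Finset.notMem_empty, false_imp_iff, implies_true, Finset.filter_true,
    Finset.card_empty, pow_zero, mul_one, ite_mul, zero_mul, Finset.sum_ite_eq', Finset.mem_univ,
    if_true] at h1 h2
  have e : ∀ v, ((1 - η) * codeDist col v + η * (1 / 2) ^ k) * F (syn col v) =
      (1 - η) * (if syn col v = 0 then 4 ^ M / 2 ^ k * F (syn col v) else 0) +
        η * (1 / 2) ^ k * F (syn col v) := by
    intro v
    unfold codeDist
    split_ifs <;> ring
  simp only [e, Finset.sum_add_distrib, ← Finset.mul_sum, noise, add_mul, h1, h2]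
  have e2 : ∀ z : Syn M, (1 - η) * (if z = 0 then 1 else 0) * F z =
      if z = 0 then (1 - η) * F z else 0 := by
    intro z; split_ifs <;> simp
  simp only [e2, Finset.sum_ite_eq', Finset.mem_univ, if_true]
  have h2k : ((1 : ℝ) / 2) ^ k = 1 / 2 ^ k := by rw [div_pow, one_pow]
  rw [h2k]
  field_simp

end Syndrome

end SeqPred

namespace SeqPred

/-! ### The loss of a predictor which bets on a wrong letter -/

/-- `a` is the first of the numbers below `n` where `w` is maximal. -/
def IsArgmax (n : ℕ) (w : ℕ → ℕ) (a : ℕ) : Prop :=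
  a < n ∧ ∀ b < n, w b ≤ w a ∧ (b < a → w b < w a)

theorem IsArgmax.unique {n : ℕ} {w : ℕ → ℕ} {a b : ℕ} (ha : IsArgmax n w a)
    (hb : IsArgmax n w b) : a = b := by
  by_contra h
  rcases lt_or_gt_of_ne h with h | h
  · have := (hb.2 a ha.1).2 h
    have := (ha.2 b hb.1).1
    omega
  · have := (ha.2 b hb.1).2 h
    have := (hb.2 a ha.1).1
    omega

theorem exists_isArgmax {n : ℕ} (hn : 0 < n) (w : ℕ → ℕ) : ∃ a, IsArgmax n w a := by
  induction n, hn using Nat.le_induction with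
  | base => exact ⟨0, by omega, fun b hb => by
      obtain rfl : b = 0 := by omega
      exact ⟨le_rfl, by omega⟩⟩
  | succ n hn ih =>
    obtain ⟨a, ha, h⟩ := ih
    by_cases hw : w a < w n
    · refine ⟨n, by omega, fun b hb => ?_⟩
      rcases Nat.lt_succ_iff_lt_or_eq.1 hb with hb | rfl
      · have := (h b hb).1
        omega
      · omega
    · refine ⟨a, by omega, fun b hb => ?_⟩
      rcases Nat.lt_succ_iff_lt_or_eq.1 hb with hb | rfl
      · exact h b hb
      · omega

section Loss

variable {n : ℕ}

theorem ofWeights_nonneg (w : Fin n → ℕ) (a : Fin n) : 0 ≤ ofWeights w a := by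
  unfold ofWeights
  split_ifs <;> positivity

theorem sum_ofWeights (hn : 0 < n) (w : Fin n → ℕ) : ∑ a, ofWeights w a = 1 := by
  unfold ofWeights
  split_ifs with h
  · have : (n : ℝ) ≠ 0 := by positivity
    simp [this]
  · have : ((∑ b, w b : ℕ) : ℝ) ≠ 0 := by exact_mod_cast h
    rw [← Finset.sum_div, ← Nat.cast_sum, div_self this]

theorem isMode_ofWeights (w : ℕ → ℕ) (a : Fin n) :
    IsMode (ofWeights fun b : Fin n => w b) a ↔ IsArgmax n w a := by
  have key : ∀ b c : Fin n,
      ((ofWeights fun b : Fin n => w b) b < (ofWeights fun b : Fin n => w b) c ↔ w b < w c) := by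
    intro b c
    unfold ofWeights
    split_ifs with h
    · rw [Finset.sum_eq_zero_iff] at h
      simp [h b, h c]
    · have : (0 : ℝ) < ((∑ b : Fin n, w b : ℕ) : ℝ) := by exact_mod_cast Nat.pos_of_ne_zero h
      rw [div_lt_div_iff_of_pos_right this]
      exact_mod_cast Iff.rfl
  constructor
  · intro h
    refine ⟨a.2, fun b hb => ?_⟩
    have := h ⟨b, hb⟩
    rw [← not_lt, key, key] at this
    exact ⟨not_lt.1 this.1, fun hba => this.2 hba⟩
  · intro h b
    rw [← not_lt, key, key]
    have := h.2 b b.2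
    exact ⟨not_lt.2 this.1, fun hba => this.2 hba⟩

theorem hitProb_eq {Q : Fin n → ℝ} {m : Fin n} (hm : IsMode Q m) (P : Fin n → ℝ) :
    hitProb P Q = P m := by
  classical
  have : Finset.univ.filter (IsMode Q) = {m} := by
    ext b
    simp only [Finset.mem_filter, Finset.mem_univ, true_and, Finset.mem_singleton]
    refine ⟨fun hb => ?_, fun hb => hb ▸ hm⟩
    by_contra h
    rcases lt_or_gt_of_ne h with h | h
    · exact absurd ((hm b).2 h) (not_lt.2 (hb m).1)
    · exact absurd ((hb m).2 h) (not_lt.2 (hm b).1)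
  unfold hitProb
  convert Finset.sum_singleton P m

theorem two_thirds_le_log : (2 / 3 : ℝ) ≤ Real.log (128 / 65) := by
  rw [Real.le_log_iff_exp_le (by norm_num)]
  have h1 : Real.exp (2 / 3) ^ 3 = Real.exp 1 ^ 2 := by
    rw [← Real.exp_nat_mul, ← Real.exp_nat_mul]
    norm_num
  have h2 := Real.exp_one_lt_d9
  have h3 : Real.exp 1 ^ 2 ≤ 2.7182818286 ^ 2 :=
    pow_le_pow_left₀ (Real.exp_pos _).le h2.le 2
  refine le_of_pow_le_pow_left₀ (n := 3) (by norm_num) (by norm_num) ?_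
  rw [h1]
  refine h3.trans ?_
  norm_num

/-- The variational bound: the divergence is at least the mean of `log c` under `P` plus one minus
the mean of `c` under `Q`, for any positive function `c`. -/
theorem kl_ge {P Q : Fin n → ℝ} (hP : ∀ x, 0 ≤ P x) (hP₁ : ∑ x, P x = 1) (hQ : ∀ x, 0 ≤ Q x)
    (hQ₁ : ∑ x, Q x = 1) (hPQ : ∀ x, Q x = 0 → P x = 0) {a : Fin n} (ha : Q a ≤ 1 / 2) :
    2 / 3 - 5 * (1 - P a) ≤ ∑ x, P x * Real.log (P x / Q x) := by
  -- The values have sum `2`, so that the mean of `c` under `Q` is at most one when `Q a ≤ 1 / 2`.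
  -- Their ratio `64` has logarithm at most `5`, which gives the penalty for `P a < 1`, and `log
  -- (128 / 65) ≥ 2 / 3`.
  let c : Fin n → ℝ := fun x => if x = a then 128 / 65 else 2 / 65
  have hc : ∀ x, 0 < c x := fun x => by simp only [c]; split_ifs <;> norm_num
  have h1 : ∀ x, P x - c x * Q x + P x * Real.log (c x) ≤ P x * Real.log (P x / Q x) := by
    intro x
    rcases (hP x).eq_or_lt with h | h
    · rw [← h]
      have := mul_nonneg (hc x).le (hQ x)
      simpa using this
    · have hq : 0 < Q x := (hQ x).lt_of_ne fun e => h.ne' (hPQ x e.symm)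
      have e : P x / Q x = P x / (c x * Q x) * c x := by
        have := (hc x).ne'
        field_simp
      have hpos : 0 < P x / (c x * Q x) := div_pos h (mul_pos (hc x) hq)
      rw [e, Real.log_mul hpos.ne' (hc x).ne']
      have := Real.one_sub_inv_le_log_of_pos hpos
      have := mul_le_mul_of_nonneg_left this h.le
      rw [inv_div, mul_sub, mul_one, mul_div_cancel₀ _ h.ne'] at this
      linarith
  have h2 := Finset.sum_le_sum fun x (_ : x ∈ Finset.univ) => h1 x
  rw [Finset.sum_add_distrib, Finset.sum_sub_distrib, hP₁] at h2
  have h3 : ∑ x, c x * Q x = 126 / 65 * Q a + 2 / 65 := by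
    have : ∀ x, c x * Q x = (if x = a then 126 / 65 * Q x else 0) + 2 / 65 * Q x := by
      intro x; simp only [c]; split_ifs <;> ring
    simp only [this, Finset.sum_add_distrib, Finset.sum_ite_eq', Finset.mem_univ, if_true,
      ← Finset.mul_sum, hQ₁]
    ring
  have h4 : ∑ x, P x * Real.log (c x) = P a * Real.log 64 + Real.log (2 / 65) := by
    have h64 : Real.log (128 / 65) = Real.log 64 + Real.log (2 / 65) := by
      rw [← Real.log_mul (by norm_num) (by norm_num)]; norm_num
    have : ∀ x, P x * Real.log (c x) =
        (if x = a then P x * Real.log 64 else 0) + Real.log (2 / 65) * P x := by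
      intro x; simp only [c]; split_ifs
      · rw [h64]; ring
      · ring
    simp only [this, Finset.sum_add_distrib, Finset.sum_ite_eq', Finset.mem_univ, if_true,
      ← Finset.mul_sum, hP₁]
    ring
  have h5 : Real.log (2 / 65) = Real.log (128 / 65) - Real.log 64 := by
    rw [← Real.log_div (by norm_num) (by norm_num)]; norm_num
  have h6 : Real.log 64 ≤ 5 := by
    have : (64 : ℝ) = 2 ^ 6 := by norm_num
    rw [this, Real.log_pow]
    have := Real.log_two_lt_d9
    norm_num
    linarith
  have h7 : P a ≤ 1 := hP₁ ▸ Finset.single_le_sum (fun x _ => hP x) (Finset.mem_univ a)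
  have h8 := two_thirds_le_log
  rw [h3, h4, h5] at h2
  nlinarith

/-- A bet on `m ≠ a` means `Q a ≤ Q m`, hence `Q a ≤ 1 / 2`. Then `kl_ge` treats the divergence, and
for the other two losses the value is at least `P a - P m ≥ 2 P a - 1`. One bound for all three
losses makes the rest of the proof independent of the loss. -/
theorem loss_ge (L : Loss) {P Q : Fin n → ℝ} (hP : ∀ x, 0 ≤ P x) (hP₁ : ∑ x, P x = 1)
    (hQ : ∀ x, 0 ≤ Q x) (hQ₁ : ∑ x, Q x = 1) {m : Fin n} (hm : IsMode Q m) (a : Fin n) :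
    ENNReal.ofReal (2 / 3 * (if m = a then 0 else 1) - 5 * (1 - P a)) ≤ L.eval P Q := by
  have hPa : P a ≤ 1 := hP₁ ▸ Finset.single_le_sum (fun x _ => hP x) (Finset.mem_univ a)
  by_cases hma : m = a
  · rw [if_pos hma, ENNReal.ofReal_of_nonpos (by linarith)]
    exact zero_le
  · rw [if_neg hma, mul_one]
    have hpair : ∀ f : Fin n → ℝ, (∀ x, 0 ≤ f x) → f a + f m ≤ ∑ x, f x := by
      intro f hf
      rw [← Finset.sum_pair (Ne.symm hma)]
      exact Finset.sum_le_sum_of_subset_of_nonneg (Finset.subset_univ _) fun x _ _ => hf x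
    have hPm : P a + P m ≤ 1 := hP₁ ▸ hpair P hP
    have hQm : Q a + Q m ≤ 1 := hQ₁ ▸ hpair Q hQ
    have hQa : Q a ≤ Q m := (hm a).1
    cases L with
    | kl =>
      simp only [Loss.eval, klLoss]
      split_ifs with h
      · exact ENNReal.ofReal_le_ofReal (kl_ge hP hP₁ hQ hQ₁ h (by linarith))
      · exact le_top
    | l1 =>
      refine ENNReal.ofReal_le_ofReal ?_
      have := hpair (fun x => |P x - Q x|) fun x => abs_nonneg _
      have h1 := le_abs_self (P a - Q a)
      have h2 := neg_abs_le (P m - Q m)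
      linarith
    | zeroOne =>
      refine ENNReal.ofReal_le_ofReal ?_
      rw [hitProb_eq hm]
      have := le_ciSup (Set.finite_range P).bddAbove a
      linarith

end Loss

end SeqPred

namespace SeqPred

/-! ### General facts on hidden Markov models -/

theorem HMM.probFrom_nonneg {T n : ℕ} (M : HMM T n) (h : Fin T) (w : List (Fin n)) :
    0 ≤ M.probFrom h w := by
  induction w generalizing h with
  | nil => exact zero_le_one
  | cons a w ih =>
    exact mul_nonneg (M.emit_nonneg _ _)
      (Finset.sum_nonneg fun h' _ => mul_nonneg (M.trans_nonneg _ _) (ih h'))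

theorem HMM.prob_nonneg {T n : ℕ} (M : HMM T n) (w : List (Fin n)) : 0 ≤ M.prob w :=
  Finset.sum_nonneg fun h _ => mul_nonneg (M.init_nonneg h) (M.probFrom_nonneg h w)

theorem HMM.prob_nil {T n : ℕ} (M : HMM T n) : M.prob [] = 1 := by
  simp [HMM.prob, HMM.probFrom, M.init_sum]

theorem HMM.sum_probFrom {T n : ℕ} (M : HMM T n) (h : Fin T) (w : List (Fin n)) :
    ∑ a, M.probFrom h (w ++ [a]) = M.probFrom h w := by
  induction w generalizing h with
  | nil => simp [HMM.probFrom, M.trans_sum, M.emit_sum]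
  | cons b w ih =>
    simp only [List.cons_append, HMM.probFrom, ← Finset.mul_sum]
    rw [Finset.sum_comm]
    simp only [← Finset.mul_sum, ih]

theorem HMM.sum_prob {T n : ℕ} (M : HMM T n) (w : List (Fin n)) :
    ∑ a, M.prob (w ++ [a]) = M.prob w := by
  simp only [HMM.prob]
  rw [Finset.sum_comm]
  simp only [← Finset.mul_sum, M.sum_probFrom]

/-! ### Blocks: literals followed by the letters of their noisy syndrome -/

/-- The point mass at `x`. -/
noncomputable def pt {α : Type} [DecidableEq α] (x a : α) : ℝ := if a = x then 1 else 0

theorem pt_nonneg {α : Type} [DecidableEq α] (x a : α) : 0 ≤ pt x a := by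
  unfold pt; split_ifs <;> norm_num

theorem sum_pt_mul {α : Type} [DecidableEq α] [Fintype α] (x : α) (f : α → ℝ) :
    ∑ a, pt x a * f a = f x := by
  simp [pt]

theorem sum_pt {α : Type} [DecidableEq α] [Fintype α] (x : α) : ∑ a, pt x a = 1 := by
  simp [pt]

theorem prod_pt {ι α : Type} [DecidableEq α] [Fintype ι] [DecidableEq ι] (x a : ι → α) :
    ∏ i, pt (x i) (a i) = pt x a := by
  unfold pt
  split_ifs with h
  · subst h; simp
  · obtain ⟨i, hi⟩ := Function.ne_iff.1 h
    exact Finset.prod_eq_zero (Finset.mem_univ i) (if_neg hi)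

/-- The number of a pair of bits. -/
def code (e : ZMod 2 × ZMod 2) : ℕ := e.1.val + 2 * e.2.val

theorem code_lt (e : ZMod 2 × ZMod 2) : code e < 4 := by
  revert e; decide

theorem code_injective : Function.Injective code := by
  intro a b; revert a b; decide

section Block

variable {k M N n : ℕ} [NeZero n]

/-- The letter for the literal with value `b` which belongs to the variable with number `q` in the
`i`-th block of variables. -/
def lit (off : ℕ) (σ : Fin N → Fin k → Bool) (i : Fin k) (q : Fin N) (b : Bool) : Fin n :=
  Fin.ofNat n (off + 2 * (k * q + i) + (xor b (σ q i)).toNat)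

/-- The letters of a block. -/
def mkBlock (off : ℕ) (σ : Fin N → Fin k → Bool) (q : Fin k → Fin N) (v : Fin k → Bool)
    (z : Syn M) : Fin (k + M) → Fin n :=
  Fin.addCases (fun i => lit off σ i (q i) (v i)) fun j => Fin.ofNat n (code (z j))

/-- The distribution of a block: with probability `θ` the default block, otherwise uniformly
distributed literals followed by their syndrome, with noise rate `η`. -/
noncomputable def blockDist (col : Fin k → Syn M) (off : ℕ) (η θ : ℝ) (σ : Fin N → Fin k → Bool)
    (b : Fin (k + M) → Fin n) : ℝ :=
  θ * pt (fun _ => 0) b + (1 - θ) * ∑ z, noise M η z * ∑ v : Fin k → Bool, (1 / 2) ^ k *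
    ∑ q : Fin k → Fin N, (1 / N) ^ k * pt (mkBlock off σ q v (z + syn col v)) b

theorem sum_blockDist_mul (col : Fin k → Syn M) (off : ℕ) (η θ : ℝ) (σ : Fin N → Fin k → Bool)
    (G : (Fin (k + M) → Fin n) → ℝ) :
    ∑ b, blockDist col off η θ σ b * G b =
      θ * G (fun _ => 0) + (1 - θ) * ∑ z, noise M η z * ∑ v : Fin k → Bool, (1 / 2) ^ k *
        ∑ q : Fin k → Fin N, (1 / N) ^ k * G (mkBlock off σ q v (z + syn col v)) := by
  simp only [blockDist, add_mul, Finset.sum_add_distrib, mul_assoc, ← Finset.mul_sum, sum_pt_mul,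
    Finset.sum_mul]
  congr 2
  rw [Finset.sum_comm]
  refine Finset.sum_congr rfl fun z _ => ?_
  rw [← Finset.mul_sum, ← Finset.mul_sum, Finset.sum_comm]
  rw [← Finset.mul_sum, Finset.sum_comm]
  simp_rw [Finset.sum_comm (s := (Finset.univ : Finset (Fin (k + M) → Fin n))), sum_pt_mul]
  rw [Finset.sum_comm]

theorem sum_blockDist (col : Fin k → Syn M) (off : ℕ) (η θ : ℝ) (hN : 0 < N)
    (σ : Fin N → Fin k → Bool) : ∑ b, blockDist (n := n) col off η θ σ b = 1 := by
  have hN' : (N : ℝ) ≠ 0 := by positivity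
  have := sum_blockDist_mul (n := n) col off η θ σ fun _ => 1
  simp only [mul_one] at this
  rw [this]
  have h1 : ∑ q : Fin k → Fin N, (1 / (N : ℝ)) ^ k = 1 := by
    simp only [Finset.sum_const, Finset.card_univ, Fintype.card_fun, Fintype.card_fin, one_div,
      inv_pow, nsmul_eq_mul, Nat.cast_pow]
    exact mul_inv_cancel₀ (by positivity)
  have h2 : ∑ v : Fin k → Bool, (1 / 2 : ℝ) ^ k = 1 := by
    simp
  simp only [h1, mul_one, h2, sum_noise]
  ring

theorem blockDist_nonneg (col : Fin k → Syn M) (off : ℕ) {η θ : ℝ} (hη₀ : 0 ≤ η) (hη₁ : η ≤ 1)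
    (hθ₀ : 0 ≤ θ) (hθ₁ : θ ≤ 1) (σ : Fin N → Fin k → Bool) (b : Fin (k + M) → Fin n) :
    0 ≤ blockDist col off η θ σ b := by
  refine add_nonneg (mul_nonneg hθ₀ (pt_nonneg _ _)) (mul_nonneg (sub_nonneg.2 hθ₁)
    (Finset.sum_nonneg fun z _ => mul_nonneg (noise_nonneg hη₀ hη₁ z)
      (Finset.sum_nonneg fun v _ => mul_nonneg (by positivity)
        (Finset.sum_nonneg fun q _ => mul_nonneg (by positivity) (pt_nonneg _ _)))))

/-! ### The hidden Markov model which outputs independent blocks -/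

/-- The hidden state apart from the position in the block: except in a default block, the value of
the next literal and the syndrome of the literals so far. -/
abbrev Memory (M : ℕ) : Type := Option (Bool × Syn M)

/-- The distribution of the memory at the start of a block. -/
noncomputable def startMem (M : ℕ) (η θ : ℝ) (s : Memory M) : ℝ :=
  θ * pt none s + (1 - θ) * ∑ z, noise M η z * ∑ b, 1 / 2 * pt (some (b, z)) s

/-- The memory syndrome after the `i`-th letter. -/
def nextSyn (col : Fin k → Syn M) (i : ℕ) (b : Bool) (z : Syn M) : Syn M :=
  z + if h : i < k then (if b then col ⟨i, h⟩ else 0) else 0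

/-- The distribution of the memory after the `i`-th letter. -/
noncomputable def moveMem (col : Fin k → Syn M) (i : ℕ) : Memory M → Memory M → ℝ
  | none, s' => pt none s'
  | some (b, z), s' => ∑ b', 1 / 2 * pt (some (b', nextSyn col i b z)) s'

/-- The distribution of the `i`-th letter of a block. -/
noncomputable def emitMem (off : ℕ) (σ : Fin N → Fin k → Bool) (i : ℕ) :
    Memory M → Fin n → ℝ
  | none, a => pt 0 a
  | some (b, z), a =>
      if h : i < k then ∑ q, 1 / (N : ℝ) * pt (lit off σ ⟨i, h⟩ q b) a
      else if h : i - k < M then pt (Fin.ofNat n (code (z ⟨i - k, h⟩))) a else pt 0 a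

variable (col : Fin k → Syn M) (off : ℕ) (η θ : ℝ) (σ : Fin N → Fin k → Bool)

omit [NeZero n] in
theorem sum_startMem_mul (f : Memory M → ℝ) :
    ∑ s, startMem M η θ s * f s =
      θ * f none + (1 - θ) * ∑ z, noise M η z * ∑ b, 1 / 2 * f (some (b, z)) := by
  simp only [startMem, add_mul, Finset.sum_add_distrib, mul_assoc, ← Finset.mul_sum, sum_pt_mul,
    Finset.sum_mul]
  congr 2
  rw [Finset.sum_comm]
  refine Finset.sum_congr rfl fun z _ => ?_
  rw [← Finset.mul_sum, ← Finset.mul_sum, Finset.sum_comm]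
  simp only [sum_pt_mul]

theorem sum_moveMem_mul (i : ℕ) (b : Bool) (z : Syn M) (f : Memory M → ℝ) :
    ∑ s, moveMem col i (some (b, z)) s * f s = ∑ b', 1 / 2 * f (some (b', nextSyn col i b z)) := by
  simp only [moveMem, Finset.sum_mul]
  rw [Finset.sum_comm]
  simp only [mul_assoc, ← Finset.mul_sum, sum_pt_mul]

theorem sum_moveMem (i : ℕ) (s : Memory M) : ∑ s', moveMem col i s s' = 1 := by
  rcases s with _ | ⟨b, z⟩
  · exact sum_pt _
  · have := sum_moveMem_mul col i b z fun _ => 1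
    simpa using this

theorem sum_emitMem (hN : 0 < N) (i : ℕ) (s : Memory M) :
    ∑ a : Fin n, emitMem off σ i s a = 1 := by
  have hN' : (N : ℝ) ≠ 0 := by positivity
  rcases s with _ | ⟨b, z⟩
  · exact sum_pt _
  · simp only [emitMem]
    split_ifs
    · rw [Finset.sum_comm]
      simp only [← Finset.mul_sum, sum_pt]
      simp [hN']
    · exact sum_pt _
    · exact sum_pt _

/-- The probability of the letters from the `i`-th one on up to the end of a block. -/
noncomputable def tailProb : ℕ → Memory M → List (Fin n) → ℝ
  | _, _, [] => 1
  | i, s, a :: l => emitMem off σ i s a * ∑ s', moveMem col i s s' * tailProb (i + 1) s' l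

/-- The letters `B i, …, B (i + r - 1)`. -/
def word (B : ℕ → Fin n) : ℕ → ℕ → List (Fin n)
  | _, 0 => []
  | i, r + 1 => B i :: word B (i + 1) r

omit [NeZero n] in
theorem word_eq (B : ℕ → Fin n) (i r : ℕ) : word B i r = List.ofFn fun t : Fin r => B (i + t) := by
  induction r generalizing i with
  | zero => rfl
  | succ r ih =>
    rw [word, List.ofFn_succ, ih]
    simp [Nat.add_assoc, Nat.add_comm 1]

omit [NeZero n] in
theorem word_add (B : ℕ → Fin n) (i r r' : ℕ) :
    word B i (r + r') = word B i r ++ word B (i + r) r' := by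
  induction r generalizing i with
  | zero => simp [word]
  | succ r ih =>
    rw [Nat.succ_add, word, word, ih, List.cons_append]
    congr 3
    omega

theorem tailProb_none (B : ℕ → Fin n) (i r : ℕ) :
    tailProb col off σ i none (word B i r) = ∏ t ∈ Finset.range r, pt 0 (B (i + t)) := by
  induction r generalizing i with
  | zero => simp [word, tailProb]
  | succ r ih =>
    rw [word, tailProb, Finset.prod_range_succ']
    have : ∀ s', moveMem col i none s' = pt none s' := fun _ => rfl
    simp only [this, sum_pt_mul]
    rw [ih, mul_comm]
    simp [emitMem, Nat.add_assoc, Nat.add_comm 1]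

/-- The mean over the value of the next literal. -/
noncomputable def tailMean (i : ℕ) (z : Syn M) (l : List (Fin n)) : ℝ :=
  ∑ b, 1 / 2 * tailProb col off σ i (some (b, z)) l

theorem tailMean_cons (i : ℕ) (z : Syn M) (a : Fin n) (l : List (Fin n)) :
    tailMean col off σ i z (a :: l) =
      ∑ b, 1 / 2 * (emitMem off σ i (some (b, z)) a *
        tailMean col off σ (i + 1) (nextSyn col i b z) l) := by
  simp only [tailMean, tailProb, sum_moveMem_mul]

/-- After the literals the syndrome in memory no longer changes, so the remaining letters are
determined by it; the value bit is still redrawn but has no effect. -/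
theorem tailMean_outputs (z : Syn M) (B : ℕ → Fin n) (j r : ℕ) (h : j + r ≤ M) :
    tailMean col off σ (k + j) z (word B (k + j) r) =
      ∏ t : Fin r, pt (Fin.ofNat n (code (z ⟨j + t, by omega⟩))) (B (k + j + t)) := by
  induction r generalizing j with
  | zero => simp [tailMean, word, tailProb]
  | succ r ih =>
    rw [word, tailMean_cons, Fin.prod_univ_succ]
    have h1 : ∀ b, emitMem off σ (k + j) (some (b, z)) (B (k + j)) =
        pt (Fin.ofNat n (code (z ⟨j, by omega⟩))) (B (k + j)) := by
      intro b
      have h2 : k + j - k < M := by omega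
      simp only [emitMem, dif_neg (show ¬ k + j < k by omega), dif_pos h2]
      congr 4
      exact Fin.ext (by simp)
    have h3 : ∀ b, nextSyn col (k + j) b z = z := by
      intro b
      simp [nextSyn]
    simp only [h1, h3]
    have := ih (j + 1) (by omega)
    rw [← Nat.add_assoc] at this
    rw [this]
    simp only [Finset.sum_const, Finset.card_univ, Fintype.card_bool, nsmul_eq_mul, Fin.val_zero,
      Nat.add_zero, Fin.val_succ, Nat.cast_ofNat]
    have e : ∀ t : Fin r, j + 1 + (t : ℕ) = j + (t + 1) := fun t => by omega
    have e' : ∀ t : Fin r, k + j + 1 + (t : ℕ) = k + j + (t + 1) := fun t => by omega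
    simp only [e, e']
    ring

/-- Each literal of value one adds its column to the memory, so the memory collects the syndrome of
the remaining values on top of `z`. -/
theorem tailMean_literals (B : ℕ → Fin n) (l : List (Fin n)) (i r : ℕ) (h : i + r = k)
    (z : Syn M) :
    tailMean col off σ i z (word B i r ++ l) =
      ∑ v : Fin r → Bool, (1 / 2) ^ r *
        ((∏ t : Fin r, ∑ q, 1 / (N : ℝ) * pt (lit off σ ⟨i + t, by omega⟩ q (v t)) (B (i + t))) *
          tailMean col off σ k (z + ∑ t : Fin r, if v t then col ⟨i + t, by omega⟩ else 0) l) := by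
  induction r generalizing i z with
  | zero =>
    obtain rfl : i = k := h
    simp [word]
  | succ r ih =>
    rw [word, List.cons_append, tailMean_cons, sum_cons]
    refine Finset.sum_congr rfl fun b _ => ?_
    have hi : i < k := by omega
    rw [ih (i + 1) (by omega)]
    simp only [emitMem, dif_pos hi, nextSyn, Finset.mul_sum]
    refine Finset.sum_congr rfl fun v _ => ?_
    have e : ∀ t : Fin r, i + 1 + (t : ℕ) = i + (t + 1) := fun t => by omega
    simp only [Fin.prod_univ_succ, Fin.sum_univ_succ, Fin.cons_zero, Fin.cons_succ, Fin.val_zero,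
      Nat.add_zero, Fin.val_succ, e, ← Finset.mul_sum, add_assoc, pow_succ]
    ring

/-- A block as a sequence indexed by the natural numbers. -/
def padBlock {K : ℕ} (b : Fin K → Fin n) : ℕ → Fin n := fun t => if h : t < K then b ⟨t, h⟩ else 0

theorem word_padBlock {K : ℕ} (b : Fin K → Fin n) : word (padBlock b) 0 K = List.ofFn b := by
  rw [word_eq]
  congr 1
  funext t
  simp [padBlock]

/-- The noise is the initial content of the memory syndrome, to which the columns of the literals
are added. Noise therefore costs no additional states. -/
theorem sum_startMem_tailProb (b : Fin (k + M) → Fin n) :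
    ∑ s, startMem M η θ s * tailProb col off σ 0 s (List.ofFn b) =
      blockDist col off η θ σ b := by
  rw [sum_startMem_mul, ← word_padBlock, tailProb_none, blockDist]
  congr 2
  · rw [← prod_pt, ← Fin.prod_univ_eq_prod_range (fun t => pt 0 (padBlock b (0 + t)))]
    simp [padBlock]
  · refine Finset.sum_congr rfl fun z _ => ?_
    congr 1
    change tailMean col off σ 0 z (word (padBlock b) 0 (k + M)) = _
    rw [word_add, tailMean_literals _ _ _ _ _ 0 k (by omega)]
    refine Finset.sum_congr rfl fun v _ => ?_
    congr 1
    have h1 := tailMean_outputs col off σ (z + syn col v) (padBlock b) 0 M (by omega)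
    simp only [Nat.add_zero, zero_add] at h1 ⊢
    rw [show (∑ t : Fin k, if v t then col ⟨t, t.2⟩ else 0) = syn col v from rfl, h1,
      Finset.prod_univ_sum, Fintype.piFinset_univ, Finset.sum_mul]
    refine Finset.sum_congr rfl fun q _ => ?_
    rw [Finset.prod_mul_distrib, ← prod_pt, Fin.prod_univ_add, mul_assoc]
    congr 1
    · simp
    · congr 1
      · refine Finset.prod_congr rfl fun i _ => ?_
        have : (i : ℕ) < k + M := by omega
        simp only [mkBlock, Fin.addCases_left, padBlock, this, dif_pos]
        rfl
      · refine Finset.prod_congr rfl fun i _ => ?_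
        have : k + (i : ℕ) < k + M := by omega
        simp only [mkBlock, Fin.addCases_right, padBlock, this, dif_pos]
        rfl

end Block

/-! ### The hidden Markov model of independent blocks -/

/-- The states of the block model together with unused states. -/
noncomputable def stateEquiv {T : ℕ} {S : Type} [Fintype S] (h : Fintype.card S ≤ T) :
    Fin T ≃ S ⊕ Fin (T - Fintype.card S) :=
  Fintype.equivOfCardEq (by simp; omega)

section Model

variable {k M N n T : ℕ} [NeZero n]

/-- The distribution of the state at the start of a block. -/
noncomputable def startState {K : ℕ} (M : ℕ) (η θ : ℝ) (s : Fin K × Memory M) : ℝ :=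
  (if (s.1 : ℕ) = 0 then 1 else 0) * startMem M η θ s.2

theorem sum_startState_mul {K : ℕ} (hK : 0 < K) (η θ : ℝ) (f : Fin K × Memory M → ℝ) :
    ∑ s, startState M η θ s * f s = ∑ s, startMem M η θ s * f (⟨0, hK⟩, s) := by
  rw [Fintype.sum_prod_type, Finset.sum_eq_single ⟨0, hK⟩]
  · simp [startState]
  · intro i _ hi
    have : (i : ℕ) ≠ 0 := fun h => hi (Fin.ext h)
    simp [startState, this]
  · simp

theorem startState_nonneg {K : ℕ} {η θ : ℝ} (hη₀ : 0 ≤ η) (hη₁ : η ≤ 1)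
    (hθ₀ : 0 ≤ θ) (hθ₁ : θ ≤ 1) (s : Fin K × Memory M) : 0 ≤ startState M η θ s := by
  refine mul_nonneg (by split_ifs <;> norm_num) (add_nonneg (mul_nonneg hθ₀ (pt_nonneg _ _))
    (mul_nonneg (sub_nonneg.2 hθ₁) (Finset.sum_nonneg fun z _ => mul_nonneg
      (noise_nonneg hη₀ hη₁ z) (Finset.sum_nonneg fun b _ => mul_nonneg (by norm_num)
        (pt_nonneg _ _)))))

/-- The transition probabilities of the block model. -/
noncomputable def moveState (col : Fin k → Syn M) (η θ : ℝ) (s s' : Fin (k + M) × Memory M) : ℝ :=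
  if (s.1 : ℕ) + 1 = k + M then startState M η θ s'
  else (if (s'.1 : ℕ) = s.1 + 1 then 1 else 0) * moveMem col s.1 s.2 s'.2

theorem sum_moveState_mul (col : Fin k → Syn M) (η θ : ℝ) (i : Fin (k + M))
    (hi : (i : ℕ) + 1 < k + M) (s : Memory M) (f : Fin (k + M) × Memory M → ℝ) :
    ∑ s', moveState col η θ (i, s) s' * f s' =
      ∑ s', moveMem col i s s' * f (⟨i + 1, hi⟩, s') := by
  rw [Fintype.sum_prod_type, Finset.sum_eq_single ⟨i + 1, hi⟩]
  · simp [moveState, hi.ne]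
  · intro i' _ hi'
    have : (i' : ℕ) ≠ i + 1 := fun h => hi' (Fin.ext h)
    simp [moveState, this, hi.ne]
  · simp

theorem sum_startState {K : ℕ} (hK : 0 < K) (η θ : ℝ) :
    ∑ s : Fin K × Memory M, startState M η θ s = 1 := by
  have := sum_startState_mul (M := M) hK η θ fun _ => 1
  simp only [mul_one] at this
  rw [this]
  have := sum_startMem_mul (M := M) η θ fun _ => 1
  simp only [mul_one] at this
  rw [this]
  simp [sum_noise]

/-- A hidden Markov model with `T` hidden states whose outputs are independent blocks. -/
noncomputable def blockModel (col : Fin k → Syn M) (off : ℕ) {η θ : ℝ} (hη₀ : 0 ≤ η) (hη₁ : η ≤ 1)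
    (hθ₀ : 0 ≤ θ) (hθ₁ : θ ≤ 1) (hk : 0 < k) (hN : 0 < N)
    (hT : Fintype.card (Fin (k + M) × Memory M) ≤ T) (σ : Fin N → Fin k → Bool) : HMM T n where
  init h := Sum.elim (startState M η θ) (fun _ => 0) (stateEquiv hT h)
  trans h h' := Sum.elim
    (fun s => Sum.elim (moveState col η θ s) (fun _ => 0) (stateEquiv hT h'))
    (fun _ => Sum.elim (startState M η θ) (fun _ => 0) (stateEquiv hT h')) (stateEquiv hT h)
  emit h a := Sum.elim (fun s => emitMem off σ s.1 s.2 a) (fun _ => pt 0 a) (stateEquiv hT h)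
  init_nonneg h := by
    rcases stateEquiv hT h with s | p
    · exact startState_nonneg hη₀ hη₁ hθ₀ hθ₁ s
    · exact le_rfl
  trans_nonneg h h' := by
    rcases stateEquiv hT h with s | p <;> rcases stateEquiv hT h' with s' | p'
    · simp only [Sum.elim_inl, moveState]
      split_ifs
      · exact startState_nonneg hη₀ hη₁ hθ₀ hθ₁ s'
      · obtain ⟨i, _ | ⟨b, z⟩⟩ := s
        · exact mul_nonneg zero_le_one (pt_nonneg _ _)
        · exact mul_nonneg zero_le_one (Finset.sum_nonneg fun b _ => mul_nonneg (by norm_num)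
            (pt_nonneg _ _))
      · simp
    · exact le_rfl
    · exact startState_nonneg hη₀ hη₁ hθ₀ hθ₁ s'
    · exact le_rfl
  emit_nonneg h a := by
    rcases stateEquiv hT h with ⟨i, _ | ⟨b, z⟩⟩ | p
    · exact pt_nonneg _ _
    · simp only [Sum.elim_inl, emitMem]
      split_ifs
      · exact Finset.sum_nonneg fun q _ => mul_nonneg (by positivity) (pt_nonneg _ _)
      · exact pt_nonneg _ _
      · exact pt_nonneg _ _
    · exact pt_nonneg _ _
  init_sum := by
    rw [Equiv.sum_comp (stateEquiv hT) (Sum.elim (startState M η θ) fun _ => 0)]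
    simp [sum_startState (M := M) (show 0 < k + M by omega)]
  trans_sum h := by
    rcases stateEquiv hT h with ⟨i, s⟩ | p
    · simp only [Sum.elim_inl]
      rw [Equiv.sum_comp (stateEquiv hT) (Sum.elim (moveState col η θ (i, s)) fun _ => 0)]
      simp only [Fintype.sum_sum_type, Sum.elim_inl, Sum.elim_inr, Finset.sum_const_zero, add_zero]
      by_cases hi : (i : ℕ) + 1 = k + M
      · simp only [moveState, hi, if_true]
        exact sum_startState (by omega) η θ
      · have := sum_moveState_mul col η θ i (by omega) s fun _ => 1
        simp only [mul_one] at this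
        rw [this, sum_moveMem]
    · simp only [Sum.elim_inr]
      rw [Equiv.sum_comp (stateEquiv hT) (Sum.elim (startState M η θ) fun _ => 0)]
      simp [sum_startState (M := M) (show 0 < k + M by omega)]
  emit_sum h := by
    rcases stateEquiv hT h with ⟨i, s⟩ | p
    · exact sum_emitMem off σ hN i s
    · exact sum_pt _

variable (col : Fin k → Syn M) (off : ℕ) {η θ : ℝ} (hη₀ : 0 ≤ η) (hη₁ : η ≤ 1)
    (hθ₀ : 0 ≤ θ) (hθ₁ : θ ≤ 1) (hk : 0 < k) (hN : 0 < N)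
    (hT : Fintype.card (Fin (k + M) × Memory M) ≤ T) (σ : Fin N → Fin k → Bool)

theorem blockModel_probFrom (i : Fin (k + M)) (s : Memory M) (l w : List (Fin n))
    (hl : i + l.length = k + M) :
    (blockModel col off hη₀ hη₁ hθ₀ hθ₁ hk hN hT σ).probFrom ((stateEquiv hT).symm (.inl (i, s)))
        (l ++ w) = tailProb col off σ i s l *
      (blockModel col off hη₀ hη₁ hθ₀ hθ₁ hk hN hT σ).prob w := by
  induction l generalizing i s with
  | nil => simp at hl; omega
  | cons a l ih =>
    rw [List.cons_append, HMM.probFrom, tailProb, mul_assoc]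
    congr 1
    · simp [blockModel]
    · rw [← Equiv.sum_comp (stateEquiv hT).symm, Fintype.sum_sum_type]
      have h0 : ∀ p, (blockModel (n := n) col off hη₀ hη₁ hθ₀ hθ₁ hk hN hT σ).trans
          ((stateEquiv hT).symm (.inl (i, s))) ((stateEquiv hT).symm (.inr p)) = 0 := by
        intro p; simp [blockModel]
      have h1 : ∀ s', (blockModel (n := n) col off hη₀ hη₁ hθ₀ hθ₁ hk hN hT σ).trans
          ((stateEquiv hT).symm (.inl (i, s))) ((stateEquiv hT).symm (.inl s')) =
          moveState col η θ (i, s) s' := by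
        intro p; simp [blockModel]
      simp only [h0, h1, zero_mul, Finset.sum_const_zero, add_zero]
      -- At the last position of a block the next state is drawn from the initial distribution,
      -- whatever the memory contains; this yields the factor `prob w`.
      by_cases hi : (i : ℕ) + 1 = k + M
      · obtain rfl : l = [] := by
          rw [List.length_cons] at hl
          exact List.length_eq_zero_iff.1 (by omega)
        have h2 : ∀ i s, tailProb (n := n) col off σ i s [] = 1 := fun _ _ => by simp [tailProb]
        simp only [h2, mul_one, sum_moveMem, one_mul, List.nil_append, moveState, hi, if_true]
        rw [HMM.prob, ← Equiv.sum_comp (stateEquiv hT).symm, Fintype.sum_sum_type]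
        simp [blockModel]
      · have hi' : (i : ℕ) + 1 < k + M := by omega
        rw [sum_moveState_mul col η θ i hi', Finset.sum_mul]
        refine Finset.sum_congr rfl fun s' _ => ?_
        rw [ih ⟨i + 1, hi'⟩ s' (by rw [List.length_cons] at hl; simp only; omega), mul_assoc]

/-- Blocks are independent, since the chain starts afresh after each one. This factorization is all
that is used about the block model later. -/
theorem blockModel_prob_append (b : Fin (k + M) → Fin n) (w : List (Fin n)) :
    (blockModel col off hη₀ hη₁ hθ₀ hθ₁ hk hN hT σ).prob (List.ofFn b ++ w) =
      blockDist col off η θ σ b * (blockModel col off hη₀ hη₁ hθ₀ hθ₁ hk hN hT σ).prob w := by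
  have hK : 0 < k + M := by omega
  have h1 : ∀ s, (blockModel (n := n) col off hη₀ hη₁ hθ₀ hθ₁ hk hN hT σ).init
      ((stateEquiv hT).symm (.inl s)) = startState M η θ s := by
    intro p; simp [blockModel]
  have h2 : ∀ p, (blockModel (n := n) col off hη₀ hη₁ hθ₀ hθ₁ hk hN hT σ).init
      ((stateEquiv hT).symm (.inr p)) = 0 := by
    intro p; simp [blockModel]
  rw [HMM.prob, ← Equiv.sum_comp (stateEquiv hT).symm, Fintype.sum_sum_type]
  simp only [h1, h2, zero_mul, Finset.sum_const_zero, add_zero]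
  rw [sum_startState_mul hK, ← sum_startMem_tailProb, Finset.sum_mul]
  refine Finset.sum_congr rfl fun s _ => ?_
  rw [blockModel_probFrom _ _ _ _ _ _ _ _ _ _ _ _ _ _ (by simp), mul_assoc]

end Model

end SeqPred

namespace SeqPred

/-! ### Streams of blocks and streams of letters -/

theorem streamMean_of_le {γ : Type} [Fintype γ] [Inhabited γ] {μ : γ → ℝ} (hμ : ∑ a, μ a = 1)
    {N N' : ℕ} (h : N ≤ N') (G : (ℕ → γ) → ℝ)
    (hG : ∀ x y, (∀ i < N, x i = y i) → G x = G y) : streamMean μ N' G = streamMean μ N G := by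
  induction N generalizing N' G with
  | zero =>
    have : G = fun _ => G fun _ => default := by
      funext x
      exact hG _ _ fun i hi => absurd hi (by omega)
    rw [this, streamMean_const hμ, streamMean_const hμ]
  | succ N ih =>
    obtain _ | N' := N'
    · omega
    · refine Finset.sum_congr rfl fun a _ => ?_
      rw [ih (by omega)]
      intro x y hxy
      refine hG _ _ fun i hi => ?_
      rcases i with _ | i
      · rfl
      · exact hxy i (by omega)

/-- Product measures are invariant under reversal. It is needed because the past is read with the
latest block first. -/
theorem streamMean_rev {γ : Type} [Fintype γ] [Inhabited γ] (μ : γ → ℝ) {N : ℕ}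
    {G H : (ℕ → γ) → ℝ} (h : ∀ x : Fin N → γ, G (extend x) = H (extend fun i => x i.rev)) :
    streamMean μ N G = streamMean μ N H := by
  rw [streamMean_eq_sum, streamMean_eq_sum]
  refine Fintype.sum_equiv (Equiv.arrowCongr Fin.revPerm (Equiv.refl γ)) _ _ fun x => ?_
  have : (Equiv.arrowCongr Fin.revPerm (Equiv.refl γ)) x = fun i => x i.rev := by
    funext i; simp [Equiv.arrowCongr]
  rw [this, h, Fintype.prod_equiv Fin.revPerm (fun i => μ (x i)) (fun i => μ (x i.rev))]
  intro i; simp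

section Flat

variable {K n : ℕ} [NeZero K] [NeZero n]

omit [NeZero n] in
theorem ofNat_eq_mk {i : ℕ} (h : i < K) : Fin.ofNat K i = ⟨i, h⟩ :=
  Fin.ext (Nat.mod_eq_of_lt h)

/-- The letters of a stream of blocks. -/
def flat (x : ℕ → Fin K → Fin n) (i : ℕ) : Fin n := x (i / K) (Fin.ofNat K i)

omit [NeZero n] in
theorem flat_eq (x : ℕ → Fin K → Fin n) (q i : ℕ) (h : i < K) : flat x (K * q + i) = x q ⟨i, h⟩ := by
  have h1 : (K * q + i) / K = q := by
    rw [Nat.mul_add_div (NeZero.pos K), Nat.div_eq_of_lt h, add_zero]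
  have h2 : Fin.ofNat K (K * q + i) = ⟨i, h⟩ :=
    Fin.ext (by simp [Nat.mod_eq_of_lt h])
  rw [flat, h1, h2]

omit [NeZero n] in
theorem flat_cons (b : Fin K → Fin n) (x : ℕ → Fin K → Fin n) (i : ℕ) :
    flat (Tree.cons b x) i = if h : i < K then b ⟨i, h⟩ else flat x (i - K) := by
  split_ifs with h
  · rw [flat, Nat.div_eq_of_lt h, ofNat_eq_mk h]
    rfl
  · obtain ⟨j, rfl⟩ := Nat.exists_eq_add_of_le (not_lt.1 h)
    have h1 : (K + j) / K = j / K + 1 := by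
      rw [Nat.add_div_left _ (NeZero.pos K)]
    have h2 : Fin.ofNat K (K + j) = Fin.ofNat K j := Fin.ext (by simp)
    rw [flat, h1, h2, Nat.add_sub_cancel_left]
    rfl

omit [NeZero K] in
theorem extend_append {N : ℕ} (b : Fin K → Fin n) (u : Fin N → Fin n) (i : ℕ) :
    extend (Fin.append b u) i = if h : i < K then b ⟨i, h⟩ else extend u (i - K) := by
  split_ifs with h
  · have h' : i < K + N := by omega
    rw [extend, dif_pos h']
    exact Fin.append_left b u ⟨i, h⟩
  · by_cases h' : i < K + N
    · have h2 : i - K < N := by omega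
      rw [extend, extend, dif_pos h', dif_pos h2]
      have : (⟨i, h'⟩ : Fin (K + N)) = Fin.natAdd K ⟨i - K, h2⟩ := Fin.ext (by simp; omega)
      rw [this, Fin.append_right]
    · rw [extend, extend, dif_neg h', dif_neg (by omega)]

omit [NeZero K] [NeZero n] in
theorem sum_append {N : ℕ} (f : (Fin (K + N) → Fin n) → ℝ) :
    ∑ x, f x = ∑ b : Fin K → Fin n, ∑ u : Fin N → Fin n, f (Fin.append b u) := by
  rw [← Fintype.sum_prod_type']
  exact (Fintype.sum_equiv (Fin.appendEquiv K N) _ _ fun _ => rfl).symm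

theorem sum_snoc {γ : Type} [Fintype γ] {N : ℕ} (f : (Fin (N + 1) → γ) → ℝ) :
    ∑ x, f x = ∑ u : Fin N → γ, ∑ a, f (Fin.snoc u a) := by
  rw [← Fintype.sum_prod_type', ← (Equiv.prodComm _ _).sum_comp]
  exact (Fintype.sum_equiv (Fin.snocEquiv fun _ => γ) _ _ fun _ => rfl).symm

omit [NeZero n] in
theorem ofFn_snoc {N : ℕ} (u : Fin N → Fin n) (a : Fin n) :
    List.ofFn (Fin.snoc u a : Fin (N + 1) → Fin n) = List.ofFn u ++ [a] := by
  rw [List.ofFn_succ', List.concat_eq_append]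
  simp

variable {T : ℕ} {M : HMM T n} {μ : (Fin K → Fin n) → ℝ}

/-- The letters of independent blocks have the law of the model's outputs; the blocks are split off
one at a time with the factorization `hM`. -/
theorem streamMean_flat (hM : ∀ b w, M.prob (List.ofFn b ++ w) = μ b * M.prob w) (L : ℕ) :
    ∀ (N : ℕ) (_ : N = K * L) (G : (ℕ → Fin n) → ℝ),
    streamMean μ L (fun x => G (flat x)) = ∑ u : Fin N → Fin n, M.prob (List.ofFn u) * G (extend u) := by
  induction L with
  | zero =>
    rintro N rfl G
    simp only [Nat.mul_zero, Finset.univ_unique, Finset.sum_singleton, List.ofFn_zero, M.prob_nil,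
      one_mul]
    rfl
  | succ L ih =>
    intro N hN G
    obtain rfl : N = K + K * L := by rw [hN]; ring
    rw [sum_append]
    refine Finset.sum_congr rfl fun b _ => ?_
    have h1 : ∀ x : ℕ → Fin K → Fin n, G (flat (Tree.cons b x)) =
        (fun y : ℕ → Fin n => G fun i => if h : i < K then b ⟨i, h⟩ else y (i - K)) (flat x) := by
      intro x
      exact congrArg G (funext fun i => flat_cons b x i)
    have h2 : ∀ u : Fin (K * L) → Fin n, G (extend (Fin.append b u)) =
        (fun y : ℕ → Fin n => G fun i => if h : i < K then b ⟨i, h⟩ else y (i - K)) (extend u) := by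
      intro u
      exact congrArg G (funext fun i => extend_append b u i)
    simp only [List.ofFn_fin_append, hM, h1, h2]
    rw [ih (K * L) rfl fun y : ℕ → Fin n => G fun i => if h : i < K then b ⟨i, h⟩ else y (i - K),
      Finset.mul_sum]
    exact Finset.sum_congr rfl fun u _ => by ring

/-- Consistency of the marginals: outputs on which `G` does not depend are summed out. It bridges
word lengths that are not multiples of the block length. -/
theorem sum_prob_of_le {N N' : ℕ} (M : HMM T n) (h : N ≤ N') (G : (ℕ → Fin n) → ℝ)
    (hG : ∀ x y, (∀ i < N, x i = y i) → G x = G y) :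
    ∑ u : Fin N' → Fin n, M.prob (List.ofFn u) * G (extend u) =
      ∑ u : Fin N → Fin n, M.prob (List.ofFn u) * G (extend u) := by
  induction N', h using Nat.le_induction with
  | base => rfl
  | succ m hm ih =>
    rw [sum_snoc, ← ih]
    refine Finset.sum_congr rfl fun u _ => ?_
    have : ∀ a, G (extend (Fin.snoc u a : Fin (m + 1) → Fin n)) = G (extend u) := by
      intro a
      refine hG _ _ fun i hi => ?_
      have h1 : i < m + 1 := by omega
      have h2 : i < m := by omega
      rw [extend, extend, dif_pos h1, dif_pos h2]
      exact Fin.snoc_castSucc (α := fun _ => Fin n) a u ⟨i, h2⟩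
    simp only [this, ofFn_snoc, ← Finset.sum_mul, M.sum_prob]

theorem streamMean_flat_of_le (hM : ∀ b w, M.prob (List.ofFn b ++ w) = μ b * M.prob w) {L N : ℕ}
    (h : N ≤ K * L) (G : (ℕ → Fin n) → ℝ) (hG : ∀ x y, (∀ i < N, x i = y i) → G x = G y) :
    streamMean μ L (fun x => G (flat x)) =
      ∑ u : Fin N → Fin n, M.prob (List.ofFn u) * G (extend u) := by
  rw [streamMean_flat hM L _ rfl, sum_prob_of_le M h G hG]

/-! ### The probability of a correct prediction -/

/-- The probability that the letter which `f` predicts at time `t` is correct. -/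
noncomputable def HMM.hit (M : HMM T n) (f : List (Fin n) → Fin n) (t : ℕ) : ℝ :=
  ∑ x : Fin t → Fin n, M.prob (List.ofFn x ++ [f (List.ofFn x)])

theorem HMM.hit_eq (hM : ∀ b w, M.prob (List.ofFn b ++ w) = μ b * M.prob w)
    (f : List (Fin n) → Fin n) {t L : ℕ} (h : t + 1 ≤ K * L) :
    M.hit f t = streamMean μ L fun x =>
      if f (List.ofFn fun i : Fin t => flat x i) = flat x t then 1 else 0 := by
  rw [streamMean_flat_of_le hM h
    (fun y => if f (List.ofFn fun i : Fin t => y i) = y t then 1 else 0), sum_snoc]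
  · refine Finset.sum_congr rfl fun x _ => ?_
    have h1 : ∀ a, (List.ofFn fun i : Fin t => extend (Fin.snoc x a : Fin (t + 1) → Fin n) i) =
        List.ofFn x := by
      intro a
      congr 1
      funext i
      have : (i : ℕ) < t + 1 := by omega
      rw [extend, dif_pos this]
      exact Fin.snoc_castSucc (α := fun _ => Fin n) a x i
    have h2 : ∀ a, extend (Fin.snoc x a : Fin (t + 1) → Fin n) t = a := by
      intro a
      rw [extend, dif_pos (Nat.lt_succ_self t)]
      exact Fin.snoc_last (α := fun _ => Fin n) a x
    simp only [h1, h2, ofFn_snoc]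
    simp
  · intro x y hxy
    have h1 : (fun i : Fin t => x i) = fun i : Fin t => y i :=
      funext fun i => hxy i (by omega)
    simp only [h1, hxy t (Nat.lt_succ_self t)]

/-- The letters before position `φ` of the block `b`, which is preceded by the blocks `V`, the
latest letter and the latest block first. -/
def past (b : Fin K → Fin n) (φ : ℕ) (V : ℕ → Fin K → Fin n) (i : ℕ) : Fin n :=
  if i < φ then b (Fin.ofNat K (φ - 1 - i))
  else V ((i - φ) / K) (Fin.ofNat K (K - 1 - (i - φ) % K))

/-- A predictor that looks back at most `s` outputs sees the beginning of the current block and at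
most `s` earlier blocks. Conditions `hΦ` and `hf` express this dependence through the reversed past.
The answer does not depend on `q`, so one generated test block represents all late times in the same
phase `φ`. -/
theorem HMM.hit_eq_past (hμ : ∑ b, μ b = 1)
    (hM : ∀ b w, M.prob (List.ofFn b ++ w) = μ b * M.prob w)
    {f : List (Fin n) → Fin n} {Φ : (ℕ → Fin n) → Fin n} {s : ℕ}
    (hΦ : ∀ y y', (∀ i < s, y i = y' i) → Φ y = Φ y')
    (hf : ∀ (x : List (Fin n)) (y : ℕ → Fin n), s ≤ x.length →
      (∀ i < s, x.reverse[i]? = some (y i)) → f x = Φ y)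
    {q L : ℕ} (hq : s ≤ q) (hL : s ≤ L) (φ : Fin K) :
    M.hit f (K * q + φ) = ∑ b, μ b * streamMean μ L fun V =>
      if Φ (past b φ V) = b φ then 1 else 0 := by
  have hK := NeZero.pos K
  have hqK : q ≤ K * q := Nat.le_mul_of_pos_left q hK
  rw [M.hit_eq hM f (L := q + 1) (by rw [Nat.mul_succ]; omega)]
  -- Reversal puts the current block first, followed by the earlier ones in the order in which they
  -- are read.
  rw [streamMean_rev μ (H := fun Y => if Φ (past (Y 0) φ fun i => Y (i + 1)) = Y 0 φ then 1 else 0)]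
  · have hdep : ∀ b (V V' : ℕ → Fin K → Fin n), (∀ i < s, V i = V' i) →
        Φ (past b φ V) = Φ (past b φ V') := by
      intro b V V' hV
      refine hΦ _ _ fun i hi => ?_
      have : (i - φ) / K < s := (Nat.div_le_self _ _).trans_lt (by omega)
      simp only [past, hV _ this]
    refine Finset.sum_congr rfl fun b _ => ?_
    congr 1
    have h1 : ∀ V V' : ℕ → Fin K → Fin n, (∀ i < s, V i = V' i) →
        (if Φ (past b φ V) = b φ then (1 : ℝ) else 0) =
          if Φ (past b φ V') = b φ then 1 else 0 := fun V V' hV => by rw [hdep b V V' hV]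
    rw [streamMean_of_le hμ hL _ h1, ← streamMean_of_le hμ hq _ h1]
    rfl
  · intro x
    set X := extend x with hX
    set Y := extend fun i : Fin (q + 1) => x i.rev with hY
    have hXY : ∀ a ≤ q, X (q - a) = Y a := by
      intro a ha
      have h1 : q - a < q + 1 := by omega
      have h2 : a < q + 1 := by omega
      rw [hX, hY, extend, extend, dif_pos h1, dif_pos h2]
      congr 1
      exact Fin.ext (by simp [Fin.val_rev])
    have h0 : flat X (K * q + φ) = Y 0 φ := by
      rw [flat_eq X q φ φ.2, ← hXY 0 (Nat.zero_le _)]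
      rfl
    have h1 : f (List.ofFn fun i : Fin (K * q + φ) => flat X i) =
        Φ (past (Y 0) φ fun i => Y (i + 1)) := by
      refine hf _ _ (by simp; omega) fun i hi => ?_
      rw [List.getElem?_reverse (by simp; omega), List.length_ofFn, List.getElem?_ofFn,
        dif_pos (by omega)]
      congr 1
      simp only [past]
      split_ifs with hiφ
      · have e : K * q + φ - 1 - i = K * q + (φ - 1 - i) := by omega
        have hlt : (φ : ℕ) - 1 - i < K := by omega
        rw [e, flat_eq X q _ hlt, ofNat_eq_mk hlt, ← hXY 0 (Nat.zero_le _)]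
        rfl
      · obtain ⟨u, rfl⟩ := Nat.exists_eq_add_of_le (not_lt.1 hiφ)
        rw [Nat.add_sub_cancel_left]
        have hu1 := Nat.div_add_mod u K
        have hu2 := Nat.mod_lt u hK
        have hu3 : u / K < q := by
          rw [Nat.div_lt_iff_lt_mul hK, Nat.mul_comm]
          omega
        have hlt : K - 1 - u % K < K := by omega
        obtain ⟨c, hc⟩ := Nat.exists_eq_add_of_lt hu3
        -- The letter `u + 1` places before the current block lies `u / K + 1` blocks earlier, and
        -- its position is counted from the end of that block.
        have e : K * q + φ - 1 - (φ + u) = K * (q - (u / K + 1)) + (K - 1 - u % K) := by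
          have e1 : q - (u / K + 1) = c := by omega
          have e2 : K * q = K * (u / K) + K * c + K := by rw [hc]; ring
          rw [e1]
          omega
        rw [e, flat_eq X _ _ hlt, ofNat_eq_mk hlt, ← hXY _ (by omega)]
    simp only [h0, h1]

/-- This evaluates the reference predictor, which looks only at the part of the current block that
has been output. -/
theorem HMM.hit_eq_block (hμ : ∑ b, μ b = 1)
    (hM : ∀ b w, M.prob (List.ofFn b ++ w) = μ b * M.prob w)
    (φ : Fin K) (g : (Fin K → Fin n) → Fin n)
    (hg : ∀ b b' : Fin K → Fin n, (∀ i < φ, b i = b' i) → g b = g b') (q : ℕ) :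
    M.hit (fun x => g fun i => x.getD (K * q + i) 0) (K * q + φ) =
      ∑ b, μ b * if g b = b φ then 1 else 0 := by
  rw [M.hit_eq hM _ (L := q + 1) (by rw [Nat.mul_succ]; omega)]
  rw [streamMean_rev μ (H := fun Y => if g (Y 0) = Y 0 φ then 1 else 0)]
  · have e : ∀ b : Fin K → Fin n,
        (streamMean μ q fun x => if g (Tree.cons b x 0) = Tree.cons b x 0 φ then (1 : ℝ) else 0) =
          if g b = b φ then 1 else 0 := fun b =>
      streamMean_const hμ q (if g b = b φ then 1 else 0)
    simp only [streamMean, e]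
  · intro x
    have h2 : extend x q = extend (fun i : Fin (q + 1) => x i.rev) 0 := by
      rw [extend, extend, dif_pos (Nat.lt_succ_self q), dif_pos (Nat.succ_pos q)]
      congr 1
    rw [flat_eq _ q φ φ.2, ← h2]
    congr 2
    refine hg _ _ fun i hi => ?_
    have hi' : (i : ℕ) < φ := hi
    rw [List.getD_eq_getElem?_getD, List.getElem?_ofFn, dif_pos (by omega)]
    exact flat_eq (extend x) q i i.2

theorem HMM.sum_prob_eq_one (M : HMM T n) (t : ℕ) : ∑ x : Fin t → Fin n, M.prob (List.ofFn x) = 1 := by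
  have := sum_prob_of_le M (Nat.zero_le t) (fun _ => 1) fun _ _ _ => rfl
  simp only [mul_one] at this
  rw [this]
  simp [M.prob_nil]

omit [NeZero n] in
theorem HMM.prob_append_le (M : HMM T n) (w : List (Fin n)) (a : Fin n) :
    M.prob (w ++ [a]) ≤ M.prob w := by
  rw [← M.sum_prob w]
  exact Finset.single_le_sum (f := fun a => M.prob (w ++ [a])) (fun b _ => M.prob_nonneg _)
    (Finset.mem_univ a)

/-- The pointwise bound `loss_ge` is averaged over the past, with the bet of any reference predictor
`g` as the letter `a`. The constant `6` exceeds `5 + 2/3`, which covers the pasts where both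
predictors bet on the same letter. -/
theorem errorAt_ge (L : Loss) (M : HMM T n) {A : List (Fin n) → Fin n → ℝ}
    (hA : ∀ x a, 0 ≤ A x a) (hA₁ : ∀ x, ∑ a, A x a = 1) {m : List (Fin n) → Fin n}
    (hm : ∀ x, IsMode (A x) (m x)) (g : List (Fin n) → Fin n) (t : ℕ) :
    ENNReal.ofReal (2 / 3 * (1 - M.hit m t) - 6 * (1 - M.hit g t)) ≤ errorAt L M A t := by
  have h1 : ∀ x : Fin t → Fin n,
      ENNReal.ofReal (2 / 3 * (M.prob (List.ofFn x) - M.prob (List.ofFn x ++ [m (List.ofFn x)])) -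
        6 * (M.prob (List.ofFn x) - M.prob (List.ofFn x ++ [g (List.ofFn x)]))) ≤
      ENNReal.ofReal (M.prob (List.ofFn x)) *
        L.eval (M.next (List.ofFn x)) (A (List.ofFn x)) := by
    intro x
    generalize List.ofFn x = w
    have hle := M.prob_append_le w (g w)
    have hle' := M.prob_append_le w (m w)
    have h0 := M.prob_nonneg (w ++ [m w])
    rcases (M.prob_nonneg w).eq_or_lt with hw | hw
    · rw [← hw] at hle hle' ⊢
      rw [ENNReal.ofReal_of_nonpos]
      · exact zero_le
      · have := M.prob_nonneg (w ++ [g w])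
        linarith
    · have hP : ∀ a, 0 ≤ M.next w a := fun a => div_nonneg (M.prob_nonneg _) hw.le
      have hP₁ : ∑ a, M.next w a = 1 := by
        simp only [HMM.next, ← Finset.sum_div, M.sum_prob]
        exact div_self hw.ne'
      have := loss_ge L hP hP₁ (hA w) (hA₁ w) (hm w) (g w)
      refine le_trans ?_ (mul_le_mul_right this _)
      rw [← ENNReal.ofReal_mul hw.le]
      refine ENNReal.ofReal_le_ofReal ?_
      have e : M.prob w * M.next w (g w) = M.prob (w ++ [g w]) := mul_div_cancel₀ _ hw.ne'
      split_ifs with hmg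
      · rw [hmg]
        nlinarith
      · nlinarith
  calc ENNReal.ofReal (2 / 3 * (1 - M.hit m t) - 6 * (1 - M.hit g t))
      = ENNReal.ofReal (∑ x : Fin t → Fin n,
        (2 / 3 * (M.prob (List.ofFn x) - M.prob (List.ofFn x ++ [m (List.ofFn x)])) -
        6 * (M.prob (List.ofFn x) - M.prob (List.ofFn x ++ [g (List.ofFn x)])))) := by
        rw [Finset.sum_sub_distrib, ← Finset.mul_sum, ← Finset.mul_sum, Finset.sum_sub_distrib,
          Finset.sum_sub_distrib, M.sum_prob_eq_one]
        rfl
    _ ≤ ∑ x : Fin t → Fin n, ENNReal.ofReal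
        (2 / 3 * (M.prob (List.ofFn x) - M.prob (List.ofFn x ++ [m (List.ofFn x)])) -
        6 * (M.prob (List.ofFn x) - M.prob (List.ofFn x ++ [g (List.ofFn x)]))) := by
        generalize (Finset.univ : Finset (Fin t → Fin n)) = S
        induction S using Finset.cons_induction with
        | empty => simp
        | cons a S ha ih =>
          rw [Finset.sum_cons, Finset.sum_cons]
          exact ENNReal.ofReal_add_le.trans (add_le_add_right ih _)
    _ ≤ _ := Finset.sum_le_sum fun x _ => h1 x

omit [NeZero n] in
/-- If the errors at the times which belong to a block add up to at least `S`, then the average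
error is at least `S / K`. -/
theorem le_of_avgError_lt (L : Loss) (M : HMM T n) (A : List (Fin n) → Fin n → ℝ) {s : ℕ}
    {S ε : ℝ} (hε : 0 < ε)
    (hS : ∀ q, s ≤ q → ENNReal.ofReal S ≤ ∑ φ ∈ Finset.range K, errorAt L M A (K * q + φ))
    (h : avgError L M A s < ENNReal.ofReal ε) : S ≤ K * ε := by
  have hK := NeZero.pos K
  have hKr : (0 : ℝ) < K := by exact_mod_cast hK
  by_contra hc
  rw [not_le] at hc
  have hSpos : 0 < S := lt_trans (by positivity) hc
  have hfreq := frequently_lt_of_liminf_lt (by isBoundedDefault) h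
  -- The `N` times contain at least `N / K - 1 - s` complete blocks among those counted; for `N`
  -- this large the missing `s + 1` blocks do not matter.
  obtain ⟨N₀, hN₀⟩ := exists_nat_gt ((s + 1) * S / (S / K - ε))
  have hpos : 0 < S / K - ε := by
    rw [sub_pos, lt_div_iff₀ hKr]
    linarith
  obtain ⟨N, hN, hlt⟩ := (frequently_atTop.1 hfreq) (N₀ + 1)
  have hNpos : 0 < N := by omega
  have hblocks : ∀ m : ℕ, m * ENNReal.ofReal S ≤
      ∑ t ∈ Finset.range (K * m), errorAt L M A (K * s + t) := by
    intro m
    induction m with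
    | zero => simp
    | succ m ih =>
      rw [Nat.mul_succ, Finset.sum_range_add, Nat.cast_succ, add_mul, one_mul]
      refine add_le_add ih ((hS (s + m) (by omega)).trans (le_of_eq ?_))
      refine Finset.sum_congr rfl fun φ _ => ?_
      congr 1
      ring
  have hsK : s ≤ K * s := Nat.le_mul_of_pos_left s hK
  have h1 : ((N / K - s : ℕ) : ℝ≥0∞) * ENNReal.ofReal S ≤
      ∑ t ∈ Finset.range N, errorAt L M A (s + t) := by
    refine (hblocks _).trans ?_
    rcases Nat.le_total (N / K) s with hle | hle
    · rw [Nat.sub_eq_zero_of_le hle]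
      simp
    · obtain ⟨m, hm⟩ := Nat.exists_eq_add_of_le hle
      have e1 : K * (N / K) ≤ N := Nat.mul_div_le N K
      have e2 : K * (N / K) = K * s + K * m := by rw [hm]; ring
      have e3 : N / K - s = m := by omega
      rw [e3]
      have e4 : ∑ t ∈ Finset.range (K * m), errorAt L M A (K * s + t) =
          ∑ t ∈ Finset.range (K * m), errorAt L M A (s + ((K * s - s) + t)) := by
        refine Finset.sum_congr rfl fun t _ => ?_
        congr 1
        omega
      obtain ⟨r, hr⟩ := Nat.exists_eq_add_of_le (show (K * s - s) + K * m ≤ N by omega)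
      rw [e4, hr, Finset.sum_range_add, Finset.sum_range_add]
      exact le_add_right le_add_self
  have h2 : ((N / K - s : ℕ) : ℝ≥0∞) * ENNReal.ofReal S < N * ENNReal.ofReal ε := by
    refine h1.trans_lt ?_
    rw [ENNReal.div_lt_iff (Or.inl (by simp; omega)) (Or.inl (by simp))] at hlt
    rwa [mul_comm]
  have h3 : ((N / K - s : ℕ) : ℝ) * S < N * ε := by
    rw [← ENNReal.ofReal_natCast, ← ENNReal.ofReal_natCast, ← ENNReal.ofReal_mul (by positivity),
      ← ENNReal.ofReal_mul (by positivity)] at h2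
    exact (ENNReal.ofReal_lt_ofReal_iff_of_nonneg (by positivity)).1 h2
  have h4 : (N : ℝ) / K - 1 - s ≤ ((N / K - s : ℕ) : ℝ) := by
    have e1 : N < K * (N / K + 1) := by
      rw [Nat.mul_succ]
      have := Nat.div_add_mod N K
      have := Nat.mod_lt N hK
      omega
    have e2 : (N : ℝ) / K ≤ (N / K : ℕ) + 1 := by
      rw [div_le_iff₀ hKr, mul_comm]
      exact_mod_cast e1.le
    have e3 : ((N / K : ℕ) : ℝ) ≤ ((N / K - s : ℕ) : ℝ) + s := by
      exact_mod_cast (show N / K ≤ N / K - s + s by omega)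
    linarith
  have h5 : ((N : ℝ) / K - 1 - s) * S < N * ε :=
    (mul_le_mul_of_nonneg_right h4 hSpos.le).trans_lt h3
  have h6 : (s + 1) * S < N * (S / K - ε) := by
    rw [div_lt_iff₀ hpos] at hN₀
    have : (N₀ : ℝ) ≤ N := by exact_mod_cast (show N₀ ≤ N by omega)
    nlinarith
  have h7 : (N : ℝ) / K * S = N * (S / K) := by ring
  nlinarith

end Flat

end SeqPred

namespace SeqPred

/-! ### Blocks from clauses -/

/-- Toss `k` coins. -/
def Tree.branch {B α : Type} : ∀ k : ℕ, ((Fin k → Bool) → Tree B α) → Tree B α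
  | 0, F => F Fin.elim0
  | k + 1, F => .coin fun b => branch k fun w => F (Fin.cons b w)

theorem Tree.mean_branch {B α : Type} [Fintype B] (μ : B → ℝ) (k : ℕ)
    (F : (Fin k → Bool) → Tree B α) (G : α → ℝ) :
    (Tree.branch k F).mean μ G = ∑ w, (1 / 2) ^ k * (F w).mean μ G := by
  induction k with
  | zero =>
    simp only [Tree.branch, Finset.univ_unique, Finset.sum_singleton, pow_zero, one_mul]
    rfl
  | succ k ih =>
    rw [sum_cons]
    simp only [Tree.branch, Tree.mean, ih, Finset.mul_sum, pow_succ]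
    exact Finset.sum_congr rfl fun b _ => Finset.sum_congr rfl fun w _ => by ring

theorem xor_xor_cancel (a b : Bool) : xor a (xor b a) = b := by
  cases a <;> cases b <;> rfl

section Generator

variable {k M N n : ℕ} [NeZero n]

/-- The `i`-th variable of the clause belongs to the `i`-th block of variables. -/
def Accepted (N : ℕ) (ι : Fin k ↪ Fin n) : Prop := ∀ i, (ι i : ℕ) % k = i ∧ (ι i : ℕ) / k < N

instance (N : ℕ) (ι : Fin k ↪ Fin n) : Decidable (Accepted N ι) := by
  unfold Accepted; infer_instance

/-- The numbers of the variables of an accepted clause in their blocks. -/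
def Accepted.index {ι : Fin k ↪ Fin n} (h : Accepted N ι) : Fin k → Fin N :=
  fun i => ⟨(ι i : ℕ) / k, (h i).2⟩

/-- Draw clauses until one is accepted, at most `r` times, and turn it into a block. -/
def attempts (col : Fin k → Syn M) (off : ℕ) (τ : Fin N → Fin k → Bool) (w : Fin k → Bool) :
    ℕ → Tree (Clause k n) (Fin (k + M) → Fin n)
  | 0 => .ret fun _ => 0
  | r + 1 => .drawS fun C => if h : Accepted N C.1 then
      .ret (mkBlock off τ h.index (fun i => xor (C.2 i) (w i)) (syn col w))
      else attempts col off τ w r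

/-- The generator of blocks from clauses. -/
def genTree (col : Fin k → Syn M) (off : ℕ) (τ : Fin N → Fin k → Bool) (r : ℕ) :
    Tree (Clause k n) (Fin (k + M) → Fin n) :=
  Tree.branch k fun w => attempts col off τ w r

/-- Either the first accepted clause occurs after `i` rejections, which gives a geometric series, or
all `r` attempts fail and the default block is returned. -/
theorem mean_attempts (col : Fin k → Syn M) (off : ℕ) (τ : Fin N → Fin k → Bool)
    (w : Fin k → Bool) {D : Clause k n → ℝ} (hD : ∑ C, D C = 1) (r : ℕ)
    (G : (Fin (k + M) → Fin n) → ℝ) {α : ℝ}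
    (hα : ∑ C, D C * (if Accepted N C.1 then 1 else 0) = α) :
    (attempts col off τ w r).mean D G =
      (∑ i ∈ Finset.range r, (1 - α) ^ i) *
        (∑ C, D C * if h : Accepted N C.1 then
          G (mkBlock off τ h.index (fun i => xor (C.2 i) (w i)) (syn col w)) else 0) +
        (1 - α) ^ r * G fun _ => 0 := by
  induction r with
  | zero => simp [attempts, Tree.mean]
  | succ r ih =>
    set S := ∑ C, D C * if h : Accepted N C.1 then
      G (mkBlock off τ h.index (fun i => xor (C.2 i) (w i)) (syn col w)) else 0
    have h1 : ∀ C : Clause k n, D C * (if h : Accepted N C.1 then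
        (.ret (mkBlock off τ h.index (fun i => xor (C.2 i) (w i)) (syn col w)) :
          Tree (Clause k n) (Fin (k + M) → Fin n))
        else attempts col off τ w r).mean D G =
        (D C * if h : Accepted N C.1 then
          G (mkBlock off τ h.index (fun i => xor (C.2 i) (w i)) (syn col w)) else 0) +
        (D C - D C * (if Accepted N C.1 then 1 else 0)) * (attempts col off τ w r).mean D G := by
      intro C
      split_ifs
      · simp [Tree.mean]
      · simp
    simp only [attempts, Tree.mean, h1]
    rw [Finset.sum_add_distrib, ← Finset.sum_mul, Finset.sum_sub_distrib, hD, hα, ih,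
      Finset.sum_range_succ', pow_succ']
    simp only [pow_succ', pow_zero, ← Finset.mul_sum]
    ring

/-- The tuple of variables with given numbers in the blocks. -/
def blockVars (hn : k * N ≤ n) (q : Fin k → Fin N) : Fin k ↪ Fin n where
  toFun i := ⟨k * q i + i, by
    have h1 : k * q i + i < k * (q i + 1) := by rw [Nat.mul_succ]; omega
    have h2 : k * (q i + 1) ≤ k * N := Nat.mul_le_mul_left k (q i).2
    omega⟩
  inj' i j h := by
    have h := congrArg (· % k) (Fin.mk.inj_iff.1 h)
    simp only [Nat.mul_add_mod, Nat.mod_eq_of_lt i.2, Nat.mod_eq_of_lt j.2] at h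
    exact Fin.ext h

omit [NeZero n] in
theorem blockVars_apply (hn : k * N ≤ n) (q : Fin k → Fin N) (i : Fin k) :
    (blockVars hn q i : ℕ) = k * q i + i := rfl

omit [NeZero n] in
theorem accepted_blockVars (hn : k * N ≤ n) (q : Fin k → Fin N) :
    Accepted N (blockVars hn q) := by
  intro i
  have hk : 0 < k := i.pos
  refine ⟨?_, ?_⟩
  · simp only [blockVars_apply, Nat.mul_add_mod, Nat.mod_eq_of_lt i.2]
  · simp only [blockVars_apply, Nat.mul_add_div hk, Nat.div_eq_of_lt i.2]
    exact (q i).2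

omit [NeZero n] in
theorem index_blockVars (hn : k * N ≤ n) (q : Fin k → Fin N)
    (h : Accepted N (blockVars hn q)) : h.index = q := by
  funext i
  have hk : 0 < k := i.pos
  refine Fin.ext ?_
  simp only [Accepted.index, blockVars_apply, Nat.mul_add_div hk, Nat.div_eq_of_lt i.2, add_zero]

-- Accepted tuples of variables correspond to arbitrary tuples of indices in the groups: the groups
-- are disjoint residue classes modulo `k`, so the variables are automatically distinct.
-- Conditioning on acceptance thus makes the variables independent.
omit [NeZero n] in
theorem sum_accepted (hn : k * N ≤ n) (F : (Fin k ↪ Fin n) → (Fin k → Fin N) → ℝ) :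
    ∑ ι : Fin k ↪ Fin n, (if h : Accepted N ι then F ι h.index else 0) =
      ∑ q, F (blockVars hn q) q := by
  symm
  refine Fintype.sum_of_injective (blockVars hn) ?_ _ _ ?_ ?_
  · intro q q' h
    funext i
    have := congrArg (fun ι : Fin k ↪ Fin n => (ι i : ℕ)) h
    simp only [blockVars_apply, Nat.add_right_cancel_iff] at this
    exact Fin.ext (Nat.eq_of_mul_eq_mul_left i.pos this)
  · intro ι hι
    rw [dif_neg]
    intro h
    refine hι ⟨h.index, ?_⟩
    ext i
    have := Nat.div_add_mod (ι i : ℕ) k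
    rw [(h i).1] at this
    exact this
  · intro q
    rw [dif_pos (accepted_blockVars hn q), index_blockVars]

/-! ### Noisy planted clauses and the law of the generated blocks -/

/-- The probability that a clause is accepted. -/
noncomputable def acceptProb (k N n : ℕ) : ℝ := N ^ k / Fintype.card (Fin k ↪ Fin n)

variable {col : Fin k → Syn M} {d : ℕ}

omit [NeZero n] in
theorem sum_clause (f : Clause k n → ℝ) :
    ∑ C, f C = ∑ ι : Fin k ↪ Fin n, ∑ c : Fin k → Bool, f (ι, c) :=
  Fintype.sum_prod_type _

-- For fixed variables the signs and the values determine each other, so the normalizing sum in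
-- `planted` is just the number of tuples of variables.
omit [NeZero n] in
theorem noisyPlanted_eq (hcol : ∀ u ≠ 0, d < (Finset.univ.filter fun i => pr u (col i) ≠ 0).card)
    (η : ℝ) (σ : Fin n → Bool) (C : Clause k n) :
    noisyPlanted (codeDist col) η σ C = 1 / Fintype.card (Fin k ↪ Fin n) *
      ((1 - η) * codeDist col (C.value σ) + η * (1 / 2) ^ k) := by
  have h1 : ∑ C' : Clause k n, codeDist col (C'.value σ) = Fintype.card (Fin k ↪ Fin n) := by
    rw [sum_clause]
    have : ∀ ι : Fin k ↪ Fin n, ∑ c : Fin k → Bool, codeDist col (Clause.value (ι, c) σ) = 1 := by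
      intro ι
      rw [← (isDistribution_codeDist hcol).2, ← sum_xor fun i => σ (ι i)]
      refine Finset.sum_congr rfl fun c _ => ?_
      congr 1
      funext i
      exact xor_xor_cancel _ _
    simp [this]
  rw [noisyPlanted, planted, uniformClause, h1, Fintype.card_prod]
  simp only [Fintype.card_pi, Fintype.card_bool, Finset.prod_const, Finset.card_univ,
    Fintype.card_fin]
  push_cast
  rw [div_pow, one_pow, one_div_mul_eq_div, one_div, mul_inv]
  ring

omit [NeZero n] in
theorem noisyPlanted_nonneg
    (hcol : ∀ u ≠ 0, d < (Finset.univ.filter fun i => pr u (col i) ≠ 0).card)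
    {η : ℝ} (hη₀ : 0 ≤ η) (hη₁ : η ≤ 1) (σ : Fin n → Bool) (C : Clause k n) :
    0 ≤ noisyPlanted (codeDist col) η σ C := by
  rw [noisyPlanted_eq hcol]
  have := (isDistribution_codeDist hcol).1 (C.value σ)
  have := mul_nonneg (sub_nonneg.2 hη₁) this
  positivity

omit [NeZero n] in
/-- The mean over noisy clauses of a function of the variables and the signs. -/
theorem sum_noisyPlanted_mul
    (hcol : ∀ u ≠ 0, d < (Finset.univ.filter fun i => pr u (col i) ≠ 0).card)
    (η : ℝ) (σ : Fin n → Bool) (f : Clause k n → ℝ) :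
    ∑ C, noisyPlanted (codeDist col) η σ C * f C =
      1 / Fintype.card (Fin k ↪ Fin n) * ∑ ι : Fin k ↪ Fin n, ∑ v : Fin k → Bool,
        ((1 - η) * codeDist col v + η * (1 / 2) ^ k) * f (ι, fun i => xor (v i) (σ (ι i))) := by
  rw [sum_clause, Finset.mul_sum]
  refine Finset.sum_congr rfl fun ι _ => ?_
  rw [← sum_xor fun i => σ (ι i), Finset.mul_sum]
  refine Finset.sum_congr rfl fun v _ => ?_
  rw [noisyPlanted_eq hcol, mul_assoc]
  congr 4
  congr 1
  funext i
  exact xor_xor_cancel _ _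

omit [NeZero n] in
theorem sum_noisy_weight
    (hcol : ∀ u ≠ 0, d < (Finset.univ.filter fun i => pr u (col i) ≠ 0).card) (η : ℝ) :
    ∑ v, ((1 - η) * codeDist col v + η * (1 / 2) ^ k) = 1 := by
  have := sum_noisy_codeDist hcol η fun _ => 1
  simpa [sum_noise] using this

omit [NeZero n] in
theorem sum_noisyPlanted (hcol : ∀ u ≠ 0, d < (Finset.univ.filter fun i => pr u (col i) ≠ 0).card)
    (hkn : k ≤ n) (η : ℝ) (σ : Fin n → Bool) :
    ∑ C, noisyPlanted (codeDist col) η σ C = 1 := by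
  have h := sum_noisyPlanted_mul hcol η σ fun _ => 1
  simp only [mul_one, sum_noisy_weight hcol] at h
  rw [h]
  have : Nonempty (Fin k ↪ Fin n) := ⟨Fin.castLEEmb hkn⟩
  have : (Fintype.card (Fin k ↪ Fin n) : ℝ) ≠ 0 := by exact_mod_cast Fintype.card_ne_zero
  rw [Finset.sum_const, Finset.card_univ, nsmul_eq_mul, mul_one, one_div_mul_cancel this]

omit [NeZero n] in
theorem sum_noisyPlanted_accepted
    (hcol : ∀ u ≠ 0, d < (Finset.univ.filter fun i => pr u (col i) ≠ 0).card)
    (hn : k * N ≤ n) (η : ℝ) (σ : Fin n → Bool) :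
    ∑ C, noisyPlanted (codeDist col) η σ C * (if Accepted N C.1 then 1 else 0) =
      acceptProb k N n := by
  rw [sum_noisyPlanted_mul hcol]
  have h1 : ∀ x : ℝ, ∑ v, ((1 - η) * codeDist col v + η * (1 / 2) ^ k) * x = x := fun x => by
    rw [← Finset.sum_mul, sum_noisy_weight hcol, one_mul]
  have h2 := sum_accepted hn fun _ _ => 1
  simp only [dite_eq_ite] at h2
  refine (congrArg (1 / (Fintype.card (Fin k ↪ Fin n) : ℝ) * ·) (Finset.sum_congr rfl fun ι _ =>
    h1 (if Accepted N ι then 1 else 0))).trans ?_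
  simp only [h2, acceptProb]
  rw [Finset.sum_const, Finset.card_univ, Fintype.card_fun, Fintype.card_fin, Fintype.card_fin,
    nsmul_eq_mul, mul_one, Nat.cast_pow, one_div_mul_eq_div]

/-- The generated blocks have exactly the law of a block model: its default probability is that of
`r` rejections, and its table is `τ` changed by the planted signs. The point is that for values `v`
and a uniform mask `w` the visible values `v + w` are uniform and independent of `v`, while `syn w =
syn (v + w) + syn v`, where `syn v` is distributed as noise. -/
theorem mean_genTree (hcol : ∀ u ≠ 0, d < (Finset.univ.filter fun i => pr u (col i) ≠ 0).card)
    (hN : 0 < N) (hn : k * N ≤ n) (hkn : k ≤ n) (η : ℝ) (σ : Fin n → Bool) (off : ℕ)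
    (τ : Fin N → Fin k → Bool) (r : ℕ) (G : (Fin (k + M) → Fin n) → ℝ) :
    (genTree col off τ r).mean (noisyPlanted (codeDist col) η σ) G =
      ∑ b, blockDist col off η ((1 - acceptProb k N n) ^ r)
        (fun q i => xor (τ q i) (σ (blockVars hn (fun _ => q) i))) b * G b := by
  set α := acceptProb k N n with hαdef
  have hZ : (Fintype.card (Fin k ↪ Fin n) : ℝ) ≠ 0 := by
    have : Nonempty (Fin k ↪ Fin n) := ⟨Fin.castLEEmb hkn⟩
    exact_mod_cast Fintype.card_ne_zero
  have hNr : (N : ℝ) ≠ 0 := by positivity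
  have hα := sum_noisyPlanted_accepted hcol hn η σ
  set τ' : Fin N → Fin k → Bool := fun q i => xor (τ q i) (σ (blockVars hn (fun _ => q) i))
  set R := ∑ z, noise M η z * ∑ v : Fin k → Bool, (1 / 2) ^ k *
        ∑ q : Fin k → Fin N, (1 / (N : ℝ)) ^ k * G (mkBlock off τ' q v (z + syn col v)) with hR
  have key : ∑ w : Fin k → Bool, (1 / 2 : ℝ) ^ k * (∑ C, noisyPlanted (codeDist col) η σ C *
      if h : Accepted N C.1 then
        G (mkBlock off τ h.index (fun i => xor (C.2 i) (w i)) (syn col w)) else 0) = α * R := by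
    have h1 : ∀ w : Fin k → Bool, (∑ C, noisyPlanted (codeDist col) η σ C *
        if h : Accepted N C.1 then
          G (mkBlock off τ h.index (fun i => xor (C.2 i) (w i)) (syn col w)) else 0) =
        1 / Fintype.card (Fin k ↪ Fin n) * ∑ q : Fin k → Fin N, ∑ v : Fin k → Bool,
          ((1 - η) * codeDist col v + η * (1 / 2) ^ k) *
            G (mkBlock off τ' q (fun i => xor (v i) (w i)) (syn col w)) := by
      intro w
      rw [sum_noisyPlanted_mul hcol]
      congr 1
      have := sum_accepted hn fun ι q => ∑ v : Fin k → Bool,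
        ((1 - η) * codeDist col v + η * (1 / 2) ^ k) *
          G (mkBlock off τ q (fun i => xor (xor (v i) (σ (ι i))) (w i)) (syn col w))
      refine Eq.trans (Finset.sum_congr rfl fun ι _ => ?_) (this.trans ?_)
      · split_ifs <;> simp
      · refine Finset.sum_congr rfl fun q _ => Finset.sum_congr rfl fun v _ => ?_
        congr 2
        funext i
        refine Fin.addCases (fun i => ?_) (fun j => ?_) i
        · simp only [mkBlock, Fin.addCases_left, lit, τ']
          congr 3
          have : blockVars hn q i = blockVars hn (fun _ => q i) i := rfl
          rw [this]
          cases v i <;> cases w i <;> cases τ (q i) i <;>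
            cases σ (blockVars hn (fun _ => q i) i) <;> rfl
        · simp only [mkBlock, Fin.addCases_right]
    simp only [h1]
    calc ∑ w : Fin k → Bool, (1 / 2 : ℝ) ^ k * (1 / Fintype.card (Fin k ↪ Fin n) *
          ∑ q : Fin k → Fin N, ∑ v : Fin k → Bool,
          ((1 - η) * codeDist col v + η * (1 / 2) ^ k) *
            G (mkBlock off τ' q (fun i => xor (v i) (w i)) (syn col w)))
        = (1 / 2 : ℝ) ^ k * (1 / Fintype.card (Fin k ↪ Fin n)) *
          ∑ q : Fin k → Fin N, ∑ v : Fin k → Bool,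
          ((1 - η) * codeDist col v + η * (1 / 2) ^ k) * ∑ w : Fin k → Bool,
            G (mkBlock off τ' q (fun i => xor (v i) (w i)) (syn col w)) := by
          simp only [← Finset.mul_sum, ← mul_assoc]
          congr 1
          rw [Finset.sum_comm]
          refine Finset.sum_congr rfl fun q _ => ?_
          rw [Finset.sum_comm]
          exact Finset.sum_congr rfl fun v _ => (Finset.mul_sum _ _ _).symm
      _ = (1 / 2 : ℝ) ^ k * (1 / Fintype.card (Fin k ↪ Fin n)) *
          ∑ q : Fin k → Fin N, ∑ z, noise M η z * ∑ w : Fin k → Bool,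
            G (mkBlock off τ' q w (z + syn col w)) := by
          congr 1
          refine Finset.sum_congr rfl fun q _ => ?_
          rw [← sum_noisy_codeDist hcol η
            fun z => ∑ w : Fin k → Bool, G (mkBlock off τ' q w (z + syn col w))]
          refine Finset.sum_congr rfl fun v _ => ?_
          congr 1
          -- Passing from the mask to the masked values `v + w`, whose sum with `v` is the mask
          -- again.
          rw [← sum_xor v]
          refine Finset.sum_congr rfl fun w _ => ?_
          rw [syn_xor, add_comm (syn col w)]
          congr 2
          funext i
          exact xor_xor_cancel _ _
      _ = α * R := by
          rw [hR, hαdef, acceptProb]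
          simp only [← Finset.mul_sum, ← mul_assoc]
          rw [Finset.sum_comm]
          have h2 : ∀ z, ∑ q : Fin k → Fin N, noise M η z * ∑ w : Fin k → Bool,
              G (mkBlock off τ' q w (z + syn col w)) = noise M η z * ∑ w : Fin k → Bool,
              ∑ q : Fin k → Fin N, G (mkBlock off τ' q w (z + syn col w)) := by
            intro z
            rw [← Finset.mul_sum, Finset.sum_comm]
          have h3 : ∀ z, noise M η z * (1 / 2) ^ k * (1 / (N : ℝ)) ^ k * (∑ w : Fin k → Bool,
              ∑ q : Fin k → Fin N, G (mkBlock off τ' q w (z + syn col w))) =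
              (1 / 2) ^ k * (1 / (N : ℝ)) ^ k * (noise M η z * ∑ w : Fin k → Bool,
              ∑ q : Fin k → Fin N, G (mkBlock off τ' q w (z + syn col w))) := by
            intro z; ring
          simp only [h2, h3]
          rw [← Finset.mul_sum]
          have h4 : (N : ℝ) ^ k * (1 / N) ^ k = 1 := by
            rw [← mul_pow, mul_one_div_cancel hNr, one_pow]
          have h5 : ∀ x y z : ℝ, (N : ℝ) ^ k / z * (x * (1 / (N : ℝ)) ^ k * y) =
              ((N : ℝ) ^ k * (1 / N) ^ k) * (x * (1 / z) * y) := by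
            intro x y z; ring
          rw [h5, h4, one_mul]
  rw [genTree, Tree.mean_branch, sum_blockDist_mul]
  simp only [mean_attempts col off τ _ (sum_noisyPlanted hcol hkn η σ) r G hα]
  -- The total probability that some attempt succeeds, which becomes the weight of the proper
  -- blocks.
  have h6 : (∑ i ∈ Finset.range r, (1 - α) ^ i) * α = 1 - (1 - α) ^ r := by
    have := mul_neg_geom_sum (1 - α) r
    rw [sub_sub_cancel] at this
    rw [mul_comm, this]
  simp only [mul_add, Finset.sum_add_distrib]
  have h7 : ∀ S : (Fin k → Bool) → ℝ, ∑ w : Fin k → Bool, (1 / 2 : ℝ) ^ k *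
      ((∑ i ∈ Finset.range r, (1 - α) ^ i) * S w) =
      (∑ i ∈ Finset.range r, (1 - α) ^ i) * ∑ w : Fin k → Bool, (1 / 2 : ℝ) ^ k * S w := by
    intro S
    rw [Finset.mul_sum]
    exact Finset.sum_congr rfl fun w _ => by ring
  rw [h7, key, ← mul_assoc, h6, add_comm]
  congr 1
  rw [← Finset.sum_mul, show ∑ w : Fin k → Bool, (1 / 2 : ℝ) ^ k = 1 by simp, one_mul]

end Generator

end SeqPred

namespace SeqPred

/-! ### Programs: registers and elementary facts

The registers of the programs below have even numbers; the odd ones are for the registers of a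
given prediction algorithm. -/

notation "rIn" => (0 : ℕ)
notation "rOne" => (2 : ℕ)
notation "rG" => (4 : ℕ)
notation "rD" => (6 : ℕ)
notation "rE" => (8 : ℕ)
notation "rX" => (10 : ℕ)
notation "rS" => (12 : ℕ)
notation "rP" => (14 : ℕ)
notation "rY" => (16 : ℕ)
notation "rC" => (18 : ℕ)

/-- The register for the `i`-th entry of a block. -/
def res (i : ℕ) : ℕ := 40 + 8 * i

/-- The register for a table of letters. -/
def tab (i : ℕ) (w : Bool) : ℕ := 42 + 8 * i + 2 * w.toNat

theorem tab_ne (i i' : ℕ) (w w' : Bool) (h : i ≠ i' ∨ w ≠ w') : tab i w ≠ tab i' w' := by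
  unfold tab
  cases w <;> cases w' <;> simp at h ⊢ <;> omega

theorem tab_mod (i : ℕ) (w : Bool) : tab i w % 8 ≠ 0 ∧ tab i w % 2 = 0 ∧ 42 ≤ tab i w := by
  unfold tab
  cases w <;> simp <;> omega

theorem MState.set_reg (st : MState) (v w : ℕ) (l : List ℕ) :
    (st.set v l).reg w = if w = v then l else st.reg w := by
  simp [MState.set, Function.update_apply]

theorem MState.set_top (st : MState) (v w : ℕ) (l : List ℕ) :
    (st.set v l).top w = if w = v then l.headD 0 else st.top w := by
  unfold MState.top
  rw [MState.set_reg]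
  split_ifs <;> rfl

theorem MState.set_set (st : MState) (v : ℕ) (l l' : List ℕ) :
    (st.set v l).set v l' = st.set v l' := by
  simp [MState.set]

theorem MState.top_eq_of_reg_eq {st st' : MState} {v : ℕ} (h : st'.reg v = st.reg v) :
    st'.top v = st.top v := by
  rw [MState.top, h, MState.top]

theorem Reach.seq {env : Source → ℕ → ℕ} {p q : Prog} {ks : List Prog} {st : MState}
    {c : List Prog × MState} {t : ℕ} (h : Reach env (p :: q :: ks, st) t c) :
    Reach env (Prog.seq p q :: ks, st) (t + 1) c :=
  Reach.head rfl h

section Lookup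

variable {env : Source → ℕ → ℕ}

/-- Move one entry from the first stack to the second one. -/
def moveTop (x : List ℕ × List ℕ) : List ℕ × List ℕ := (x.1.tail, x.1.headD 0 :: x.2)

/-- Move one entry back. -/
def moveBack (x : List ℕ × List ℕ) : List ℕ × List ℕ := (x.2.headD 0 :: x.1, x.2.tail)

theorem getD_cons_headD (l : List ℕ) (c : ℕ) : (l.headD 0 :: l.tail).getD c 0 = l.getD c 0 := by
  rcases l with _ | ⟨a, l⟩
  · rcases c with _ | c <;> simp
  · rfl

theorem moveTop_iterate (d : ℕ) (T X : List ℕ) :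
    (moveTop^[d] (T, X)).1.headD 0 = T.getD d 0 := by
  induction d generalizing T X with
  | zero => rcases T with _ | ⟨a, T⟩ <;> rfl
  | succ d ih =>
    rw [Function.iterate_succ_apply]
    refine (ih _ _).trans ?_
    rcases T with _ | ⟨a, T⟩ <;> simp

/-- The entries agree only up to trailing zeros: popping an empty stack moves a zero, which is then
put back. Tables are therefore always compared through `getD`. -/
theorem moveBack_moveTop (d : ℕ) (T X : List ℕ) :
    (moveBack^[d] (moveTop^[d] (T, X))).2 = X ∧
      ∀ c, (moveBack^[d] (moveTop^[d] (T, X))).1.getD c 0 = T.getD c 0 := by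
  induction d generalizing T X with
  | zero => exact ⟨rfl, fun _ => rfl⟩
  | succ d ih =>
    rw [Function.iterate_succ_apply', Function.iterate_succ_apply moveTop]
    obtain ⟨h1, h2⟩ := ih T.tail (T.headD 0 :: X)
    change (moveBack^[d] (moveTop^[d] (moveTop (T, X)))).2 = _ at h1
    refine ⟨by rw [moveBack, h1]; rfl, fun c => ?_⟩
    rw [moveBack, h1, ← getD_cons_headD T]
    rcases c with _ | c
    · rfl
    · exact h2 c

/-- Move as many entries of `T` to `rX` as the number on top of `rD`, and count them in `rE`. -/
def fetch (T : ℕ) : Prog :=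
  .loop rD (.seq (.copy T rX) (.seq (.pop T) (.seq (.sub rOne rD) (.add rOne rE))))

/-- Move as many entries of `rX` to `T` as the number on top of `rE`. -/
def unfetch (T : ℕ) : Prog :=
  .loop rE (.seq (.copy rX T) (.seq (.pop rX) (.sub rOne rE)))

theorem reach_fetch {T : ℕ} (hT : 40 ≤ T) (ks : List Prog) (d : ℕ) : ∀ st : MState,
    st.top rOne = 1 → st.top rD = d → ∃ st', Reach env (fetch T :: ks, st) (8 * d + 1) (ks, st') ∧
      st'.pos = st.pos ∧ (st'.reg T, st'.reg rX) = moveTop^[d] (st.reg T, st.reg rX) ∧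
      st'.top rD = 0 ∧ st'.top rE = st.top rE + d ∧
      ∀ v, v ≠ T → v ≠ rX → v ≠ rD → v ≠ rE → st'.reg v = st.reg v := by
  have hT' : T ≠ 2 ∧ T ≠ 6 ∧ T ≠ 8 ∧ T ≠ 10 := by omega
  induction d with
  | zero =>
    intro st h1 hd
    exact ⟨st, .of_step (by simp [fetch, step, hd]), rfl, rfl, hd, rfl, fun _ _ _ _ _ => rfl⟩
  | succ d ih =>
    intro st h1 hd
    let st₁ := (((st.set rX (st.top T :: st.reg rX)).set T (st.reg T).tail).set rD
      (d :: (st.reg rD).tail)).set rE ((st.top rE + 1) :: (st.reg rE).tail)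
    have hr : Reach env (fetch T :: ks, st) 8 (fetch T :: ks, st₁) := by
      refine Reach.head (c' := (_ :: fetch T :: ks, st)) (by simp [fetch, step, hd]; rfl) ?_
      refine ⟨7, le_rfl, ?_⟩
      simp [step, MState.set_top, MState.set_reg, hT', hT'.1.symm, hT'.2.1.symm, hT'.2.2.1.symm,
        h1, hd, st₁]
    obtain ⟨st', hr', hp, hm, hD, hE, hf⟩ := ih st₁
      (by simp [st₁, MState.set_top, hT'.1.symm, h1])
      (by simp [st₁, MState.set_top])
    refine ⟨st', (hr.trans hr').mono (by omega), hp, ?_, hD, ?_, fun v h1 h2 h3 h4 => ?_⟩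
    · rw [hm, Function.iterate_succ_apply]
      simp [st₁, MState.set_reg, hT', hT'.2.2.2.symm, moveTop, MState.top]
    · rw [hE]
      simp [st₁, MState.set_top]
      omega
    · rw [hf v h1 h2 h3 h4]
      simp [st₁, MState.set_reg, h1, h2, h3, h4]

theorem reach_unfetch {T : ℕ} (hT : 40 ≤ T) (ks : List Prog) (d : ℕ) : ∀ st : MState,
    st.top rOne = 1 → st.top rE = d → ∃ st', Reach env (unfetch T :: ks, st) (6 * d + 1) (ks, st') ∧
      st'.pos = st.pos ∧ (st'.reg T, st'.reg rX) = moveBack^[d] (st.reg T, st.reg rX) ∧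
      st'.top rE = 0 ∧ ∀ v, v ≠ T → v ≠ rX → v ≠ rE → st'.reg v = st.reg v := by
  have hT' : T ≠ 2 ∧ T ≠ 6 ∧ T ≠ 8 ∧ T ≠ 10 := by omega
  induction d with
  | zero =>
    intro st h1 hd
    exact ⟨st, .of_step (by simp [unfetch, step, hd]), rfl, rfl, hd, fun _ _ _ _ => rfl⟩
  | succ d ih =>
    intro st h1 hd
    let st₁ := ((st.set T (st.top rX :: st.reg T)).set rX (st.reg rX).tail).set rE
      (d :: (st.reg rE).tail)
    have hr : Reach env (unfetch T :: ks, st) 6 (unfetch T :: ks, st₁) := by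
      refine Reach.head (c' := (_ :: unfetch T :: ks, st)) (by simp [unfetch, step, hd]; rfl) ?_
      refine ⟨5, le_rfl, ?_⟩
      simp [step, MState.set_top, MState.set_reg, hT'.1.symm, hT'.2.2.1.symm, hT'.2.2.2.symm, h1, hd,
        st₁]
    obtain ⟨st', hr', hp, hm, hE, hf⟩ := ih st₁
      (by simp [st₁, MState.set_top, hT'.1.symm, h1])
      (by simp [st₁, MState.set_top])
    refine ⟨st', (hr.trans hr').mono (by omega), hp, ?_, hE, fun v h1 h2 h3 => ?_⟩
    · rw [hm, Function.iterate_succ_apply]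
      simp [st₁, MState.set_reg, hT', moveBack, MState.top]
    · rw [hf v h1 h2 h3]
      simp [st₁, MState.set_reg, h1, h2, h3]

/-- Push the entry of `T` whose index is on top of `rD` on `r`. -/
def lookup (T r : ℕ) : Prog := .seq (fetch T) (.seq (.copy T r) (unfetch T))

/-- Random access to a stack in time linear in the index: entries are moved aside, the exposed one
is copied, and the others are moved back. -/
theorem reach_lookup {T r : ℕ} (hT : 40 ≤ T) (hr : 40 ≤ r) (hTr : T ≠ r) (ks : List Prog)
    (st : MState) (h1 : st.top rOne = 1) (hE : st.top rE = 0) :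
    ∃ st', Reach env (lookup T r :: ks, st) (14 * st.top rD + 5) (ks, st') ∧ st'.pos = st.pos ∧
      (∀ c, (st'.reg T).getD c 0 = (st.reg T).getD c 0) ∧
      st'.top r = (st.reg T).getD (st.top rD) 0 ∧ st'.top rE = 0 ∧
      ∀ v, v ≠ T → v ≠ r → v ≠ rX → v ≠ rD → v ≠ rE → st'.reg v = st.reg v := by
  obtain ⟨st₁, hr₁, hp₁, hm₁, hD₁, hE₁, hf₁⟩ :=
    reach_fetch (env := env) hT (.seq (.copy T r) (unfetch T) :: ks) _ st h1 rfl
  rw [hE, zero_add] at hE₁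
  have hX : (10 : ℕ) ≠ r ∧ (2 : ℕ) ≠ r ∧ (8 : ℕ) ≠ r ∧ (2 : ℕ) ≠ T := by omega
  set st₂ := st₁.set r (st₁.top T :: st₁.reg r) with hst₂
  have hr₂ : Reach env (.seq (.copy T r) (unfetch T) :: ks, st₁) 2 (unfetch T :: ks, st₂) :=
    ⟨2, le_rfl, rfl⟩
  obtain ⟨st₃, hr₃, hp₃, hm₃, hE₃, hf₃⟩ := reach_unfetch (env := env) hT ks (st.top rD) st₂
    (by rw [hst₂, MState.set_top, if_neg hX.2.1, MState.top_eq_of_reg_eq (hf₁ 2 hX.2.2.2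
      (by decide) (by decide) (by decide)), h1])
    (by rw [hst₂, MState.set_top, if_neg hX.2.2.1, hE₁])
  have hm : (st₃.reg T, st₃.reg rX) =
      moveBack^[st.top rD] (moveTop^[st.top rD] (st.reg T, st.reg rX)) := by
    rw [hm₃, ← hm₁]
    simp [hst₂, MState.set_reg, hTr, hX.1]
  obtain ⟨h2, h3⟩ := moveBack_moveTop (st.top rD) (st.reg T) (st.reg rX)
  rw [← hm] at h2 h3
  refine ⟨st₃, ((Reach.seq (hr₁.trans hr₂)).trans hr₃).mono (by omega), hp₃.trans hp₁, h3, ?_, hE₃,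
    fun v a b c d e => ?_⟩
  · rw [MState.top_eq_of_reg_eq (hf₃ r (Ne.symm hTr) (by omega) (by omega)), hst₂, MState.set_top,
      if_pos rfl, ← moveTop_iterate _ _ (st.reg rX), ← hm₁]
    rfl
  · rw [hf₃ v a c e, hst₂, MState.set_reg, if_neg b, hf₁ v a c d e]

end Lookup

/-! ### The program which makes a block from clauses -/

section Gen

variable {k M N n : ℕ} [NeZero n]

/-- The coins and the clauses, written one after the other, as streams. -/
def streamEnv (ω : ℕ → Bool) (C : ℕ → Clause k n) : Source → ℕ → ℕ
  | .coin => fun i => (ω i).toNat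
  | .sample => fun j => (C (j / k)).codes.getD (j % k) 0
  | .past => fun _ => 0

omit [NeZero n] in
theorem streamEnv_sample (ω : ℕ → Bool) (C : ℕ → Clause k n) (l : ℕ) (i : Fin k) :
    streamEnv ω C .sample (k * l + i) = 2 * ((C l).1 i : ℕ) + ((C l).2 i).toNat := by
  have hk : 0 < k := i.pos
  simp only [streamEnv, Nat.mul_add_div hk, Nat.div_eq_of_lt i.2, Nat.mul_add_mod,
    Nat.mod_eq_of_lt i.2, add_zero, Clause.codes, List.getD_eq_getElem?_getD, List.getElem?_ofFn,
    dif_pos i.2, Option.getD_some]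

/-- The positions in the streams are as in `P`, when clauses of length `k` are read. -/
structure At (k : ℕ) (st : MState) (P : Pos) : Prop where
  coin : st.pos .coin = P.c
  sample : st.pos .sample = k * P.s

/-- The number of the letter, plus one, which replaces the literal with number `c` in position `i`
when the sign is changed if `w` holds; zero if the variable is not in the `i`-th block. -/
def tableVal (off : ℕ) (τ : Fin N → Fin k → Bool) (i : Fin k) (w : Bool) (c : ℕ) : ℕ :=
  if h : c / 2 / k < N ∧ c / 2 % k = i then
    off + 2 * (c / 2) + (xor (xor (decide (c % 2 = 1)) w) (τ ⟨c / 2 / k, h.1⟩ i)).toNat + 1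
  else 0

/-- The constants and the tables are in place. -/
structure Ready (off : ℕ) (τ : Fin N → Fin k → Bool) (st : MState) : Prop where
  one : st.top rOne = 1
  e : st.top rE = 0
  tab : ∀ (i : Fin k) w c, (st.reg (tab i w)).getD c 0 = tableVal off τ i w c

/-- The registers which are not used for intermediate results. -/
def Stable (v : ℕ) : Prop := v % 2 = 1 ∨ v = rIn ∨ v = rS ∨ v = rP ∨ v = rY

/-- Read the `m` first literals of a clause and look them up. -/
def lookups (w : Fin k → Bool) : ℕ → Prog
  | 0 => .skip
  | m + 1 => .seq (lookups w m) (.seq (.read .sample rD)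
      (lookup (tab m (if h : m < k then w ⟨m, h⟩ else false)) (res m)))

-- A literal number is at most `2 n`, so each lookup takes `O(n)` steps. The tables replace the
-- divisions and remainders which the instructions do not offer.
omit [NeZero n] in
theorem reach_lookups {ω : ℕ → Bool} {C : ℕ → Clause k n} {off : ℕ} {τ : Fin N → Fin k → Bool}
    (w : Fin k → Bool) {st : MState} {P : Pos} (hst : Ready off τ st) (hP : At k st P) (m : ℕ)
    (hm : m ≤ k) : ∀ ks : List Prog,
    ∃ st', Reach (streamEnv ω C) (lookups w m :: ks, st) (m * (28 * n + 10) + 1) (ks, st') ∧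
      st'.pos .coin = P.c ∧ st'.pos .sample = k * P.s + m ∧ Ready off τ st' ∧
      (∀ i : Fin k, (i : ℕ) < m → st'.top (res i) =
        tableVal off τ i (w i) (2 * ((C P.s).1 i : ℕ) + ((C P.s).2 i).toNat)) ∧
      ∀ v, Stable v → st'.reg v = st.reg v := by
  induction m with
  | zero =>
    intro ks
    exact ⟨st, (Reach.of_step rfl).mono (by omega), hP.coin, by rw [hP.sample]; rfl, hst,
      fun i hi => absurd hi (by omega), fun _ _ => rfl⟩
  | succ m ih =>
    intro ks
    have hmk : m < k := hm
    simp only [lookups, dif_pos hmk]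
    obtain ⟨st₁, hr₁, hc₁, hs₁, hR₁, hv₁, hf₁⟩ := ih hmk.le
      (.seq (.read .sample rD) (lookup (tab m (w ⟨m, hmk⟩)) (res m)) :: ks)
    set c := 2 * ((C P.s).1 ⟨m, hmk⟩ : ℕ) + ((C P.s).2 ⟨m, hmk⟩).toNat with hc
    have hcn : c ≤ 2 * n := by
      have := ((C P.s).1 ⟨m, hmk⟩).2
      have := Bool.toNat_le ((C P.s).2 ⟨m, hmk⟩)
      omega
    have hread : streamEnv ω C .sample (k * P.s + m) = c := streamEnv_sample ω C P.s ⟨m, hmk⟩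
    let st₂ : MState := { reg := Function.update st₁.reg rD (c :: st₁.reg rD),
                          pos := Function.update st₁.pos .sample (k * P.s + m + 1) }
    have hreg₂ : ∀ v, st₂.reg v = if v = rD then c :: st₁.reg rD else st₁.reg v := fun v => by
      simp [st₂, Function.update_apply]
    have htop₂ : ∀ v, v ≠ rD → st₂.top v = st₁.top v := fun v hv =>
      MState.top_eq_of_reg_eq (by rw [hreg₂, if_neg hv])
    have hD₂ : st₂.top rD = c := by simp [MState.top, hreg₂]
    have hr₂ : Reach (streamEnv ω C)
        (.seq (.read .sample rD) (lookup (tab m (w ⟨m, hmk⟩)) (res m)) :: ks, st₁) 2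
        (lookup (tab m (w ⟨m, hmk⟩)) (res m) :: ks, st₂) := by
      refine ⟨2, le_rfl, ?_⟩
      simp [step, hs₁, hread, st₂]
    have htab := tab_mod m (w ⟨m, hmk⟩)
    have hres : ∀ i, res i % 8 = 0 ∧ 40 ≤ res i := fun i => by unfold res; omega
    obtain ⟨st₃, hr₃, hp₃, hT₃, ht₃, hE₃, hf₃⟩ := reach_lookup (env := streamEnv ω C)
      (T := tab m (w ⟨m, hmk⟩)) (r := res m) (by omega) (hres m).2
      (fun h => htab.1 (h ▸ (hres m).1)) ks st₂
      (by rw [htop₂ 2 (by decide), hR₁.one]) (by rw [htop₂ 8 (by decide), hR₁.e])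
    have hregtab : ∀ (i : Fin k) w' c', (st₂.reg (tab i w')).getD c' 0 =
        tableVal off τ i w' c' := fun i w' c' => by
      rw [hreg₂, if_neg (by have := tab_mod i w'; omega), hR₁.tab]
    refine ⟨st₃, ((Reach.seq (hr₁.trans hr₂)).trans hr₃).mono ?_, ?_, ?_, ⟨?_, hE₃, ?_⟩, ?_, ?_⟩
    · rw [hD₂]
      have : (m + 1) * (28 * n + 10) = m * (28 * n + 10) + (28 * n + 10) := Nat.succ_mul _ _
      omega
    · rw [hp₃]
      simp [st₂, hc₁]
    · rw [hp₃]
      simp [st₂, Nat.add_assoc]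
    · rw [MState.top_eq_of_reg_eq (hf₃ 2 (by omega) (by have := hres m; omega) (by decide)
        (by decide) (by decide)), htop₂ 2 (by decide), hR₁.one]
    · intro i w' c'
      by_cases h : tab i w' = tab m (w ⟨m, hmk⟩)
      · rw [h, hT₃, ← h, hregtab]
      · have h1 := tab_mod i w'
        have h2 := hres m
        rw [hf₃ _ h (by omega) (by omega) (by omega) (by omega), hregtab]
    · intro i hi
      rcases Nat.lt_succ_iff_lt_or_eq.1 hi with hi | hi
      · have h1 := hres i
        have h2 : res i ≠ res m := by unfold res; omega
        rw [MState.top_eq_of_reg_eq (hf₃ _ (by omega) h2 (by omega) (by omega) (by omega)),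
          htop₂ _ (by omega), hv₁ i hi]
      · obtain rfl : i = ⟨m, hmk⟩ := Fin.ext hi
        rw [ht₃, hD₂, hregtab ⟨m, hmk⟩]
    · intro v hv
      have h1 := hres m
      have hv' : v % 2 = 1 ∨ v < 18 ∧ v ≠ 6 ∧ v ≠ 8 ∧ v ≠ 10 := by unfold Stable at hv; omega
      rw [hf₃ v (by omega) (by omega) (by omega) (by omega) (by omega), hreg₂,
        if_neg (by omega), hf₁ v hv]

/-- Run `p` if the first `m` entries of the block are all nonzero, otherwise run `q`. -/
def ifAll (p q : Prog) : ℕ → Prog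
  | 0 => p
  | m + 1 => .ite (res m) (ifAll p q m) q

theorem reach_ifAll_pos {env : Source → ℕ → ℕ} (p q : Prog) (ks : List Prog) (st : MState) (m : ℕ)
    (h : ∀ i < m, st.top (res i) ≠ 0) : Reach env (ifAll p q m :: ks, st) m (p :: ks, st) := by
  induction m with
  | zero => exact Reach.refl _ _
  | succ m ih =>
    exact Reach.head (by simp [ifAll, step, h m (Nat.lt_succ_self m)])
      (ih fun i hi => h i (by omega))

theorem reach_ifAll_neg {env : Source → ℕ → ℕ} (p q : Prog) (ks : List Prog) (st : MState) (m : ℕ)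
    (h : ∃ i < m, st.top (res i) = 0) : Reach env (ifAll p q m :: ks, st) m (q :: ks, st) := by
  induction m with
  | zero =>
    obtain ⟨i, hi, -⟩ := h
    omega
  | succ m ih =>
    by_cases hm : st.top (res m) = 0
    · exact (Reach.of_step (by simp [ifAll, step, hm])).mono (by omega)
    · refine Reach.head (by simp [ifAll, step, hm]) (ih ?_)
      obtain ⟨i, hi, h0⟩ := h
      rcases Nat.lt_succ_iff_lt_or_eq.1 hi with hi | rfl
      · exact ⟨i, hi, h0⟩
      · exact absurd h0 hm

/-- Push an entry, which is in a register or constant. -/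
def pushItem (r : ℕ) : ℕ ⊕ ℕ → Prog
  | .inl v => .copy v r
  | .inr c => .push r c

/-- The value of an entry. -/
def itemVal (st : MState) : ℕ ⊕ ℕ → ℕ
  | .inl v => st.top v
  | .inr c => c

/-- Push the entries with the indices in a list. -/
def pushItems (src : ℕ → ℕ ⊕ ℕ) (r : ℕ) : List ℕ → Prog
  | [] => .skip
  | i :: L => .seq (pushItem r (src i)) (pushItems src r L)

theorem reach_pushItems {env : Source → ℕ → ℕ} (src : ℕ → ℕ ⊕ ℕ) {r : ℕ}
    (hr : ∀ i v, src i = .inl v → v ≠ r) (ks : List Prog) (L : List ℕ) (st : MState) :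
    Reach env (pushItems src r L :: ks, st) (2 * L.length + 1)
      (ks, st.set r ((L.map fun i => itemVal st (src i)).reverse ++ st.reg r)) := by
  induction L generalizing st with
  | nil =>
    refine (Reach.of_step ?_).mono (by simp)
    simp [pushItems, step, MState.set]
  | cons i L ih =>
    have h1 : Reach env (pushItems src r (i :: L) :: ks, st) 2
        (pushItems src r L :: ks, st.set r (itemVal st (src i) :: st.reg r)) := by
      refine Reach.seq ?_
      rcases hi : src i with v | c <;> exact .of_step rfl
    have h2 := ih (st.set r (itemVal st (src i) :: st.reg r))
    have h3 : ∀ j, itemVal (st.set r (itemVal st (src i) :: st.reg r)) (src j) =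
        itemVal st (src j) := by
      intro j
      rcases hj : src j with v | c
      · simp only [itemVal]
        rw [MState.set_top, if_neg (hr j v hj)]
      · rfl
    rw [MState.set_set] at h2
    simp only [h3, MState.set_reg, if_true] at h2
    refine ((h1.trans h2).mono (by simp; omega)).trans (t' := 0) ?_ |>.mono le_rfl
    simp [Reach.refl]

/-- Where the entries of a block are found after a clause has been accepted. -/
def blockSrc (col : Fin k → Syn M) (w : Fin k → Bool) (i : ℕ) : ℕ ⊕ ℕ :=
  if i < k then .inl (res i)
  else .inr (if h : i - k < M then code (syn col w ⟨i - k, h⟩) + 1 else 0)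

/-- Push the entries with indices in `L` on `r`, and those with indices in `L'` on `rY`. -/
def output (r : ℕ) (L L' : List ℕ) (src : ℕ → ℕ ⊕ ℕ) : Prog :=
  .seq (pushItems src r L) (pushItems src rY L')

/-- Make a block out of at most `t` clauses, when the sign changes are given by `w`. -/
def attemptsProg (col : Fin k → Syn M) (r : ℕ) (L L' : List ℕ) (w : Fin k → Bool) : ℕ → Prog
  | 0 => output r L L' fun _ => .inr 1
  | t + 1 => .seq (lookups w k)
      (ifAll (output r L L' (blockSrc col w)) (attemptsProg col r L L' w t) k)

/-- Toss `k` coins and continue accordingly. -/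
def branchProg : ∀ k : ℕ, ((Fin k → Bool) → Prog) → Prog
  | 0, F => F Fin.elim0
  | k + 1, F => .seq (.read .coin rC) (.ite rC (branchProg k fun w => F (Fin.cons true w))
      (branchProg k fun w => F (Fin.cons false w)))

/-- The program which makes a block. -/
def genProg (col : Fin k → Syn M) (t r : ℕ) (L L' : List ℕ) : Prog :=
  branchProg k fun w => attemptsProg col r L L' w t

/-- The `i`-th letter of a block, plus one. -/
def blockVal {K : ℕ} (b : Fin K → Fin n) (i : ℕ) : ℕ := if h : i < K then (b ⟨i, h⟩ : ℕ) + 1 else 0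

/-- The effect of writing the entries of the block `b` with indices in `L` on `r` and those with
indices in `L'` on `rY`. -/
structure Written {K : ℕ} (r : ℕ) (L L' : List ℕ) (b : Fin K → Fin n) (st st' : MState) :
    Prop where
  main : st'.reg r = (L.map (blockVal b)).reverse ++ st.reg r
  test : st'.reg rY = (L'.map (blockVal b)).reverse ++ st.reg rY
  frame : ∀ v, Stable v → v ≠ r → v ≠ rY → st'.reg v = st.reg v

omit [NeZero n] in
theorem Written.of_eq {K : ℕ} {r : ℕ} {L L' : List ℕ} {b : Fin K → Fin n} {st st₁ st' : MState}
    (h : Written r L L' b st₁ st') (hr : Stable r) (hst : ∀ v, Stable v → st₁.reg v = st.reg v) :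
    Written r L L' b st st' :=
  ⟨by rw [h.main, hst r hr], by rw [h.test, hst rY (by simp [Stable])],
    fun v hv h1 h2 => by rw [h.frame v hv h1 h2, hst v hv]⟩

omit [NeZero n] in
theorem reach_output {K : ℕ} {env : Source → ℕ → ℕ} {off : ℕ} {τ : Fin N → Fin k → Bool}
    {r : ℕ} (hr : r = rS ∨ r = rP) {L L' : List ℕ} {src : ℕ → ℕ ⊕ ℕ} {b : Fin K → Fin n}
    {st : MState} (hsrc : ∀ i v, src i = .inl v → 40 ≤ v)
    (hL : ∀ i ∈ L ++ L', itemVal st (src i) = blockVal b i) (hst : Ready off τ st)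
    (ks : List Prog) :
    ∃ st', Reach env (output r L L' src :: ks, st) (2 * (L.length + L'.length) + 3) (ks, st') ∧
      st'.pos = st.pos ∧ Ready off τ st' ∧ Written r L L' b st st' := by
  have hr' : r = 12 ∨ r = 14 := hr
  have h1 := reach_pushItems (env := env) src (r := r)
    (fun i v h => by have := hsrc i v h; omega) (pushItems src rY L' :: ks) L st
  set st₁ := st.set r ((L.map fun i => itemVal st (src i)).reverse ++ st.reg r) with hst₁
  have h2 := reach_pushItems (env := env) src (r := rY)
    (fun i v h => by have := hsrc i v h; omega) ks L' st₁
  have hval : ∀ i, itemVal st₁ (src i) = itemVal st (src i) := by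
    intro i
    rcases hi : src i with v | c
    · have := hsrc i v hi
      simp only [itemVal]
      rw [hst₁, MState.set_top, if_neg (by omega)]
    · rfl
  set st₂ := st₁.set rY ((L'.map fun i => itemVal st₁ (src i)).reverse ++ st₁.reg rY) with hst₂
  have hreg : ∀ v, v ≠ r → v ≠ rY → st₂.reg v = st.reg v := by
    intro v hv hv'
    rw [hst₂, MState.set_reg, if_neg hv', hst₁, MState.set_reg, if_neg hv]
  refine ⟨st₂, (Reach.seq (h1.trans h2)).mono (by omega), rfl, ⟨?_, ?_, ?_⟩, ⟨?_, ?_, ?_⟩⟩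
  · rw [MState.top_eq_of_reg_eq (hreg 2 (by omega) (by omega)), hst.one]
  · rw [MState.top_eq_of_reg_eq (hreg 8 (by omega) (by omega)), hst.e]
  · intro i w c
    have := tab_mod i w
    rw [hreg _ (by omega) (by omega), hst.tab]
  · rw [hst₂, MState.set_reg, if_neg (by omega), hst₁, MState.set_reg, if_pos rfl]
    congr 2
    exact List.map_congr_left fun i hi => hL i (List.mem_append_left _ hi)
  · rw [hst₂, MState.set_reg, if_pos rfl]
    congr 1
    · congr 1
      exact List.map_congr_left fun i hi => by rw [hval, hL i (List.mem_append_right _ hi)]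
    · rw [hst₁, MState.set_reg, if_neg (by omega)]
  · exact fun v _ h h' => hreg v h h'

/-- The condition `hoff` ensures that the letters of all literals are below `n`, so the reduction
modulo `n` in `lit` has no effect. -/
theorem tableVal_accepted {off : ℕ} (hoff : off + 2 * (k * N) ≤ n) (τ : Fin N → Fin k → Bool)
    (C : Clause k n) (h : Accepted N C.1) (w : Fin k → Bool) (i : Fin k) :
    tableVal off τ i (w i) (2 * (C.1 i : ℕ) + (C.2 i).toNat) =
      (lit off τ i (h.index i) (xor (C.2 i) (w i)) : Fin n).val + 1 := by
  have hk : 0 < k := i.pos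
  have h1 : (2 * (C.1 i : ℕ) + (C.2 i).toNat) / 2 = C.1 i := by
    cases C.2 i <;> simp
    omega
  have h2 : decide ((2 * (C.1 i : ℕ) + (C.2 i).toNat) % 2 = 1) = C.2 i := by
    cases C.2 i <;> simp
  have h3 := Nat.div_add_mod (C.1 i : ℕ) k
  rw [(h i).1] at h3
  have h4 : (C.1 i : ℕ) < k * N := by
    rw [Nat.mul_comm]
    exact (Nat.div_lt_iff_lt_mul hk).1 (h i).2
  simp only [tableVal, h1, h2]
  rw [dif_pos ⟨(h i).2, (h i).1⟩]
  have h5 : k * ((h.index i : Fin N) : ℕ) + i = (C.1 i : ℕ) := h3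
  have h6 := Bool.toNat_le (xor (xor (C.2 i) (w i)) (τ (h.index i) i))
  have h7 : (lit off τ i (h.index i) (xor (C.2 i) (w i)) : Fin n).val =
      off + 2 * (C.1 i : ℕ) + (xor (xor (C.2 i) (w i)) (τ (h.index i) i)).toNat := by
    simp only [lit, Fin.ofNat, h5]
    exact Nat.mod_eq_of_lt (by omega)
  rw [h7]
  rfl

theorem mkBlock_castAdd (off : ℕ) (σ : Fin N → Fin k → Bool) (q : Fin k → Fin N) (v : Fin k → Bool)
    (z : Syn M) (i : Fin k) :
    (mkBlock off σ q v z (Fin.castAdd M i) : Fin n) = lit off σ i (q i) (v i) :=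
  Fin.addCases_left i

theorem mkBlock_natAdd (off : ℕ) (σ : Fin N → Fin k → Bool) (q : Fin k → Fin N) (v : Fin k → Bool)
    (z : Syn M) (j : Fin M) :
    (mkBlock off σ q v z (Fin.natAdd k j) : Fin n) = Fin.ofNat n (code (z j)) :=
  Fin.addCases_right j

omit [NeZero n] in
theorem tableVal_eq_zero {off : ℕ} (τ : Fin N → Fin k → Bool) (C : Clause k n) (i : Fin k)
    (h : ¬((C.1 i : ℕ) % k = i ∧ (C.1 i : ℕ) / k < N)) (w : Bool) :
    tableVal off τ i w (2 * (C.1 i : ℕ) + (C.2 i).toNat) = 0 := by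
  have h1 : (2 * (C.1 i : ℕ) + (C.2 i).toNat) / 2 = C.1 i := by
    cases C.2 i <;> simp
    omega
  simp only [tableVal, h1]
  rw [dif_neg fun h' => h ⟨h'.2, h'.1⟩]

/-- The program follows `attempts`: a clause is accepted exactly if all its table entries are
nonzero, because letters are stored plus one. Since `4 ≤ n`, the codes of syndrome pairs are
letters. -/
theorem reach_attempts {ω : ℕ → Bool} {C : ℕ → Clause k n} (y : ℕ → Clause k n) {off : ℕ}
    (hoff : off + 2 * (k * N) ≤ n) (hn : 4 ≤ n)
    {τ : Fin N → Fin k → Bool} (col : Fin k → Syn M) {r : ℕ} (hr : r = rS ∨ r = rP)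
    {L L' : List ℕ} (hL : ∀ i ∈ L ++ L', i < k + M) (w : Fin k → Bool) (ks : List Prog) (t : ℕ) :
    ∀ (st : MState) (P : Pos), Ready off τ st → At k st P →
    ∃ st', Reach (streamEnv ω C) (attemptsProg col r L L' w t :: ks, st)
        (t * (k * (28 * n + 11) + 2) + (2 * (L.length + L'.length) + 3)) (ks, st') ∧
      At k st' ((attempts col off τ w t).run ω C y P).2 ∧ Ready off τ st' ∧
      Written r L L' ((attempts col off τ w t).run ω C y P).1 st st' := by
  have hrS : Stable r := by unfold Stable; omega
  induction t with
  | zero =>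
    intro st P hst hP
    obtain ⟨st', h1, h2, h3, h4⟩ := reach_output (env := streamEnv ω C) hr (L := L) (L' := L')
      (src := fun _ => .inr 1) (b := fun _ : Fin (k + M) => (0 : Fin n)) (st := st) (by simp)
      (fun i hi => by simp [itemVal, blockVal, hL i hi]) hst ks
    exact ⟨st', h1.mono (by omega), ⟨by rw [h2]; exact hP.coin, by rw [h2]; exact hP.sample⟩, h3,
      h4⟩
  | succ t ih =>
    intro st P hst hP
    obtain ⟨st₁, hr₁, hc₁, hs₁, hR₁, hv₁, hf₁⟩ := reach_lookups (ω := ω) (C := C) w hst hP k le_rfl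
      (ifAll (output r L L' (blockSrc col w)) (attemptsProg col r L L' w t) k :: ks)
    have hAt : At k st₁ ⟨P.c, P.s + 1, P.p⟩ := ⟨hc₁, by rw [hs₁]; ring⟩
    have hcost : (t + 1) * (k * (28 * n + 11) + 2) =
        t * (k * (28 * n + 11) + 2) + (k * (28 * n + 10) + k + 2) := by ring
    by_cases h : Accepted N (C P.s).1
    · have hrun : (attempts col off τ w (t + 1)).run ω C y P =
          (mkBlock off τ h.index (fun i => xor ((C P.s).2 i) (w i)) (syn col w),
            ⟨P.c, P.s + 1, P.p⟩) := by
        simp only [attempts, Tree.run, dif_pos h]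
      obtain ⟨st', h1, h2, h3, h4⟩ := reach_output (env := streamEnv ω C) hr (L := L) (L' := L')
        (src := blockSrc col w)
        (b := mkBlock off τ h.index (fun i => xor ((C P.s).2 i) (w i)) (syn col w)) (st := st₁)
        (by
          intro i v hv
          unfold blockSrc at hv
          split_ifs at hv
          obtain rfl := Sum.inl.inj hv
          unfold res
          omega)
        (by
          intro i hi
          have hi := hL i hi
          by_cases hik : i < k
          · simp only [blockSrc, if_pos hik, itemVal, blockVal, dif_pos hi]
            rw [hv₁ ⟨i, hik⟩ hik, tableVal_accepted hoff τ (C P.s) h w ⟨i, hik⟩]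
            have : (⟨i, hi⟩ : Fin (k + M)) = Fin.castAdd M ⟨i, hik⟩ := rfl
            rw [this, mkBlock_castAdd (n := n)]
          · have hiM : i - k < M := by omega
            have h' := code_lt (syn col w ⟨i - k, hiM⟩)
            simp only [blockSrc, if_neg hik, itemVal, blockVal, dif_pos hi, dif_pos hiM]
            have : (⟨i, hi⟩ : Fin (k + M)) = Fin.natAdd k ⟨i - k, hiM⟩ :=
              Fin.ext (by simp; omega)
            rw [this, mkBlock_natAdd (n := n)]
            exact congrArg (· + 1) (Nat.mod_eq_of_lt (by omega)).symm)
        hR₁ ks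
      refine ⟨st', (((Reach.seq hr₁).trans (reach_ifAll_pos _ _ _ _ _ fun i hi => ?_)).trans
        h1).mono (by rw [hcost]; omega), ?_, h3, ?_⟩
      · rw [hv₁ ⟨i, hi⟩ hi, tableVal_accepted hoff τ (C P.s) h w ⟨i, hi⟩]
        omega
      · rw [hrun]
        exact ⟨by rw [h2]; exact hAt.coin, by rw [h2]; exact hAt.sample⟩
      · rw [hrun]
        exact h4.of_eq hrS hf₁
    · have hrun : (attempts col off τ w (t + 1)).run ω C y P =
          (attempts col off τ w t).run ω C y ⟨P.c, P.s + 1, P.p⟩ := by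
        simp only [attempts, Tree.run, dif_neg h]
      obtain ⟨st', h1, h2, h3, h4⟩ := ih st₁ _ hR₁ hAt
      refine ⟨st', (((Reach.seq hr₁).trans (reach_ifAll_neg _ _ _ _ _ ?_)).trans
        h1).mono (by rw [hcost]; omega), ?_, h3, ?_⟩
      · unfold Accepted at h
        rw [not_forall] at h
        obtain ⟨i, hi⟩ := h
        exact ⟨i, i.2, by rw [hv₁ i i.2, tableVal_eq_zero τ (C P.s) i hi]⟩
      · rw [hrun]
        exact h2
      · rw [hrun]
        exact h4.of_eq hrS hf₁

omit [NeZero n] in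
/-- A program which tosses `k` coins and continues accordingly, if its continuations carry out
computations. The coins change only the register `rC`. -/
theorem reach_branch {α : Type} {ω : ℕ → Bool} {C y : ℕ → Clause k n}
    {Pre : MState → Prop} {Post : MState → MState → α → Prop}
    (hPre : ∀ st st', Pre st → (∀ v, v ≠ rC → st'.reg v = st.reg v) → Pre st')
    (hPost : ∀ st st₁ st' a, (∀ v, v ≠ rC → st₁.reg v = st.reg v) → Post st₁ st' a → Post st st' a)
    (cost : ℕ) (ks : List Prog) (m : ℕ) : ∀ (F : (Fin m → Bool) → Prog)
    (F' : (Fin m → Bool) → Tree (Clause k n) α)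
    (_ : ∀ w st P, Pre st → At k st P → ∃ st', Reach (streamEnv ω C) (F w :: ks, st) cost (ks, st') ∧
      At k st' ((F' w).run ω C y P).2 ∧ Post st st' ((F' w).run ω C y P).1)
    (st : MState) (P : Pos), Pre st → At k st P →
    ∃ st', Reach (streamEnv ω C) (branchProg m F :: ks, st) (3 * m + cost) (ks, st') ∧
      At k st' ((Tree.branch m F').run ω C y P).2 ∧
      Post st st' ((Tree.branch m F').run ω C y P).1 := by
  induction m with
  | zero =>
    intro F F' h st P hst hP
    obtain ⟨st', h1, h2⟩ := h Fin.elim0 st P hst hP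
    exact ⟨st', h1.mono (by omega), h2⟩
  | succ m ih =>
    intro F F' h st P hst hP
    let st₁ : MState := { reg := Function.update st.reg rC ((ω P.c).toNat :: st.reg rC),
                          pos := Function.update st.pos .coin (P.c + 1) }
    have hreg : ∀ v, v ≠ rC → st₁.reg v = st.reg v := fun v hv => by simp [st₁, hv]
    have hAt : At k st₁ ⟨P.c + 1, P.s, P.p⟩ := ⟨by simp [st₁], by simp [st₁, hP.sample]⟩
    obtain ⟨st', h1, h2, h3⟩ := ih (fun w => F (Fin.cons (ω P.c) w))
      (fun w => F' (Fin.cons (ω P.c) w)) (fun w => h (Fin.cons (ω P.c) w)) st₁ _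
      (hPre _ _ hst hreg) hAt
    have hr : Reach (streamEnv ω C) (branchProg (m + 1) F :: ks, st) 3
        (branchProg m (fun w => F (Fin.cons (ω P.c) w)) :: ks, st₁) := by
      refine ⟨3, le_rfl, ?_⟩
      cases hb : ω P.c <;>
        simp [branchProg, step, streamEnv, hP.coin, hb, st₁, MState.top]
    refine ⟨st', (hr.trans h1).mono (by omega), ?_, ?_⟩
    · exact h2
    · exact hPost _ _ _ _ hreg h3

theorem reach_gen {ω : ℕ → Bool} {C : ℕ → Clause k n} (y : ℕ → Clause k n) {off : ℕ}
    (hoff : off + 2 * (k * N) ≤ n) (hn : 4 ≤ n)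
    {τ : Fin N → Fin k → Bool} (col : Fin k → Syn M) {r : ℕ} (hr : r = rS ∨ r = rP)
    {L L' : List ℕ} (hL : ∀ i ∈ L ++ L', i < k + M) (ks : List Prog) (t : ℕ)
    (st : MState) (P : Pos) (hst : Ready off τ st) (hP : At k st P) :
    ∃ st', Reach (streamEnv ω C) (genProg col t r L L' :: ks, st)
        (3 * k + (t * (k * (28 * n + 11) + 2) + (2 * (L.length + L'.length) + 3))) (ks, st') ∧
      At k st' ((genTree col off τ t).run ω C y P).2 ∧ Ready off τ st' ∧
      Written r L L' ((genTree col off τ t).run ω C y P).1 st st' := by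
  refine reach_branch (Pre := Ready off τ) (Post := fun st st' b => Ready off τ st' ∧
    Written r L L' b st st') ?_ ?_ _ ks k _ _ ?_ st P hst hP
  · intro st st' h heq
    refine ⟨?_, ?_, fun i w c => ?_⟩
    · rw [MState.top_eq_of_reg_eq (heq 2 (by decide)), h.one]
    · rw [MState.top_eq_of_reg_eq (heq 8 (by decide)), h.e]
    · have := tab_mod i w
      rw [heq _ (by omega), h.tab]
  · intro st st₁ st' b heq h
    refine ⟨h.1, h.2.of_eq (by unfold Stable; omega) fun v hv => heq v ?_⟩
    unfold Stable at hv
    omega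
  · intro w st P hst hP
    exact reach_attempts y hoff hn col hr hL w ks t st P hst hP

end Gen

end SeqPred

namespace SeqPred

/-! ### The program which makes the tables -/

section Table

variable {k N n : ℕ}

/-- Push entries on `T`: constants to which the top of `rG` is added, or zeros. -/
def pushRow (T : ℕ) : List (Option ℕ) → Prog
  | [] => .skip
  | none :: l => .seq (.push T 0) (pushRow T l)
  | some x :: l => .seq (.push T x) (.seq (.add rG T) (pushRow T l))

theorem reach_pushRow {env : Source → ℕ → ℕ} {T : ℕ} (hT : T ≠ rG) (ks : List Prog)
    (l : List (Option ℕ)) : ∀ st : MState, Reach env (pushRow T l :: ks, st) (4 * l.length + 1)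
      (ks, st.set T ((l.map fun o => o.elim 0 (· + st.top rG)).reverse ++ st.reg T)) := by
  induction l with
  | nil =>
    intro st
    refine (Reach.of_step ?_).mono (by simp)
    simp [pushRow, step, MState.set]
  | cons o l ih =>
    intro st
    have h1 : Reach env (pushRow T (o :: l) :: ks, st) 4 (pushRow T l :: ks,
        st.set T (o.elim 0 (· + st.top rG) :: st.reg T)) := by
      rcases o with _ | x
      · exact ⟨2, by omega, rfl⟩
      · refine ⟨4, le_rfl, ?_⟩
        simp [pushRow, step, MState.set_set, MState.set_top, hT.symm]
    have h2 := ih (st.set T (o.elim 0 (· + st.top rG) :: st.reg T))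
    rw [MState.set_set, MState.set_top, if_neg hT.symm, MState.set_reg, if_pos rfl] at h2
    refine (h1.trans h2).mono (by simp; omega) |>.trans (t' := 0) ?_
    simp [Reach.refl]

/-- The entries of the table of `i` and `w` which come from one block of variables. -/
def rowItem (row : Fin k → Bool) (i : Fin k) (w : Bool) (c : ℕ) : Option ℕ :=
  if c / 2 = i then some (2 * i + (xor (xor (decide (c % 2 = 1)) w) (row i)).toNat) else none

/-- The entries, if `G` is the number of the first letter, plus one. -/
def rowList (G : ℕ) (row : Fin k → Bool) (i : Fin k) (w : Bool) : List ℕ :=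
  (List.range (2 * k)).map fun c => (rowItem row i w c).elim 0 (· + G)

/-- Push the entries which come from one block of variables on several tables. -/
def pushRows (row : Fin k → Bool) : List (Fin k × Bool) → Prog
  | [] => .skip
  | x :: J => .seq (pushRow (tab x.1 x.2) ((List.range (2 * k)).map (rowItem row x.1 x.2)).reverse)
      (pushRows row J)

theorem tab_inj {i i' : Fin k} {w w' : Bool} (h : (i, w) ≠ (i', w')) : tab i w ≠ tab i' w' := by
  refine tab_ne _ _ _ _ ?_
  by_contra h'
  push Not at h'
  exact h (Prod.ext (Fin.ext h'.1) h'.2)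

theorem reach_pushRows {env : Source → ℕ → ℕ} (row : Fin k → Bool) (ks : List Prog)
    (J : List (Fin k × Bool)) : ∀ (_ : J.Nodup) (st : MState),
    ∃ st', Reach env (pushRows row J :: ks, st) (J.length * (8 * k + 2) + 1) (ks, st') ∧
      st'.pos = st.pos ∧
      (∀ (i : Fin k) w, st'.reg (tab i w) =
        (if (i, w) ∈ J then rowList (st.top rG) row i w else []) ++ st.reg (tab i w)) ∧
      ∀ v, v < 40 ∨ v % 2 = 1 → st'.reg v = st.reg v := by
  induction J with
  | nil => exact fun _ st => ⟨st, (Reach.of_step rfl).mono (by simp), rfl, by simp, fun _ _ => rfl⟩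
  | cons x J ih =>
    intro hJ st
    obtain ⟨i₀, w₀⟩ := x
    have ht := tab_mod i₀ w₀
    have h1 := reach_pushRow (env := env) (T := tab i₀ w₀) (by omega) (pushRows row J :: ks)
      ((List.range (2 * k)).map (rowItem row i₀ w₀)).reverse st
    rw [List.map_reverse, List.reverse_reverse, List.map_map] at h1
    change Reach env _ _ (_, st.set (tab i₀ w₀) (rowList (st.top rG) row i₀ w₀ ++ _)) at h1
    obtain ⟨st', h2, hp, ht', hf⟩ := ih (List.nodup_cons.1 hJ).2
      (st.set (tab i₀ w₀) (rowList (st.top rG) row i₀ w₀ ++ st.reg (tab i₀ w₀)))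
    refine ⟨st', ((Reach.seq h1).trans h2).mono ?_, hp, fun i w => ?_, fun v hv => ?_⟩
    · simp [Nat.succ_mul]; omega
    · have hG : ∀ l, (st.set (tab i₀ w₀) l).top rG = st.top rG := fun l => by
        rw [MState.set_top, if_neg (by omega)]
      rw [ht', hG, MState.set_reg]
      by_cases h : (i, w) = (i₀, w₀)
      · obtain ⟨rfl, rfl⟩ := Prod.mk.inj h
        simp [(List.nodup_cons.1 hJ).1]
      · rw [if_neg (tab_inj h)]
        simp only [List.mem_cons, h, false_or]
    · rw [hf v hv, MState.set_reg, if_neg (by omega)]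

/-- Make the tables of all blocks, from the last one to the first one. The top of `rG` is the number
of the first letter of the current block, plus one. -/
noncomputable def tabLoop (k : ℕ) : Prog :=
  .loop rG (branchProg k fun row => .seq (pushRows row (Finset.univ : Finset (Fin k × Bool)).toList)
    (.seq (.push rX (2 * k)) (.sub rX rG)))

/-- The choice of a sign change for each variable. -/
def tabTree {B : Type} (k : ℕ) : ∀ N : ℕ, Tree B (Fin N → Fin k → Bool)
  | 0 => .ret Fin.elim0
  | N + 1 => (Tree.branch k .ret).bind fun row => (tabTree k N).bind fun rest =>
      .ret (Fin.snoc rest row)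

/-- A new last row of signs extends each table by `2 k` entries at its end. As stacks grow at the
front, the loop treats the last row first. -/
theorem tableVal_snoc (off : ℕ) (rest : Fin N → Fin k → Bool) (row : Fin k → Bool) (i : Fin k)
    (w : Bool) :
    (List.range (2 * k * (N + 1))).map
        (tableVal off (Fin.snoc rest row : Fin (N + 1) → Fin k → Bool) i w) =
      (List.range (2 * k * N)).map (tableVal off rest i w) ++
        rowList (off + 2 * (k * N) + 1) row i w := by
  have hk : 0 < k := i.pos
  rw [Nat.mul_add, mul_one, List.range_add, List.map_append, List.map_map, rowList]
  congr 1
  · refine List.map_congr_left fun c hc => ?_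
    have hc : c / 2 / k < N := by
      rw [Nat.div_div_eq_div_mul, Nat.div_lt_iff_lt_mul (by omega), Nat.mul_comm]
      exact List.mem_range.1 hc
    have e : (⟨c / 2 / k, by omega⟩ : Fin (N + 1)) = Fin.castSucc ⟨c / 2 / k, hc⟩ := rfl
    simp only [tableVal, hc, true_and, show c / 2 / k < N + 1 by omega, e, Fin.snoc_castSucc]
  · refine List.map_congr_left fun c hc => ?_
    have hc : c < 2 * k := List.mem_range.1 hc
    have h1 : (2 * k * N + c) / 2 = k * N + c / 2 := by
      rw [Nat.mul_assoc]; omega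
    have h2 : (2 * k * N + c) % 2 = c % 2 := by
      rw [Nat.mul_assoc]; omega
    have h3 : c / 2 < k := by omega
    have h4 : (k * N + c / 2) / k = N := by
      rw [Nat.mul_add_div hk, Nat.div_eq_of_lt h3, add_zero]
    have h5 : (k * N + c / 2) % k = c / 2 := by
      rw [Nat.mul_add_mod, Nat.mod_eq_of_lt h3]
    have e : ∀ h, (⟨N, h⟩ : Fin (N + 1)) = Fin.last N := fun _ => rfl
    simp only [Function.comp, tableVal, h1, h2, h4, h5, Nat.lt_succ_self, true_and, rowItem, e,
      Fin.snoc_last]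
    split_ifs with h
    · simp only [Option.elim]
      omega
    · rfl

variable [NeZero n]

/-- The registers which are not used when the tables are made. -/
def Unused (v : ℕ) : Prop := v % 2 = 1 ∨ v < 18 ∧ v ≠ rG ∧ v ≠ rX

-- Truncated subtraction ends the loop: after all rows the counter is `off + 1 - 2 k`, which is zero
-- as `off < 2 k`. In this way the number of rows and the offset are found without a division.
omit [NeZero n] in
theorem reach_tabLoop {ω : ℕ → Bool} {C : ℕ → Clause k n} (y : ℕ → Clause k n) {off : ℕ}
    (hoff : off < 2 * k) (ks : List Prog) (N : ℕ) : ∀ (st : MState) (P : Pos), At k st P →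
    st.top rG = off + 2 * (k * N) + 1 - 2 * k →
    ∃ st', Reach (streamEnv ω C) (tabLoop k :: ks, st) (N * (3 * k + 2 * k * (8 * k + 2) + 6) + 1)
        (ks, st') ∧ At k st' ((tabTree k N).run ω C y P).2 ∧
      (∀ (i : Fin k) w, st'.reg (tab i w) = (List.range (2 * k * N)).map
        (tableVal off ((tabTree k N).run ω C y P).1 i w) ++ st.reg (tab i w)) ∧
      ∀ v, Unused v → st'.reg v = st.reg v := by
  induction N with
  | zero =>
    intro st P hP hG
    exact ⟨st, (Reach.of_step (by simp [tabLoop, step, hG]; omega)).mono (by omega), hP, by simp,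
      fun _ _ => rfl⟩
  | succ N ih =>
    intro st P hP hG
    have hG' : st.top rG = off + 2 * (k * N) + 1 := by rw [hG, Nat.mul_add]; omega
    obtain ⟨st₁, hr₁, hP₁, ht₁, hG₁, hf₁⟩ := reach_branch (k := k) (n := n) (ω := ω) (C := C) (y := y)
      (Pre := fun _ => True)
      (Post := fun st st' row => (∀ (i : Fin k) w, st'.reg (tab i w) =
        rowList (st.top rG) row i w ++ st.reg (tab i w)) ∧ st'.top rG = st.top rG - 2 * k ∧
        ∀ v, Unused v → st'.reg v = st.reg v)
      (fun _ _ _ _ => trivial)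
      (fun st st₁ st' row heq h => by
        obtain ⟨h1, h2, h3⟩ := h
        have e : st₁.top rG = st.top rG := MState.top_eq_of_reg_eq (heq 4 (by decide))
        refine ⟨fun i w => ?_, by rw [h2, e], fun v hv => ?_⟩
        · have := tab_mod i w
          rw [h1, e, heq _ (by omega)]
        · rw [h3 v hv, heq v (by unfold Unused at hv; omega)])
      (2 * k * (8 * k + 2) + 5) (tabLoop k :: ks) k _ Tree.ret
      (fun row st P _ hP => by
        obtain ⟨st', hr, hp, ht, hf⟩ := reach_pushRows (env := streamEnv ω C) row
          (.seq (.push rX (2 * k)) (.sub rX rG) :: tabLoop k :: ks)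
          (Finset.univ : Finset (Fin k × Bool)).toList (Finset.nodup_toList _) st
        have hlen : (Finset.univ : Finset (Fin k × Bool)).toList.length = 2 * k := by
          rw [Finset.length_toList, Finset.card_univ, Fintype.card_prod, Fintype.card_fin,
            Fintype.card_bool, Nat.mul_comm]
        rw [hlen] at hr
        have hG : st'.top rG = st.top rG := MState.top_eq_of_reg_eq (hf 4 (Or.inl (by decide)))
        refine ⟨(st'.set rX (2 * k :: st'.reg rX)).set rG
            ((st.top rG - 2 * k) :: (st'.reg rG).tail),
          ((Reach.seq hr).trans (t' := 3) ⟨3, le_rfl, ?_⟩).mono (by omega), ?_, fun i w => ?_, ?_,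
          fun v hv => ?_⟩
        · simp [step, MState.set_top, MState.set_reg, hG]
        · exact ⟨by simp [hp, hP.coin, Tree.run], by simp [hp, hP.sample, Tree.run]⟩
        · have := tab_mod i w
          rw [MState.set_reg, if_neg (by omega), MState.set_reg, if_neg (by omega), ht,
            if_pos (Finset.mem_toList.2 (Finset.mem_univ _))]
          rfl
        · simp [MState.set_top]
        · unfold Unused at hv
          rw [MState.set_reg, if_neg (by omega), MState.set_reg, if_neg (by omega), hf v (by omega)])
      st P trivial hP
    obtain ⟨st₂, hr₂, hP₂, ht₂, hf₂⟩ := ih st₁ _ hP₁ (by rw [hG₁, hG'])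
    refine ⟨st₂, ((Reach.head ?_ hr₁).trans hr₂).mono ?_, ?_, fun i w => ?_, fun v hv => ?_⟩
    · simp [tabLoop, step, hG']
    · rw [Nat.add_mul N 1]
      omega
    · simp only [tabTree, Tree.run_bind]
      exact hP₂
    · simp only [tabTree, Tree.run_bind, Tree.run]
      rw [tableVal_snoc, ht₂, ht₁, hG', List.append_assoc]
    · rw [hf₂ v hv, hf₁ v hv]

/-- Set up the constants and make the tables. -/
noncomputable def setup (k : ℕ) : Prog :=
  .seq (.push rOne 1) (.seq (.copy rIn rG) (.seq (.push rX (2 * k)) (.seq (.add rOne rG)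
    (.seq (.sub rX rG) (tabLoop k)))))

theorem getD_tableVal (off : ℕ) (τ : Fin N → Fin k → Bool) (i : Fin k) (w : Bool) (c : ℕ) :
    ((List.range (2 * k * N)).map (tableVal off τ i w)).getD c 0 = tableVal off τ i w c := by
  by_cases hc : c < 2 * k * N
  · simp [List.getD_eq_getElem?_getD, hc]
  · rw [List.getD_eq_default _ _ (by simpa using hc), tableVal, dif_neg]
    rw [Nat.div_div_eq_div_mul, Nat.div_lt_iff_lt_mul (by have := i.pos; omega), Nat.mul_comm]
    exact fun h => hc h.1

omit [NeZero n] in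
theorem reach_setup {ω : ℕ → Bool} {C : ℕ → Clause k n} (y : ℕ → Clause k n) {off : ℕ}
    (hoff : off < 2 * k) (hn : n = off + 2 * (k * N)) (ks : List Prog) (st : MState) (P : Pos)
    (hP : At k st P) (hst : st.reg = (MState.init n).reg) :
    ∃ st', Reach (streamEnv ω C) (setup k :: ks, st)
        (N * (3 * k + 2 * k * (8 * k + 2) + 6) + 11) (ks, st') ∧
      At k st' ((tabTree k N).run ω C y P).2 ∧
      Ready off ((tabTree k N).run ω C y P).1 st' ∧
      ∀ v, Stable v → st'.reg v = (MState.init n).reg v := by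
  -- With `n = off + 2 k N` this is one more than the first letter of the last row.
  let st₁ := ((st.set rOne [1]).set rX [2 * k]).set rG [n + 1 - 2 * k]
  have hreg : ∀ v, st.reg v = if v = 0 then [n] else [] := fun v => by rw [hst]; rfl
  have h1 : Reach (streamEnv ω C) (setup k :: ks, st) 10 (tabLoop k :: ks, st₁) := by
    refine ⟨10, le_rfl, ?_⟩
    simp [setup, step, hreg, MState.set, st₁, MState.top]
    funext v
    simp only [Function.update_apply]
    split_ifs <;> rfl
  obtain ⟨st', h2, h3, h4, h5⟩ := reach_tabLoop (ω := ω) (C := C) y hoff ks N st₁ P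
    ⟨hP.coin, hP.sample⟩ (by simp [st₁, MState.set_top, hn])
  have hreg₁ : ∀ v, v ≠ 2 → v ≠ 10 → v ≠ 4 → st₁.reg v = (MState.init n).reg v := fun v _ _ _ => by
    simp only [st₁, MState.set_reg, *]
    rfl
  refine ⟨st', (h1.trans h2).mono (by omega), h3, ⟨?_, ?_, fun i w c => ?_⟩, fun v hv => ?_⟩
  · rw [MState.top_eq_of_reg_eq (h5 2 (by unfold Unused; omega))]
    simp [st₁, MState.set_top]
  · rw [MState.top_eq_of_reg_eq (h5 8 (by unfold Unused; omega)), MState.top,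
      hreg₁ 8 (by decide) (by decide) (by decide)]
    rfl
  · have := tab_mod i w
    rw [h4, hreg₁ _ (by omega) (by omega) (by omega)]
    have e : (MState.init n).reg (tab i w) = [] := if_neg (by omega)
    rw [e, List.append_nil, getD_tableVal]
  · unfold Stable at hv
    rw [h5 v (by unfold Unused; omega), hreg₁ v (by omega) (by omega) (by omega)]

end Table

end SeqPred

namespace SeqPred

/-! ### Runs of a program on generated blocks -/

/-- The stream from which the next instruction reads. -/
def request : List Prog × MState → Option Source
  | (.read s _ :: _, _) => some s
  | _ => none

/-- One step, if `x` is the entry which is read. -/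
def feed (x : ℕ) (c : List Prog × MState) : List Prog × MState := step (fun _ _ => x) c

theorem step_of_request {env : Source → ℕ → ℕ} {c : List Prog × MState} {s : Source}
    (h : request c = some s) : step env c = feed (env s (c.2.pos s)) c := by
  obtain ⟨ks, st⟩ := c
  rcases ks with _ | ⟨q, ks⟩
  · simp [request] at h
  · cases q <;> simp [request] at h
    subst h
    rfl

theorem step_of_request_none {env : Source → ℕ → ℕ} {c : List Prog × MState}
    (h : request c = none) : step env c = feed 0 c := by
  obtain ⟨ks, st⟩ := c
  rcases ks with _ | ⟨q, ks⟩
  · rfl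
  · cases q <;> first | rfl | simp [request] at h

theorem feed_pos {x : ℕ} {c : List Prog × MState} {s : Source} (h : request c = some s) :
    (feed x c).2.pos = Function.update c.2.pos s (c.2.pos s + 1) := by
  obtain ⟨ks, st⟩ := c
  rcases ks with _ | ⟨q, ks⟩
  · simp [request] at h
  · cases q <;> simp [request] at h
    subst h
    rfl

theorem feed_pos_none {x : ℕ} {c : List Prog × MState} (h : request c = none) :
    (feed x c).2.pos = c.2.pos := by
  obtain ⟨ks, st⟩ := c
  rcases ks with _ | ⟨q, ks⟩
  · rfl
  · cases q <;> first | rfl | simp [request] at h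

section Blocks

variable {K n : ℕ}

/-- The letters of a block. -/
def fwd (b : Fin K → Fin n) : List ℕ := List.ofFn fun i => (b i : ℕ)

/-- The letters of a block, latest one first. -/
def bwd (b : Fin K → Fin n) : List ℕ := (fwd b).reverse

theorem length_fwd (b : Fin K → Fin n) : (fwd b).length = K := by simp [fwd]

theorem length_bwd (b : Fin K → Fin n) : (bwd b).length = K := by simp [bwd, fwd]

/-- The run of a program, if its samples and past outputs come in blocks which are drawn when they
are needed; `bs` and `bp` are what remains of the latest blocks. -/
def ptree : ℕ → List Prog × MState → List ℕ → List ℕ → Tree (Fin K → Fin n) (List Prog × MState)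
  | 0, c, _, _ => .ret c
  | t + 1, c, bs, bp =>
    match request c with
    | none => ptree t (feed 0 c) bs bp
    | some .coin => .coin fun b => ptree t (feed b.toNat c) bs bp
    | some .sample => match bs with
      | [] => .drawS fun b => ptree t (feed ((fwd b).headD 0) c) (fwd b).tail bp
      | x :: bs => ptree t (feed x c) bs bp
    | some .past => match bp with
      | [] => .drawP fun b => ptree t (feed ((bwd b).headD 0) c) bs (bwd b).tail
      | x :: bp => ptree t (feed x c) bs bp

/-- The entries of `l`, followed by the letters of the blocks `x s, x (s + 1), …`. -/
def buf (letters : (Fin K → Fin n) → List ℕ) (x : ℕ → Fin K → Fin n) (l : List ℕ) (s i : ℕ) : ℕ :=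
  if i < l.length then l.getD i 0
  else (letters (x (s + (i - l.length) / K))).getD ((i - l.length) % K) 0

theorem buf_cons_zero (letters : (Fin K → Fin n) → List ℕ) (x : ℕ → Fin K → Fin n) (a : ℕ)
    (l : List ℕ) (s : ℕ) : buf letters x (a :: l) s 0 = a := by
  simp [buf]

theorem buf_cons_succ (letters : (Fin K → Fin n) → List ℕ) (x : ℕ → Fin K → Fin n) (a : ℕ)
    (l : List ℕ) (s i : ℕ) : buf letters x (a :: l) s (i + 1) = buf letters x l s i := by
  simp [buf]

/-- An empty buffer may be refilled with the next block without changing the stream. -/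
theorem buf_nil (hK : 0 < K) {letters : (Fin K → Fin n) → List ℕ}
    (hl : ∀ b, (letters b).length = K) (x : ℕ → Fin K → Fin n) (s i : ℕ) :
    buf letters x [] s i = buf letters x (letters (x s)) (s + 1) i := by
  unfold buf
  simp only [List.length_nil, Nat.not_lt_zero, if_false, Nat.sub_zero, hl]
  split_ifs with h
  · rw [Nat.div_eq_of_lt h, Nat.mod_eq_of_lt h, add_zero]
  · obtain ⟨j, rfl⟩ := Nat.exists_eq_add_of_le (not_lt.1 h)
    rw [Nat.add_div_left _ hK, Nat.add_mod_left, Nat.add_sub_cancel_left]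
    congr 3
    omega

theorem buf_nil_headD (hK : 0 < K) {letters : (Fin K → Fin n) → List ℕ}
    (hl : ∀ b, (letters b).length = K) (x : ℕ → Fin K → Fin n) (s : ℕ) :
    buf letters x [] s 0 = (letters (x s)).headD 0 ∧
      ∀ i, buf letters x [] s (i + 1) = buf letters x (letters (x s)).tail (s + 1) i := by
  have h := buf_nil hK hl x s
  rcases e : letters (x s) with _ | ⟨a, l⟩
  · have := hl (x s)
    rw [e] at this
    simp at this
    omega
  · rw [e] at h
    exact ⟨by rw [h, buf_cons_zero]; rfl, fun i => by rw [h, buf_cons_succ]; rfl⟩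

/-- Lazy drawing of blocks reproduces the run on the concatenated letters. A block is drawn only
when a letter is requested, so the number of blocks drawn is at most the number of letters read;
this is how the sample bound of the predictor limits the clauses used. -/
theorem run_ptree (hK : 0 < K) {ω : ℕ → Bool} {x y : ℕ → Fin K → Fin n} {env : Source → ℕ → ℕ}
    (t : ℕ) : ∀ (c : List Prog × MState) (bs bp : List ℕ) (P : Pos),
    (∀ i, env .coin (c.2.pos .coin + i) = (ω (P.c + i)).toNat) →
    (∀ i, env .sample (c.2.pos .sample + i) = buf fwd x bs P.s i) →
    (∀ i, env .past (c.2.pos .past + i) = buf bwd y bp P.p i) →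
    ((ptree t c bs bp).run ω x y P).1 = (step env)^[t] c ∧
    ((ptree t c bs bp).run ω x y P).2.c ≤ P.c + t ∧
    ((ptree t c bs bp).run ω x y P).2.s + c.2.pos .sample ≤
      P.s + ((step env)^[t] c).2.pos .sample ∧
    ((ptree t c bs bp).run ω x y P).2.p + c.2.pos .past ≤
      P.p + ((step env)^[t] c).2.pos .past := by
  induction t with
  | zero =>
    intro c bs bp P _ _ _
    exact ⟨rfl, by simp [ptree, Tree.run], by simp [ptree, Tree.run], by simp [ptree, Tree.run]⟩
  | succ t ih =>
    intro c bs bp P hc hs hp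
    rw [Function.iterate_succ_apply]
    rcases h : request c with _ | src
    · rw [step_of_request_none h]
      have hpos := feed_pos_none (x := 0) h
      obtain ⟨h1, h2, h3, h4⟩ := ih (feed 0 c) bs bp P (by rwa [hpos]) (by rwa [hpos]) (by rwa [hpos])
      rw [hpos] at h3 h4
      simp only [ptree, h]
      exact ⟨h1, by omega, by omega, by omega⟩
    · rw [step_of_request h]
      have hpos := feed_pos (x := env src (c.2.pos src)) h
      rcases src with _ | _ | _
      · have e : env .coin (c.2.pos .coin) = (ω P.c).toNat := by simpa using hc 0
        rw [e] at hpos ⊢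
        obtain ⟨h1, h2, h3, h4⟩ := ih (feed (ω P.c).toNat c) bs bp ⟨P.c + 1, P.s, P.p⟩
          (fun i => by
            rw [hpos]
            simpa [Nat.add_assoc, Nat.add_comm 1] using hc (i + 1))
          (by simpa [hpos] using hs) (by simpa [hpos] using hp)
        rw [hpos] at h3 h4
        simp only [ptree, h, Tree.run]
        simp only [Function.update_of_ne, ne_eq, reduceCtorEq, not_false_eq_true] at h2 h3 h4
        exact ⟨h1, by omega, by omega, by omega⟩
      · rcases bs with _ | ⟨a, bs⟩
        · obtain ⟨b1, b2⟩ := buf_nil_headD hK length_fwd x P.s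
          have e : env .sample (c.2.pos .sample) = (fwd (x P.s)).headD 0 := by
            rw [← b1]; simpa using hs 0
          rw [e] at hpos ⊢
          obtain ⟨h1, h2, h3, h4⟩ := ih (feed ((fwd (x P.s)).headD 0) c) (fwd (x P.s)).tail bp
            ⟨P.c, P.s + 1, P.p⟩ (by rw [hpos]; simpa using hc)
            (fun i => by
              rw [hpos, ← b2, ← hs (i + 1)]
              simp [Nat.add_assoc, Nat.add_comm 1])
            (by rw [hpos]; simpa using hp)
          rw [hpos] at h3 h4
          simp only [ptree, h, Tree.run]
          simp only [Function.update_of_ne, Function.update_self, ne_eq, reduceCtorEq,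
            not_false_eq_true] at h2 h3 h4
          exact ⟨h1, by omega, by omega, by omega⟩
        · have e : env .sample (c.2.pos .sample) = a := by
            rw [← buf_cons_zero fwd x a bs P.s]; simpa using hs 0
          rw [e] at hpos ⊢
          obtain ⟨h1, h2, h3, h4⟩ := ih (feed a c) bs bp P (by simpa [hpos] using hc)
            (fun i => by
              rw [hpos, ← buf_cons_succ fwd x a, ← hs (i + 1)]
              simp [Nat.add_assoc, Nat.add_comm 1])
            (by simpa [hpos] using hp)
          rw [hpos] at h3 h4
          simp only [ptree, h]
          simp only [Function.update_of_ne, Function.update_self, ne_eq, reduceCtorEq,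
            not_false_eq_true] at h2 h3 h4
          exact ⟨h1, by omega, by omega, by omega⟩
      · rcases bp with _ | ⟨a, bp⟩
        · obtain ⟨b1, b2⟩ := buf_nil_headD hK length_bwd y P.p
          have e : env .past (c.2.pos .past) = (bwd (y P.p)).headD 0 := by
            rw [← b1]; simpa using hp 0
          rw [e] at hpos ⊢
          obtain ⟨h1, h2, h3, h4⟩ := ih (feed ((bwd (y P.p)).headD 0) c) bs (bwd (y P.p)).tail
            ⟨P.c, P.s, P.p + 1⟩ (by rw [hpos]; simpa using hc) (by rw [hpos]; simpa using hs)
            (fun i => by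
              rw [hpos, ← b2, ← hp (i + 1)]
              simp [Nat.add_assoc, Nat.add_comm 1])
          rw [hpos] at h3 h4
          simp only [ptree, h, Tree.run]
          simp only [Function.update_of_ne, Function.update_self, ne_eq, reduceCtorEq,
            not_false_eq_true] at h2 h3 h4
          exact ⟨h1, by omega, by omega, by omega⟩
        · have e : env .past (c.2.pos .past) = a := by
            rw [← buf_cons_zero bwd y a bp P.p]; simpa using hp 0
          rw [e] at hpos ⊢
          obtain ⟨h1, h2, h3, h4⟩ := ih (feed a c) bs bp P (by simpa [hpos] using hc)
            (by simpa [hpos] using hs)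
            (fun i => by
              rw [hpos, ← buf_cons_succ bwd y a, ← hp (i + 1)]
              simp [Nat.add_assoc, Nat.add_comm 1])
          rw [hpos] at h3 h4
          simp only [ptree, h]
          simp only [Function.update_of_ne, Function.update_self, ne_eq, reduceCtorEq,
            not_false_eq_true] at h2 h3 h4
          exact ⟨h1, by omega, by omega, by omega⟩

end Blocks

/-! ### Compilation -/

/-- Read the next letter from a buffer, which is filled by `g` if it is empty. -/
def readBuf (g : Prog) (r v : ℕ) : Prog :=
  .seq (.ite r .skip g) (.seq (.copy r (2 * v + 1)) (.seq (.pop r) (.sub rOne (2 * v + 1))))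

/-- Replace the samples and the past by letters which are generated by `gS` and `gP`. -/
def compile (gS gP : Prog) : Prog → Prog
  | .skip => .skip
  | .push v c => .push (2 * v + 1) c
  | .pop v => .pop (2 * v + 1)
  | .copy v w => .copy (2 * v + 1) (2 * w + 1)
  | .add v w => .add (2 * v + 1) (2 * w + 1)
  | .sub v w => .sub (2 * v + 1) (2 * w + 1)
  | .read .coin v => .read .coin (2 * v + 1)
  | .read .sample v => readBuf gS rS v
  | .read .past v => readBuf gP rP v
  | .seq p q => .seq (compile gS gP p) (compile gS gP q)
  | .ite v p q => .ite (2 * v + 1) (compile gS gP p) (compile gS gP q)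
  | .loop v p => .loop (2 * v + 1) (compile gS gP p)

section Compile

variable {k M N n : ℕ} {off : ℕ} {τ : Fin N → Fin k → Bool}

/-- `st` represents the state `pst` of the program that is simulated. -/
structure Sim (off : ℕ) (τ : Fin N → Fin k → Bool) (bs bp : List ℕ) (pst st : MState) : Prop where
  ready : Ready off τ st
  reg : ∀ v, st.reg (2 * v + 1) = pst.reg v
  bufS : st.reg rS = bs.map (· + 1)
  bufP : st.reg rP = bp.map (· + 1)

theorem Ready.of_reg {st st' : MState} (h : Ready off τ st)
    (h' : ∀ v, v % 2 = 0 → v ≠ rS → v ≠ rP → v ≠ rY → st'.reg v = st.reg v) : Ready off τ st' := by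
  refine ⟨?_, ?_, fun i w c => ?_⟩
  · rw [MState.top_eq_of_reg_eq (h' 2 (by decide) (by decide) (by decide) (by decide)), h.one]
  · rw [MState.top_eq_of_reg_eq (h' 8 (by decide) (by decide) (by decide) (by decide)), h.e]
  · have := tab_mod i w
    rw [h' _ (by omega) (by omega) (by omega) (by omega), h.tab]

theorem Sim.set {bs bp : List ℕ} {pst st : MState} (h : Sim off τ bs bp pst st) (v : ℕ)
    (l : List ℕ) : Sim off τ bs bp (pst.set v l) (st.set (2 * v + 1) l) := by
  refine ⟨h.ready.of_reg fun w hw _ _ _ => ?_, fun w => ?_, ?_, ?_⟩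
  · rw [MState.set_reg, if_neg (by omega)]
  · rw [MState.set_reg, MState.set_reg, h.reg]
    by_cases e : w = v <;> simp [e]
  · rw [MState.set_reg, if_neg (by omega), h.bufS]
  · rw [MState.set_reg, if_neg (by omega), h.bufP]

theorem Sim.set_frame (st : MState) (v : ℕ) (l : List ℕ) :
    (st.set (2 * v + 1) l).reg rIn = st.reg rIn ∧ (st.set (2 * v + 1) l).reg rY = st.reg rY := by
  constructor <;> rw [MState.set_reg, if_neg (by omega)]

theorem Sim.step_none {bs bp : List ℕ} {pst st : MState} {env : Source → ℕ → ℕ} {gS gP : Prog}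
    (h : Sim off τ bs bp pst st) (ks rest : List Prog) (hr : request (ks, pst) = none) :
    ∃ st', Reach env (ks.map (compile gS gP) ++ rest, st) 1
        ((feed 0 (ks, pst)).1.map (compile gS gP) ++ rest, st') ∧
      Sim off τ bs bp (feed 0 (ks, pst)).2 st' ∧ st'.pos = st.pos ∧
      (st'.reg rIn = st.reg rIn ∧ st'.reg rY = st.reg rY) := by
  rcases ks with _ | ⟨q, ks⟩
  · exact ⟨st, (Reach.refl _ _).mono zero_le_one, h, rfl, rfl, rfl⟩
  · have top : ∀ v, st.top (2 * v + 1) = pst.top v := fun v => by simp [MState.top, h.reg]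
    cases q with
    | skip => exact ⟨st, .of_step rfl, h, rfl, rfl, rfl⟩
    | push v c =>
      exact ⟨_, .of_step rfl, by simpa [feed, step, h.reg] using h.set v (c :: pst.reg v), rfl,
        Sim.set_frame _ _ _⟩
    | pop v =>
      exact ⟨_, .of_step rfl, by simpa [feed, step, h.reg] using h.set v (pst.reg v).tail, rfl,
        Sim.set_frame _ _ _⟩
    | copy v w =>
      exact ⟨_, .of_step rfl, by
        simpa [feed, step, h.reg, top] using h.set w (pst.top v :: pst.reg w), rfl,
        Sim.set_frame _ _ _⟩
    | add v w =>
      exact ⟨_, .of_step rfl, by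
        simpa [feed, step, h.reg, top] using h.set w ((pst.top w + pst.top v) :: (pst.reg w).tail),
        rfl, Sim.set_frame _ _ _⟩
    | sub v w =>
      exact ⟨_, .of_step rfl, by
        simpa [feed, step, h.reg, top] using h.set w ((pst.top w - pst.top v) :: (pst.reg w).tail),
        rfl, Sim.set_frame _ _ _⟩
    | read s v => simp [request] at hr
    | seq p q => exact ⟨st, .of_step rfl, h, rfl, rfl, rfl⟩
    | ite v p q =>
      refine ⟨st, .of_step ?_, h, rfl, rfl, rfl⟩
      by_cases e : pst.top v = 0 <;> simp [feed, step, compile, top, e]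
    | loop v p =>
      refine ⟨st, .of_step ?_, h, rfl, rfl, rfl⟩
      by_cases e : pst.top v = 0 <;> simp [feed, step, compile, top, e]

theorem reach_take {env : Source → ℕ → ℕ} {st : MState} {r v x : ℕ} {l : List ℕ}
    (hr : r = rS ∨ r = rP) (h1 : st.top rOne = 1) (h : st.reg r = (x + 1) :: l) (ks : List Prog) :
    Reach env (.seq (.copy r (2 * v + 1)) (.seq (.pop r) (.sub rOne (2 * v + 1))) :: ks, st) 5
      (ks, (st.set r l).set (2 * v + 1) (x :: st.reg (2 * v + 1))) := by
  have h1' : (st.reg 2).headD 0 = 1 := h1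
  refine ⟨5, le_rfl, ?_⟩
  rcases hr with rfl | rfl
  · have e1 : (12 : ℕ) ≠ 2 * v + 1 := by omega
    have e2 : (2 : ℕ) ≠ 2 * v + 1 := by omega
    simp only [Function.iterate_succ_apply, Function.iterate_zero, id, step, MState.set, MState.top, h]
    congr 1
    congr 1
    funext w
    simp only [Function.update_apply]
    split_ifs <;> simp_all
  · have e1 : (14 : ℕ) ≠ 2 * v + 1 := by omega
    have e2 : (2 : ℕ) ≠ 2 * v + 1 := by omega
    simp only [Function.iterate_succ_apply, Function.iterate_zero, id, step, MState.set, MState.top, h]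
    congr 1
    congr 1
    funext w
    simp only [Function.update_apply]
    split_ifs <;> simp_all

theorem map_blockVal {K : ℕ} (b : Fin K → Fin n) :
    (List.range K).map (blockVal b) = (fwd b).map (· + 1) := by
  refine List.ext_getElem (by simp [fwd]) fun i h1 h2 => ?_
  have hi : i < K := by simpa using h1
  simp [fwd, blockVal, hi]

theorem Sim.of_reg_eq {bs bp : List ℕ} {pst pst' st : MState} (h : Sim off τ bs bp pst st)
    (e : pst'.reg = pst.reg) : Sim off τ bs bp pst' st :=
  ⟨h.ready, fun v => by rw [h.reg, e], h.bufS, h.bufP⟩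

theorem Sim.takeS {bs bp : List ℕ} {pst st : MState} {env : Source → ℕ → ℕ} {x : ℕ}
    (h : Sim off τ (x :: bs) bp pst st) (v : ℕ) (ks : List Prog) :
    ∃ st', Reach env
        (.seq (.copy rS (2 * v + 1)) (.seq (.pop rS) (.sub rOne (2 * v + 1))) :: ks, st) 5 (ks, st') ∧
      Sim off τ bs bp (pst.set v (x :: pst.reg v)) st' ∧ st'.pos = st.pos ∧
      (st'.reg rIn = st.reg rIn ∧ st'.reg rY = st.reg rY) := by
  have h1 : Sim off τ bs bp pst (st.set rS (bs.map (· + 1))) := by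
    refine ⟨h.ready.of_reg fun w _ h1 _ _ => ?_, fun w => ?_, ?_, ?_⟩
    · rw [MState.set_reg, if_neg h1]
    · rw [MState.set_reg, if_neg (by omega), h.reg]
    · rw [MState.set_reg, if_pos rfl]
    · rw [MState.set_reg, if_neg (by decide), h.bufP]
  have h2 := h1.set v (x :: pst.reg v)
  refine ⟨_, reach_take (Or.inl rfl) h.ready.one (by rw [h.bufS]; rfl) ks, ?_, rfl, ?_⟩
  · rwa [h.reg]
  · constructor <;> rw [MState.set_reg, if_neg (by omega), MState.set_reg, if_neg (by decide)]

theorem Sim.takeP {bs bp : List ℕ} {pst st : MState} {env : Source → ℕ → ℕ} {x : ℕ}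
    (h : Sim off τ bs (x :: bp) pst st) (v : ℕ) (ks : List Prog) :
    ∃ st', Reach env
        (.seq (.copy rP (2 * v + 1)) (.seq (.pop rP) (.sub rOne (2 * v + 1))) :: ks, st) 5 (ks, st') ∧
      Sim off τ bs bp (pst.set v (x :: pst.reg v)) st' ∧ st'.pos = st.pos ∧
      (st'.reg rIn = st.reg rIn ∧ st'.reg rY = st.reg rY) := by
  have h1 : Sim off τ bs bp pst (st.set rP (bp.map (· + 1))) := by
    refine ⟨h.ready.of_reg fun w _ _ h1 _ => ?_, fun w => ?_, ?_, ?_⟩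
    · rw [MState.set_reg, if_neg h1]
    · rw [MState.set_reg, if_neg (by omega), h.reg]
    · rw [MState.set_reg, if_neg (by decide), h.bufS]
    · rw [MState.set_reg, if_pos rfl]
  have h2 := h1.set v (x :: pst.reg v)
  refine ⟨_, reach_take (Or.inr rfl) h.ready.one (by rw [h.bufP]; rfl) ks, ?_, rfl, ?_⟩
  · rwa [h.reg]
  · constructor <;> rw [MState.set_reg, if_neg (by omega), MState.set_reg, if_neg (by decide)]

/-- Pushing the letters in reverse order leaves the first one on top, as samples are read forwards.
-/
theorem Written.simS {b : Fin (k + M) → Fin n} {bp : List ℕ} {pst st st' : MState}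
    (h : Written rS (List.range (k + M)).reverse [] b st st') (hst : Sim off τ [] bp pst st)
    (hr : Ready off τ st') : Sim off τ (fwd b) bp pst st' ∧ st'.reg rIn = st.reg rIn ∧
      st'.reg rY = st.reg rY := by
  refine ⟨⟨hr, fun v => ?_, ?_, ?_⟩, ?_, ?_⟩
  · rw [h.frame _ (by unfold Stable; omega) (by omega) (by omega), hst.reg]
  · rw [h.main, hst.bufS, List.map_reverse, List.reverse_reverse, map_blockVal]
    simp
  · rw [h.frame _ (by unfold Stable; omega) (by decide) (by decide), hst.bufP]
  · rw [h.frame _ (by unfold Stable; omega) (by decide) (by decide)]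
  · simpa using h.test

/-- Here the letters are pushed in their natural order, so that the latest one is on top. -/
theorem Written.simP {b : Fin (k + M) → Fin n} {bs : List ℕ} {pst st st' : MState}
    (h : Written rP (List.range (k + M)) [] b st st') (hst : Sim off τ bs [] pst st)
    (hr : Ready off τ st') : Sim off τ bs (bwd b) pst st' ∧ st'.reg rIn = st.reg rIn ∧
      st'.reg rY = st.reg rY := by
  refine ⟨⟨hr, fun v => ?_, ?_, ?_⟩, ?_, ?_⟩
  · rw [h.frame _ (by unfold Stable; omega) (by omega) (by omega), hst.reg]
  · rw [h.frame _ (by unfold Stable; omega) (by decide) (by decide), hst.bufS]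
  · rw [h.main, hst.bufP, map_blockVal]
    simp [bwd]
  · rw [h.frame _ (by unfold Stable; omega) (by decide) (by decide)]
  · simpa using h.test

/-- A bound for the time to make a block. -/
def genCost (k M n B : ℕ) : ℕ := 3 * k + (B * (k * (28 * n + 11) + 2) + (2 * (k + M) + 3))

/-- The compiled program, which generates its own data from clauses. -/
def onClauses (col : Fin k → Syn M) (B : ℕ) : Prog → Prog :=
  compile (genProg col B rS (List.range (k + M)).reverse []) (genProg col B rP (List.range (k + M)) [])

variable [NeZero n]

/-- The compiled program simulates the lazy run with every draw replaced by the generator. Letters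
are kept plus one in the buffers, so that a zero on top means that the buffer is empty. -/
theorem reach_ptree {ω : ℕ → Bool} {C : ℕ → Clause k n} (y : ℕ → Clause k n)
    (hK : 0 < k + M) (hoff : off + 2 * (k * N) ≤ n) (hn : 4 ≤ n) (col : Fin k → Syn M) (B : ℕ)
    (rest : List Prog) (t : ℕ) :
    ∀ (c : List Prog × MState) (bs bp : List ℕ) (st : MState) (P : Pos),
    Sim off τ bs bp c.2 st → At k st P →
    ∃ st' bs' bp', Reach (streamEnv ω C) (c.1.map (onClauses col B) ++ rest, st)
        (t * (genCost k M n B + 8))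
        ((((ptree t c bs bp).subst (genTree col off τ B)).run ω C y P).1.1.map (onClauses col B) ++
          rest, st') ∧
      At k st' (((ptree t c bs bp).subst (genTree col off τ B)).run ω C y P).2 ∧
      Sim off τ bs' bp' (((ptree t c bs bp).subst (genTree col off τ B)).run ω C y P).1.2 st' ∧
      (st'.reg rIn = st.reg rIn ∧ st'.reg rY = st.reg rY) := by
  induction t with
  | zero => exact fun c bs bp st P hst hP => ⟨st, bs, bp, (Reach.refl _ _).mono (by omega), hP, hst,
      rfl, rfl⟩
  | succ t ih =>
    intro c bs bp st P hst hP
    -- It is enough to simulate one step within the cost of making a block plus eight.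
    have key : ∀ {c₁ : List Prog × MState} {bs₁ bp₁ : List ℕ} {st₁ : MState} {P₁ : Pos},
        Reach (streamEnv ω C) (c.1.map (onClauses col B) ++ rest, st) (genCost k M n B + 8)
          (c₁.1.map (onClauses col B) ++ rest, st₁) → At k st₁ P₁ → Sim off τ bs₁ bp₁ c₁.2 st₁ →
        (st₁.reg rIn = st.reg rIn ∧ st₁.reg rY = st.reg rY) →
        ((ptree (t + 1) c bs bp).subst (genTree col off τ B)).run ω C y P =
          ((ptree t c₁ bs₁ bp₁).subst (genTree col off τ B)).run ω C y P₁ →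
        ∃ st' bs' bp', Reach (streamEnv ω C) (c.1.map (onClauses col B) ++ rest, st)
          ((t + 1) * (genCost k M n B + 8))
          ((((ptree (t + 1) c bs bp).subst (genTree col off τ B)).run ω C y P).1.1.map
            (onClauses col B) ++ rest, st') ∧
        At k st' (((ptree (t + 1) c bs bp).subst (genTree col off τ B)).run ω C y P).2 ∧
        Sim off τ bs' bp' (((ptree (t + 1) c bs bp).subst (genTree col off τ B)).run ω C y P).1.2
          st' ∧ (st'.reg rIn = st.reg rIn ∧ st'.reg rY = st.reg rY) := by
      intro c₁ bs₁ bp₁ st₁ P₁ hr hP₁ hst₁ hf₁ e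
      obtain ⟨st', bs', bp', h1, h2, h3, h4⟩ := ih c₁ bs₁ bp₁ st₁ P₁ hst₁ hP₁
      rw [e]
      exact ⟨st', bs', bp', (hr.trans h1).mono (by rw [Nat.succ_mul]; omega), h2, h3,
        h4.1.trans hf₁.1, h4.2.trans hf₁.2⟩
    rcases h : request c with _ | src
    · obtain ⟨st₁, hr, hs, hp, hf⟩ := hst.step_none (env := streamEnv ω C) c.1 rest h
      exact key (c₁ := feed 0 c) (hr.mono (by omega)) ⟨by rw [hp]; exact hP.coin, by rw [hp]; exact hP.sample⟩ hs hf
        (by simp only [ptree, h])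
    · obtain ⟨ks, pst⟩ := c
      rcases ks with _ | ⟨q, ks⟩
      · simp [request] at h
      cases q <;> simp only [request, reduceCtorEq, Option.some.injEq] at h
      rename_i src' v
      subst h
      have hfeed : ∀ x, (feed x (Prog.read src' v :: ks, pst)).2.reg =
        (pst.set v (x :: pst.reg v)).reg := fun x => rfl
      rcases src' with _ | _ | _
      · let st₁ : MState := { reg := Function.update st.reg (2 * v + 1)
                                ((ω P.c).toNat :: st.reg (2 * v + 1)),
                              pos := Function.update st.pos .coin (P.c + 1) }
        refine key (c₁ := feed (ω P.c).toNat (Prog.read .coin v :: ks, pst)) (st₁ := st₁)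
          (P₁ := ⟨P.c + 1, P.s, P.p⟩) (bs₁ := bs) (bp₁ := bp) ((Reach.of_step ?_).mono (by omega))
          ⟨by simp [st₁], by simp [st₁, hP.sample]⟩ ?_ ?_ rfl
        · simp [step, onClauses, compile, feed, hP.coin, streamEnv, st₁]
        · have := hst.set v ((ω P.c).toNat :: pst.reg v)
          refine Sim.of_reg_eq (pst := pst.set v ((ω P.c).toNat :: pst.reg v)) ?_ (hfeed _)
          rw [← hst.reg] at this ⊢
          exact ⟨⟨this.ready.one, this.ready.e, this.ready.tab⟩, this.reg, this.bufS, this.bufP⟩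
        · exact Sim.set_frame st v _
      · rcases bs with _ | ⟨x, bs⟩
        · obtain ⟨st₁, hr₁, hP₁, hR₁, hW₁⟩ := reach_gen (ω := ω) (C := C) y hoff hn col (r := rS)
            (Or.inl rfl) (L := (List.range (k + M)).reverse) (L' := []) (by simp)
            (.seq (.copy rS (2 * v + 1)) (.seq (.pop rS) (.sub rOne (2 * v + 1))) ::
              (ks.map (onClauses col B) ++ rest)) B st P hst.ready hP
          obtain ⟨hs₁, hf₁⟩ := hW₁.simS hst hR₁
          set b := ((genTree col off τ B).run ω C y P).1 with hb
          obtain ⟨x, l, hl⟩ : ∃ x l, fwd b = x :: l := by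
            rcases e : fwd b with _ | ⟨x, l⟩
            · have := length_fwd b
              rw [e] at this
              simp at this
              omega
            · exact ⟨x, l, rfl⟩
          rw [hl] at hs₁
          obtain ⟨st₂, hr₂, hs₂, hp₂, hf₂⟩ := hs₁.takeS (env := streamEnv ω C) v
            (ks.map (onClauses col B) ++ rest)
          refine key (c₁ := feed x (Prog.read .sample v :: ks, pst)) (st₁ := st₂) (bs₁ := l)
            (bp₁ := bp) (P₁ := ((genTree col off τ B).run ω C y P).2)
            (((Reach.head (c' := (_ :: _ :: _, st)) rfl (Reach.head ?_ hr₁)).trans hr₂).mono ?_)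
            ⟨by rw [hp₂]; exact hP₁.coin, by rw [hp₂]; exact hP₁.sample⟩ (hs₂.of_reg_eq (hfeed _))
            ⟨hf₂.1.trans hf₁.1, hf₂.2.trans hf₁.2⟩ ?_
          · simp [step, MState.top, hst.bufS]
          · simp [genCost]
          · simp only [ptree, request, Tree.subst, Tree.run_bind]
            rw [← hb, hl]
            rfl
        · obtain ⟨st₂, hr₂, hs₂, hp₂, hf₂⟩ := hst.takeS (env := streamEnv ω C) v
            (ks.map (onClauses col B) ++ rest)
          refine key (c₁ := feed x (Prog.read .sample v :: ks, pst)) (st₁ := st₂) (bs₁ := bs)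
            (bp₁ := bp) (P₁ := P)
            ((Reach.head (c' := (_ :: _ :: _, st)) rfl (Reach.head (c' := (.skip :: _ :: _, st)) ?_
              (Reach.head rfl hr₂))).mono (by omega))
            ⟨by rw [hp₂]; exact hP.coin, by rw [hp₂]; exact hP.sample⟩ (hs₂.of_reg_eq (hfeed _))
            hf₂ rfl
          simp [step, MState.top, hst.bufS]
      · rcases bp with _ | ⟨x, bp⟩
        · obtain ⟨st₁, hr₁, hP₁, hR₁, hW₁⟩ := reach_gen (ω := ω) (C := C) y hoff hn col (r := rP)
            (Or.inr rfl) (L := List.range (k + M)) (L' := []) (by simp)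
            (.seq (.copy rP (2 * v + 1)) (.seq (.pop rP) (.sub rOne (2 * v + 1))) ::
              (ks.map (onClauses col B) ++ rest)) B st P hst.ready hP
          obtain ⟨hs₁, hf₁⟩ := hW₁.simP hst hR₁
          set b := ((genTree col off τ B).run ω C y P).1 with hb
          obtain ⟨x, l, hl⟩ : ∃ x l, bwd b = x :: l := by
            rcases e : bwd b with _ | ⟨x, l⟩
            · have := length_bwd b
              rw [e] at this
              simp at this
              omega
            · exact ⟨x, l, rfl⟩
          rw [hl] at hs₁
          obtain ⟨st₂, hr₂, hs₂, hp₂, hf₂⟩ := hs₁.takeP (env := streamEnv ω C) v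
            (ks.map (onClauses col B) ++ rest)
          refine key (c₁ := feed x (Prog.read .past v :: ks, pst)) (st₁ := st₂) (bs₁ := bs)
            (bp₁ := l) (P₁ := ((genTree col off τ B).run ω C y P).2)
            (((Reach.head (c' := (_ :: _ :: _, st)) rfl (Reach.head ?_ hr₁)).trans hr₂).mono ?_)
            ⟨by rw [hp₂]; exact hP₁.coin, by rw [hp₂]; exact hP₁.sample⟩ (hs₂.of_reg_eq (hfeed _))
            ⟨hf₂.1.trans hf₁.1, hf₂.2.trans hf₁.2⟩ ?_
          · simp [step, MState.top, hst.bufP]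
          · simp [genCost]
          · simp only [ptree, request, Tree.subst, Tree.run_bind]
            rw [← hb, hl]
            rfl
        · obtain ⟨st₂, hr₂, hs₂, hp₂, hf₂⟩ := hst.takeP (env := streamEnv ω C) v
            (ks.map (onClauses col B) ++ rest)
          refine key (c₁ := feed x (Prog.read .past v :: ks, pst)) (st₁ := st₂) (bs₁ := bs)
            (bp₁ := bp) (P₁ := P)
            ((Reach.head (c' := (_ :: _ :: _, st)) rfl (Reach.head (c' := (.skip :: _ :: _, st)) ?_
              (Reach.head rfl hr₂))).mono (by omega))
            ⟨by rw [hp₂]; exact hP.coin, by rw [hp₂]; exact hP.sample⟩ (hs₂.of_reg_eq (hfeed _))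
            hf₂ rfl
          simp [step, MState.top, hst.bufP]

end Compile

end SeqPred

namespace SeqPred

/-! ### The test of a prediction -/

/-- `G` is the largest of the first `m` weights, plus one, and `X` is its first position, plus
one. -/
structure Best (w : ℕ → ℕ) (m G X : ℕ) : Prop where
  le : ∀ i < m, w i + 1 ≤ G
  zero : m = 0 → G = 0
  pos : 0 < m → ∃ a, X = a + 1 ∧ a < m ∧ w a + 1 = G ∧ ∀ i < a, w i + 1 < G

theorem Best.update {w : ℕ → ℕ} {m G X : ℕ} (h : Best w m G X) (hw : w m + 1 - G ≠ 0) :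
    Best w (m + 1) (w m + 1) (m + 1) := by
  refine ⟨fun i hi => ?_, by omega, fun _ => ⟨m, rfl, by omega, rfl, fun i hi => ?_⟩⟩
  · rcases Nat.lt_succ_iff_lt_or_eq.1 hi with hi | rfl
    · have := h.le i hi
      omega
    · exact le_rfl
  · have := h.le i hi
    omega

/-- Ties keep the earlier position, in accordance with the rule that the first letter of maximal
weight counts. Because weights are stored plus one, the initial value zero is beaten by any weight.
-/
theorem Best.keep {w : ℕ → ℕ} {m G X : ℕ} (h : Best w m G X) (hw : w m + 1 - G = 0) :
    Best w (m + 1) G X := by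
  refine ⟨fun i hi => ?_, by omega, fun _ => ?_⟩
  · rcases Nat.lt_succ_iff_lt_or_eq.1 hi with hi | rfl
    · exact h.le i hi
    · omega
  · rcases Nat.eq_zero_or_pos m with rfl | hm
    · have := h.zero rfl
      omega
    · obtain ⟨a, h1, h2, h3, h4⟩ := h.pos hm
      exact ⟨a, h1, by omega, h3, h4⟩

theorem Best.iff {w : ℕ → ℕ} {n G X : ℕ} (h : Best w n G X) (hn : 0 < n) (a : ℕ) :
    X = a + 1 ↔ IsArgmax n w a := by
  obtain ⟨a', h1, h2, h3, h4⟩ := h.pos hn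
  have ha' : IsArgmax n w a' := by
    refine ⟨h2, fun b hb => ?_⟩
    have := h.le b hb
    refine ⟨by omega, fun hba => ?_⟩
    have := h4 b hba
    omega
  constructor
  · intro h
    obtain rfl : a = a' := by omega
    exact ha'
  · intro h
    rw [h.unique ha', h1]

/-- Compare the number on top of `rC` with the best one so far. -/
def compareBody : Prog :=
  .seq (.copy rC rS) (.seq (.sub rG rS) (.seq (.ite rS (.seq (.copy rC rG) (.copy rE rX)) .skip)
    (.sub rOne rD)))

/-- Compare the next weight with the best one so far. -/
def scanBody : Prog :=
  .seq (.add rOne rE) (.seq (.copy 1 rC) (.seq (.add rOne rC) (.seq (.pop 1) compareBody)))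

theorem reach_scanBody {env : Source → ℕ → ℕ} (ks : List Prog) (st : MState)
    (h1 : st.top rOne = 1) : ∃ st', Reach env (scanBody :: ks, st) 8 (compareBody :: ks, st') ∧
      st'.pos = st.pos ∧ st'.top rE = st.top rE + 1 ∧ st'.top rC = st.top 1 + 1 ∧
      st'.reg 1 = (st.reg 1).tail ∧ ∀ v, v ≠ rE → v ≠ rC → v ≠ 1 → st'.reg v = st.reg v := by
  refine ⟨((st.set rE ((st.top rE + 1) :: (st.reg rE).tail)).set rC
    ((st.top 1 + 1) :: st.reg rC)).set 1 (st.reg 1).tail, ⟨8, le_rfl, ?_⟩, rfl, ?_, ?_, ?_, ?_⟩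
  · simp [scanBody, step, MState.set_top, MState.set_reg, h1, MState.set_set]
  · simp [MState.set_top]
  · simp [MState.set_top]
  · simp
  · intro v h1 h2 h3
    simp [MState.set_reg, h1, h2, h3]

theorem reach_compareBody {env : Source → ℕ → ℕ} (ks : List Prog) (st : MState)
    (h1 : st.top rOne = 1) : ∃ st', Reach env (compareBody :: ks, st) 10 (ks, st') ∧
      st'.pos = st.pos ∧ st'.top rD = st.top rD - 1 ∧
      (st.top rC - st.top rG ≠ 0 → st'.top rG = st.top rC ∧ st'.top rX = st.top rE) ∧
      (st.top rC - st.top rG = 0 → st'.top rG = st.top rG ∧ st'.top rX = st.top rX) ∧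
      ∀ v, v ≠ rS → v ≠ rG → v ≠ rX → v ≠ rD → st'.reg v = st.reg v := by
  let st₁ := st.set rS ((st.top rC - st.top rG) :: st.reg rS)
  have hr₁ : Reach env (compareBody :: ks, st) 5
      (.ite rS (.seq (.copy rC rG) (.copy rE rX)) .skip :: .sub rOne rD :: ks, st₁) := by
    refine ⟨5, le_rfl, ?_⟩
    simp [compareBody, step, MState.set_top, MState.set_set, st₁]
  have htop : ∀ v, v ≠ 12 → st₁.top v = st.top v := fun v hv => by
    simp [st₁, MState.set_top, hv]
  have hreg : ∀ v, v ≠ 12 → st₁.reg v = st.reg v := fun v hv => by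
    simp [st₁, MState.set_reg, hv]
  have hS : st₁.top 12 = st.top rC - st.top rG := by simp [st₁, MState.set_top]
  have hp : st₁.pos = st.pos := rfl
  clear_value st₁
  by_cases hc : st.top rC - st.top rG = 0
  · refine ⟨st₁.set rD ((st.top rD - 1) :: (st.reg rD).tail), (hr₁.trans (t' := 3)
      ⟨3, le_rfl, ?_⟩).mono (by omega), hp, ?_, fun h => absurd hc h, fun _ => ?_, ?_⟩
    · simp [step, hS, hc, htop, h1, hreg]
    · simp [MState.set_top]
    · simp [MState.set_top, htop]
    · intro v h1 h2 h3 h4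
      simp [MState.set_reg, h1, h4, hreg]
  · refine ⟨((st₁.set rG (st.top rC :: st.reg rG)).set rX (st.top rE :: st.reg rX)).set rD
      ((st.top rD - 1) :: (st.reg rD).tail), (hr₁.trans (t' := 5)
      ⟨5, le_rfl, ?_⟩).mono (by omega), hp, ?_, fun _ => ?_, fun h => absurd h hc, ?_⟩
    · simp [step, hS, hc, htop, h1, hreg, MState.set_top, MState.set_reg]
    · simp [MState.set_top]
    · simp [MState.set_top]
    · intro v h1 h2 h3 h4
      simp [MState.set_reg, h1, h2, h3, h4, hreg]

theorem reach_scan {env : Source → ℕ → ℕ} {w : ℕ → ℕ} (ks : List Prog) (m : ℕ) :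
    ∀ (i₀ : ℕ) (st : MState), st.top rOne = 1 → st.top rE = i₀ → st.top rD = m →
      (∀ i, (st.reg 1).getD i 0 = w (i₀ + i)) → Best w i₀ (st.top rG) (st.top rX) →
    ∃ st', Reach env (.loop rD scanBody :: ks, st) (20 * m + 1) (ks, st') ∧ st'.pos = st.pos ∧
      Best w (i₀ + m) (st'.top rG) (st'.top rX) ∧ st'.reg rY = st.reg rY := by
  induction m with
  | zero =>
    intro i₀ st h1 hE hD hw hB
    exact ⟨st, .of_step (by simp [step, hD]), rfl, hB, rfl⟩
  | succ m ih =>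
    intro i₀ st h1 hE hD hw hB
    have hw0 : st.top 1 = w i₀ := by
      rw [← add_zero i₀, ← hw 0, MState.top]
      rcases st.reg 1 <;> rfl
    have htail : ∀ i, ((st.reg 1).tail).getD i 0 = w (i₀ + 1 + i) := fun i => by
      rw [Nat.add_assoc, Nat.add_comm 1, ← hw (i + 1)]
      rcases st.reg 1 <;> simp
    obtain ⟨st₁, hr₁, hp₁, hE₁, hC₁, hw₁, hf₁⟩ := reach_scanBody (env := env)
      (.loop rD scanBody :: ks) st h1
    have htop₁ : ∀ v, v ≠ 8 → v ≠ 18 → v ≠ 1 → st₁.top v = st.top v := fun v a b c =>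
      MState.top_eq_of_reg_eq (hf₁ v a b c)
    obtain ⟨st₂, hr₂, hp₂, hD₂, hpos, hneg, hf₂⟩ := reach_compareBody (env := env)
      (.loop rD scanBody :: ks) st₁ (by rw [htop₁ 2 (by decide) (by decide) (by decide), h1])
    have htop₂ : ∀ v, v ≠ 12 → v ≠ 4 → v ≠ 10 → v ≠ 6 → st₂.top v = st₁.top v :=
      fun v a b c d => MState.top_eq_of_reg_eq (hf₂ v a b c d)
    rw [hC₁, hw0, htop₁ 4 (by decide) (by decide) (by decide)] at hpos hneg
    rw [hE₁, hE] at hpos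
    rw [htop₁ 10 (by decide) (by decide) (by decide)] at hneg
    obtain ⟨st', h2, h3, h4, h5⟩ := ih (i₀ + 1) st₂
      (by rw [htop₂ 2 (by decide) (by decide) (by decide) (by decide),
        htop₁ 2 (by decide) (by decide) (by decide), h1])
      (by rw [htop₂ 8 (by decide) (by decide) (by decide) (by decide), hE₁, hE])
      (by rw [hD₂, htop₁ 6 (by decide) (by decide) (by decide), hD]; rfl)
      (by rw [hf₂ 1 (by decide) (by decide) (by decide) (by decide), hw₁]; exact htail)
      (by
        by_cases hc : w i₀ + 1 - st.top rG = 0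
        · rw [(hneg hc).1, (hneg hc).2]
          exact hB.keep hc
        · rw [(hpos hc).1, (hpos hc).2]
          exact hB.update hc)
    refine ⟨st', ((Reach.head ?_ (hr₁.trans hr₂)).trans h2).mono (by omega),
      h3.trans (hp₂.trans hp₁), ?_, ?_⟩
    · simp [step, hD]
    · rwa [show i₀ + (m + 1) = i₀ + 1 + m by omega]
    · rw [h5, hf₂ 16 (by decide) (by decide) (by decide) (by decide),
        hf₁ 16 (by decide) (by decide) (by decide)]

/-- Test whether `rX` and `rY` have the same top. -/
def eqTest : Prog :=
  .seq (.copy rX rC) (.seq (.sub rY rC) (.ite rC (.push rC 0)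
    (.seq (.copy rY rC) (.seq (.sub rX rC) (.ite rC (.push rC 0) (.push rC 1))))))

theorem reach_eqTest {env : Source → ℕ → ℕ} (ks : List Prog) (st : MState) :
    ∃ st', Reach env (eqTest :: ks, st) 11 (ks, st') ∧ st'.pos = st.pos ∧
      st'.top rC = if st.top rX = st.top rY then 1 else 0 := by
  by_cases h1 : st.top rX - st.top rY = 0
  · by_cases h2 : st.top rY - st.top rX = 0
    · have e : st.top rX = st.top rY := by omega
      refine ⟨((st.set rC (0 :: st.reg rC)).set rC (0 :: 0 :: st.reg rC)).set rC
        (1 :: 0 :: 0 :: st.reg rC), ⟨11, le_rfl, ?_⟩, rfl, ?_⟩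
      · simp [eqTest, step, MState.set_top, e, MState.set_set]
      · simp [MState.set_top, e]
    · have e : st.top rX ≠ st.top rY := by omega
      refine ⟨((st.set rC (0 :: st.reg rC)).set rC
        ((st.top rY - st.top rX) :: 0 :: st.reg rC)).set rC
        (0 :: (st.top rY - st.top rX) :: 0 :: st.reg rC), ⟨11, le_rfl, ?_⟩, rfl, ?_⟩
      · simp [eqTest, step, MState.set_top, h1, h2, MState.set_set]
      · simp [MState.set_top, e]
  · have e : st.top rX ≠ st.top rY := by omega
    refine ⟨st.set rC (0 :: (st.top rX - st.top rY) :: st.reg rC), ⟨6, by omega, ?_⟩, rfl, ?_⟩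
    · simp [eqTest, step, MState.set_top, h1, MState.set_set]
    · simp [MState.set_top, e]

/-- Test whether the most likely letter according to the weights in register `1` is the one in
`rY`. -/
def hitTest : Prog :=
  .seq (.copy rIn rD) (.seq (.push rE 0) (.seq (.push rG 0) (.seq (.push rX 0)
    (.seq (.loop rD scanBody) eqTest))))

open Classical in
theorem reach_hitTest {env : Source → ℕ → ℕ} {n a : ℕ} (hn : 0 < n) (st : MState)
    (h1 : st.top rOne = 1) (hIn : st.top rIn = n) (hY : st.top rY = a + 1) :
    ∃ st', Reach env ([hitTest], st) (20 * n + 25) ([], st') ∧ st'.pos = st.pos ∧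
      st'.top rC = if IsArgmax n (fun i => (st.reg 1).getD i 0) a then 1 else 0 := by
  let st₁ := (((st.set rD (n :: st.reg rD)).set rE (0 :: st.reg rE)).set rG (0 :: st.reg rG)).set rX
    (0 :: st.reg rX)
  have hr₁ : Reach env ([hitTest], st) 9 ([.loop rD scanBody, eqTest], st₁) := by
    refine ⟨9, le_rfl, ?_⟩
    simp [hitTest, step, MState.set_reg, hIn, st₁]
  obtain ⟨st₂, h2, h3, h4, h5⟩ := reach_scan (env := env) (w := fun i => (st.reg 1).getD i 0)
    [eqTest] n 0 st₁ (by simp [st₁, MState.set_top, h1]) (by simp [st₁, MState.set_top])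
    (by simp [st₁, MState.set_top]) (by simp [st₁, MState.set_reg])
    (by
      refine ⟨fun i hi => absurd hi (by omega), fun _ => by simp [st₁, MState.set_top],
        fun h => absurd h (by omega)⟩)
  obtain ⟨st₃, h6, h7, h8⟩ := reach_eqTest (env := env) [] st₂
  refine ⟨st₃, ((hr₁.trans h2).trans h6).mono (by omega), h7.trans h3, ?_⟩
  have hY₂ : st₂.top rY = a + 1 := by
    rw [MState.top_eq_of_reg_eq h5]
    simpa [st₁, MState.set_top] using hY
  rw [zero_add] at h4
  rw [h8, hY₂]
  simp only [h4.iff hn a]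

/-! ### One trial -/

theorem Tree.branch_run_le {B α : Type} {ω : ℕ → Bool} {x y : ℕ → B} {N : ℕ} (k : ℕ) :
    ∀ (F : (Fin k → Bool) → Tree B α) (_ : ∀ w P, ((F w).run ω x y P).2.s ≤ P.s + N) (P : Pos),
    ((Tree.branch k F).run ω x y P).2.s ≤ P.s + N := by
  induction k with
  | zero => exact fun F h P => h _ P
  | succ k ih => exact fun F h P => ih _ (fun w P => h _ P) ⟨P.c + 1, P.s, P.p⟩

theorem tabTree_run_le {B : Type} {ω : ℕ → Bool} {x y : ℕ → B} (k N : ℕ) (P : Pos) :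
    ((tabTree k N).run ω x y P).2.s ≤ P.s := by
  induction N generalizing P with
  | zero => exact le_rfl
  | succ N ih =>
    simp only [tabTree, Tree.run_bind, Tree.run]
    exact (ih _).trans (Tree.branch_run_le (N := 0) k _ (fun _ _ => le_rfl) P)

section Trial

variable {k M N n : ℕ} {off : ℕ} [NeZero n]

theorem attempts_run_le {ω : ℕ → Bool} {x y : ℕ → Clause k n} (col : Fin k → Syn M)
    (τ : Fin N → Fin k → Bool) (w : Fin k → Bool) (B : ℕ) (P : Pos) :
    ((attempts col off τ w B).run ω x y P).2.s ≤ P.s + B := by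
  induction B generalizing P with
  | zero => exact le_rfl
  | succ B ih =>
    simp only [attempts, Tree.run]
    split_ifs with h
    · simp only [Tree.run]
      omega
    · have := ih ⟨P.c, P.s + 1, P.p⟩
      simp only at this
      omega

theorem genTree_run_le {ω : ℕ → Bool} {x y : ℕ → Clause k n} (col : Fin k → Syn M)
    (τ : Fin N → Fin k → Bool) (B : ℕ) (P : Pos) :
    ((genTree col off τ B).run ω x y P).2.s ≤ P.s + B :=
  Tree.branch_run_le k _ (fun w P => attempts_run_le col τ w B P) P

open Classical in
/-- Whether the prediction of a program in its final configuration is the letter `a`. -/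
noncomputable def hitValue (n : ℕ) (a : ℕ) (c : List Prog × MState) : ℕ :=
  if IsArgmax n (fun i => (c.2.reg 0).getD i 0) a then 1 else 0

/-- Generate a block and test the prediction of its letter with number `φ`. -/
noncomputable def trialTree (col : Fin k → Syn M) (off N B : ℕ) (p : Prog) (t φ : ℕ) :
    Tree (Clause k n) ℕ :=
  (tabTree k N).bind fun τ => (genTree col off τ B).bind fun b =>
    ((ptree t ([p], MState.init n) [] ((fwd b).take φ).reverse).subst (genTree col off τ B)).bind
      fun c => .ret (hitValue n ((fwd b).getD φ 0) c)

/-- The program for a trial. -/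
noncomputable def trialProg (col : Fin k → Syn M) (B : ℕ) (p : Prog) (φ : ℕ) : Prog :=
  .seq (setup k) (.seq (genProg col B rP (List.range φ) [φ]) (.seq (.copy rIn 1)
    (.seq (onClauses col B p) hitTest)))

/-- A bound for the time of a trial. -/
def trialCost (k M n B t : ℕ) : ℕ :=
  n * (3 * k + 2 * k * (8 * k + 2) + 6) + (t + 1) * (genCost k M n B + 8) + 20 * n + 50

/-- For every test block, the program halts after `t` steps, after drawing at most `S` blocks. -/
def PredHalts (K n : ℕ) (p : Prog) (t S φ : ℕ) : Prop :=
  ∀ (b : Fin K → Fin n) (ω : ℕ → Bool) (x y : ℕ → Fin K → Fin n),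
    ((ptree t ([p], MState.init n) [] ((fwd b).take φ).reverse).run ω x y ⟨0, 0, 0⟩).1.1 = [] ∧
    ((ptree t ([p], MState.init n) [] ((fwd b).take φ).reverse).run ω x y ⟨0, 0, 0⟩).2.s +
      ((ptree t ([p], MState.init n) [] ((fwd b).take φ).reverse).run ω x y ⟨0, 0, 0⟩).2.p ≤ S

/-- Besides the at most `S` blocks read by the predictor there is the test block, and each block
takes at most `B` clauses. -/
theorem trialTree_run_le {ω : ℕ → Bool} {C y : ℕ → Clause k n} (col : Fin k → Syn M) {B t S φ : ℕ}
    {p : Prog} (hp : PredHalts (k + M) n p t S φ) (P : Pos) :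
    ((trialTree col off N B p t φ).run ω C y P).2.s ≤ P.s + B * (S + 1) := by
  simp only [trialTree, Tree.run_bind, Tree.run]
  set τ := ((tabTree k N).run ω C y P).1
  have h1 := tabTree_run_le (ω := ω) (x := C) (y := y) k N P
  set P₁ := ((tabTree k N).run ω C y P).2
  have h2 := genTree_run_le (ω := ω) (x := C) (y := y) (off := off) col τ B P₁
  set b := ((genTree col off τ B).run ω C y P₁).1
  set P₂ := ((genTree col off τ B).run ω C y P₁).2
  obtain ⟨ω', x', y', -, h3⟩ := Tree.exists_run_subst (g := genTree col off τ B) ω C y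
    (genTree_run_le col τ B) (ptree t ([p], MState.init n) [] ((fwd b).take φ).reverse) P₂
  have h4 := Nat.mul_le_mul_left B (hp b ω' x' y').2
  rw [Nat.mul_add]
  omega

/-- The beginning of the test block is put into the buffer of the past, where the predictor finds it
before any older block; the next letter waits in `rY` for comparison with the prediction. -/
theorem reach_trial {ω : ℕ → Bool} {C : ℕ → Clause k n} (y : ℕ → Clause k n)
    (hoff : off < 2 * k) (hn : n = off + 2 * (k * N)) (hn4 : 4 ≤ n) (col : Fin k → Syn M)
    {B t S φ : ℕ} (hφ : φ < k + M) {p : Prog} (hp : PredHalts (k + M) n p t S φ) (st : MState)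
    (P : Pos) (hP : At k st P) (hst : st.reg = (MState.init n).reg) :
    ∃ st', Reach (streamEnv ω C) ([trialProg col B p φ], st) (trialCost k M n B t) ([], st') ∧
      At k st' ((trialTree col off N B p t φ).run ω C y P).2 ∧
      st'.top rC = ((trialTree col off N B p t φ).run ω C y P).1 := by
  have hN : N ≤ n := by
    rcases Nat.eq_zero_or_pos k with rfl | hk
    · omega
    · nlinarith
  obtain ⟨st₁, hr₁, hP₁, hR₁, hf₁⟩ := reach_setup (ω := ω) (C := C) y hoff hn
    [.seq (genProg col B rP (List.range φ) [φ]) (.seq (.copy rIn 1) (.seq (onClauses col B p) hitTest))]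
    st P hP hst
  set τ := ((tabTree k N).run ω C y P).1 with hτ
  obtain ⟨st₂, hr₂, hP₂, hR₂, hW₂⟩ := reach_gen (ω := ω) (C := C) y (by omega) hn4 col (r := rP)
    (Or.inr rfl) (L := List.range φ) (L' := [φ])
    (fun i hi => by
      rcases List.mem_append.1 hi with h | h
      · have := List.mem_range.1 h
        omega
      · rw [List.mem_singleton.1 h]
        exact hφ)
    [.seq (.copy rIn 1) (.seq (onClauses col B p) hitTest)] B st₁ _ hR₁ hP₁
  set b := ((genTree col off τ B).run ω C y ((tabTree k N).run ω C y P).2).1 with hb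
  have hreg : ∀ v, Stable v → v ≠ rP → v ≠ rY → st₂.reg v = (MState.init n).reg v :=
    fun v h1 h2 h3 => by rw [hW₂.frame v h1 h2 h3, hf₁ v h1]
  have hinit : ∀ v, v ≠ 0 → (MState.init n).reg v = [] := fun v h => if_neg h
  let st₃ := st₂.set 1 [n]
  have hIn₂ : st₂.reg 0 = [n] := hreg 0 (by unfold Stable; omega) (by decide) (by decide)
  have hr₃ : Reach (streamEnv ω C) ([.seq (.copy rIn 1) (.seq (onClauses col B p) hitTest)], st₂) 3
      ([onClauses col B p, hitTest], st₃) := by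
    refine ⟨3, le_rfl, ?_⟩
    have e : st₂.reg 1 = [] := by
      rw [hreg 1 (by unfold Stable; omega) (by decide) (by decide), hinit 1 (by decide)]
    simp [step, MState.top, hIn₂, e, st₃]
  have hsim : Sim off τ [] ((fwd b).take φ).reverse (MState.init n) st₃ := by
    refine ⟨hR₂.of_reg fun w h1 h2 h3 h4 => ?_, fun v => ?_, ?_, ?_⟩
    · rw [MState.set_reg, if_neg (by omega)]
    · rw [MState.set_reg]
      by_cases hv : v = 0
      · subst hv
        rfl
      · rw [if_neg (by omega), hreg _ (by unfold Stable; omega) (by omega) (by omega),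
          hinit _ (by omega), hinit _ hv]
    · rw [MState.set_reg, if_neg (by omega), hreg _ (by unfold Stable; omega) (by omega) (by omega),
        hinit _ (by decide)]
      rfl
    · rw [MState.set_reg, if_neg (by omega), hW₂.main, hf₁ _ (by unfold Stable; omega),
        hinit _ (by decide), List.append_nil, List.map_reverse, List.map_take, ← map_blockVal,
        ← List.map_take, List.take_range, Nat.min_eq_left hφ.le]
  obtain ⟨st₄, bs', bp', hr₄, hP₄, hs₄, hf₄⟩ := reach_ptree (ω := ω) (C := C) y (by omega)
    (by omega) hn4 col B [hitTest] t ([p], MState.init n) [] ((fwd b).take φ).reverse st₃ _ hsim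
    ⟨hP₂.coin, hP₂.sample⟩
  set P₂ := ((genTree col off τ B).run ω C y ((tabTree k N).run ω C y P).2).2 with hP₂'
  obtain ⟨ω', x', y', e, -⟩ := Tree.exists_run_subst (g := genTree col off τ B) ω C y
    (genTree_run_le col τ B) (ptree t ([p], MState.init n) [] ((fwd b).take φ).reverse) P₂
  set R := ((ptree t ([p], MState.init n) [] ((fwd b).take φ).reverse).subst
    (genTree col off τ B)).run ω C y P₂ with hR
  have hhalt : R.1.1 = [] := by rw [e]; exact (hp b ω' x' y').1
  rw [hhalt] at hr₄
  have hbφ : st₂.reg rY = [(fwd b).getD φ 0 + 1] := by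
    rw [hW₂.test, hf₁ _ (by unfold Stable; omega), hinit _ (by decide)]
    simp [blockVal, fwd, hφ]
  obtain ⟨st₅, hr₅, hp₅, ht₅⟩ := reach_hitTest (env := streamEnv ω C) (n := n)
    (a := (fwd b).getD φ 0) (by omega) st₄ hs₄.ready.one
    (by rw [MState.top, hf₄.1, MState.set_reg, if_neg (by decide), hIn₂]; rfl)
    (by rw [MState.top, hf₄.2, MState.set_reg, if_neg (by decide), hbφ]; rfl)
  have hrun : (trialTree col off N B p t φ).run ω C y P =
      (hitValue n ((fwd b).getD φ 0) R.1, R.2) := by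
    simp only [trialTree, Tree.run_bind, Tree.run]
    rfl
  refine ⟨st₅, ((Reach.seq (hr₁.trans (Reach.seq hr₂))).trans (hr₃.trans (hr₄.trans hr₅))).mono ?_,
    ?_, ?_⟩
  · have h1 := Nat.mul_le_mul_right (3 * k + 2 * k * (8 * k + 2) + 6) hN
    have h2 : (t + 1) * (genCost k M n B + 8) = t * (genCost k M n B + 8) + (genCost k M n B + 8) :=
      Nat.succ_mul _ _
    simp only [trialCost, h2]
    simp only [genCost, List.length_range, List.length_singleton]
    omega
  · rw [hrun]
    exact ⟨by rw [hp₅]; exact hP₄.coin, by rw [hp₅]; exact hP₄.sample⟩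
  · rw [hrun, ht₅]
    have e1 : st₄.reg 1 = R.1.2.reg 0 := hs₄.reg 0
    rw [e1]
    rfl

end Trial

end SeqPred

namespace SeqPred

/-! ### The distinguisher -/

/-- The register of the trial number `ρ`, out of `J`, which stands for `v`. -/
def slot (J ρ v : ℕ) : ℕ := (J + 1) * v + (ρ + 1)

theorem slot_mod {J ρ : ℕ} (h : ρ < J) (v : ℕ) : slot J ρ v % (J + 1) = ρ + 1 := by
  rw [slot, Nat.mul_add_mod, Nat.mod_eq_of_lt (by omega)]

theorem slot_injective (J ρ : ℕ) : Function.Injective (slot J ρ) := fun _ _ h =>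
  Nat.eq_of_mul_eq_mul_left (Nat.succ_pos J) (Nat.add_right_cancel h)

theorem slot_ne {J ρ ρ' : ℕ} (h : ρ < J) (h' : ρ' < J) (hne : ρ ≠ ρ') (v v' : ℕ) :
    slot J ρ v ≠ slot J ρ' v' := fun e => hne <| by
  have := slot_mod h v
  rw [e, slot_mod h' v'] at this
  omega

theorem slot_ne_mul {J ρ : ℕ} (h : ρ < J) (v g : ℕ) : (J + 1) * g ≠ slot J ρ v := fun e => by
  have := slot_mod h v
  rw [← e, Nat.mul_mod_right] at this
  omega

section Main

variable {k M N n : ℕ} {off : ℕ}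

/-- The first `m` of `J` trials; the results are added up in register `J + 1`. -/
noncomputable def trialsProg (col : Fin k → Syn M) (B : ℕ) (p : Prog) (J : ℕ) : ℕ → Prog
  | 0 => .skip
  | m + 1 => .seq (trialsProg col B p J m) (.seq (.copy 0 (slot J m 0))
      (.seq ((trialProg col B p (k + m % M)).map (slot J m)) (.add (slot J m rC) ((J + 1) * 1))))

/-- Test whether more than `r` of `J` trials are successful. -/
noncomputable def mainProg (col : Fin k → Syn M) (B : ℕ) (p : Prog) (J r : ℕ) : Prog :=
  .seq (trialsProg col B p J J) (.seq (.copy ((J + 1) * 1) 0) (.seq (.push ((J + 1) * 2) r)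
    (.sub ((J + 1) * 2) 0)))

variable [NeZero n]

/-- The number of successful trials. -/
noncomputable def countTree (col : Fin k → Syn M) (off N B : ℕ) (p : Prog) (t J : ℕ) :
    Tree (Clause k n) ℕ :=
  sumTree (fun i => trialTree col off N B p t (k + i % M)) J

/-- Trial number `ρ` uses the registers congruent to `ρ + 1` modulo `J + 1`. The registers of later
trials are therefore still empty, and the multiples of `J + 1` are free for the input and the count.
-/
theorem reach_trials {ω : ℕ → Bool} {C : ℕ → Clause k n} (y : ℕ → Clause k n)
    (hoff : off < 2 * k) (hn : n = off + 2 * (k * N)) (hn4 : 4 ≤ n) (hM : 0 < M)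
    (col : Fin k → Syn M) {B t S : ℕ} {p : Prog} (hp : ∀ φ < k + M, PredHalts (k + M) n p t S φ)
    {J : ℕ} (m : ℕ) (hm : m ≤ J) : ∀ ks : List Prog,
    ∃ st', Reach (streamEnv ω C) (trialsProg col B p J m :: ks, MState.init n)
        (m * (trialCost k M n B t + 5) + 1) (ks, st') ∧
      At k st' ((countTree col off N B p t m).run ω C y ⟨0, 0, 0⟩).2 ∧
      st'.top ((J + 1) * 1) = ((countTree col off N B p t m).run ω C y ⟨0, 0, 0⟩).1 ∧
      st'.reg 0 = [n] ∧ ∀ ρ, m ≤ ρ → ρ < J → ∀ v, st'.reg (slot J ρ v) = [] := by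
  induction m with
  | zero =>
    refine fun ks => ⟨MState.init n, (Reach.of_step rfl).mono (by omega), ⟨rfl, rfl⟩, rfl, rfl,
      fun ρ _ hρ v => ?_⟩
    have h : slot J ρ v ≠ 0 := by unfold slot; omega
    simp [MState.init, h]
  | succ m ih =>
    intro ks
    obtain ⟨st₁, hr₁, hP₁, ha₁, h0₁, hs₁⟩ := ih (by omega)
      (.seq (.copy 0 (slot J m 0)) (.seq ((trialProg col B p (k + m % M)).map (slot J m))
        (.add (slot J m rC) ((J + 1) * 1))) :: ks)
    set P₁ := ((countTree col off N B p t m).run ω C y ⟨0, 0, 0⟩).2 with hP₁'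
    let st₂ := st₁.set (slot J m 0) [n]
    have hr₂ : Reach (streamEnv ω C) (.seq (.copy 0 (slot J m 0))
        (.seq ((trialProg col B p (k + m % M)).map (slot J m))
        (.add (slot J m rC) ((J + 1) * 1))) :: ks, st₁) 3
        ((trialProg col B p (k + m % M)).map (slot J m) ::
          .add (slot J m rC) ((J + 1) * 1) :: ks, st₂) := by
      refine ⟨3, le_rfl, ?_⟩
      have e : st₁.top 0 = n := by rw [MState.top, h0₁]; rfl
      simp [step, e, hs₁ m le_rfl (by omega), st₂]
    have hren : Renamed (slot J m) st₂ ⟨(MState.init n).reg, st₁.pos⟩ st₂ := by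
      refine ⟨fun v => ?_, rfl, fun _ _ => rfl⟩
      by_cases hv : v = 0
      · subst hv
        simp [st₂, MState.init]
      · rw [MState.set_reg, if_neg fun h => hv (slot_injective J m h), hs₁ m le_rfl (by omega)]
        exact (if_neg hv).symm
    obtain ⟨lst, hr₃, hP₃, ht₃⟩ := reach_trial (ω := ω) (C := C) y hoff hn hn4 col (B := B)
      (φ := k + m % M) (by have := Nat.mod_lt m hM; omega) (hp (k + m % M) (by have := Nat.mod_lt m hM; omega))
      ⟨(MState.init n).reg, st₁.pos⟩ P₁ ⟨hP₁.coin, hP₁.sample⟩ rfl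
    obtain ⟨st₄, hr₄, hren₄⟩ := hren.reach (slot_injective J m) hr₃
      (.add (slot J m rC) ((J + 1) * 1) :: ks)
    have hreg : ∀ v, (∀ w, v ≠ slot J m w) → st₄.reg v = st₁.reg v := fun v hv => by
      rw [hren₄.frame v (by rintro ⟨w, rfl⟩; exact hv w rfl), MState.set_reg, if_neg (hv 0)]
    have hJ := hreg ((J + 1) * 1) (fun w => slot_ne_mul (by omega) w 1)
    have h0 := hreg ((J + 1) * 0) (fun w => slot_ne_mul (by omega) w 0)
    rw [Nat.mul_zero] at h0
    refine ⟨st₄.set ((J + 1) * 1) ((st₄.top ((J + 1) * 1) + st₄.top (slot J m rC)) ::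
      (st₄.reg ((J + 1) * 1)).tail), ((Reach.seq (hr₁.trans (hr₂.trans hr₄))).trans
      (Reach.of_step rfl)).mono ?_, ?_, ?_, ?_, fun ρ h1 h2 v => ?_⟩
    · rw [Nat.succ_mul]
      omega
    · simp only [countTree, sumTree, Tree.run_bind, Tree.run]
      exact ⟨by rw [MState.set_pos, hren₄.pos]; exact hP₃.coin,
        by rw [MState.set_pos, hren₄.pos]; exact hP₃.sample⟩
    · rw [MState.set_top, if_pos rfl, MState.top_eq_of_reg_eq hJ, ha₁,
        MState.top, hren₄.reg, ← MState.top, ht₃]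
      simp only [countTree, sumTree, Tree.run_bind, Tree.run]
      rfl
    · rw [MState.set_reg, if_neg (by omega), h0, h0₁]
    · rw [MState.set_reg, if_neg (slot_ne_mul h2 v 1).symm,
        hreg _ (fun w => slot_ne h2 (by omega) (by omega) v w), hs₁ ρ (by omega) h2]

theorem reach_main {ω : ℕ → Bool} {C : ℕ → Clause k n} (y : ℕ → Clause k n)
    (hoff : off < 2 * k) (hn : n = off + 2 * (k * N)) (hn4 : 4 ≤ n) (hM : 0 < M)
    (col : Fin k → Syn M) {B t S : ℕ} {p : Prog} (hp : ∀ φ < k + M, PredHalts (k + M) n p t S φ)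
    (J r : ℕ) :
    ∃ st', Reach (streamEnv ω C) ([mainProg col B p J r], MState.init n)
        (J * (trialCost k M n B t + 5) + 8) ([], st') ∧
      At k st' ((countTree col off N B p t J).run ω C y ⟨0, 0, 0⟩).2 ∧
      st'.top 0 = ((countTree col off N B p t J).run ω C y ⟨0, 0, 0⟩).1 - r := by
  obtain ⟨st₁, hr₁, hP₁, ha₁, -⟩ := reach_trials (ω := ω) (C := C) y hoff hn hn4 hM col (B := B) hp
    J le_rfl [.seq (.copy ((J + 1) * 1) 0) (.seq (.push ((J + 1) * 2) r) (.sub ((J + 1) * 2) 0))]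
  rw [← ha₁]
  have e1 : (0 : ℕ) ≠ (J + 1) * 2 := by omega
  refine ⟨((st₁.set 0 (st₁.top ((J + 1) * 1) :: st₁.reg 0)).set ((J + 1) * 2)
    (r :: st₁.reg ((J + 1) * 2))).set 0 ((st₁.top ((J + 1) * 1) - r) :: st₁.reg 0),
    ((Reach.seq hr₁).trans (t' := 5) ⟨5, le_rfl, ?_⟩).mono (by omega), ⟨hP₁.coin, hP₁.sample⟩, ?_⟩
  · simp [step, MState.set_reg, MState.set_top]
  · simp [MState.set_top]

end Main

/-! ### Computations which use only one of the streams -/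

/-- The computation does not use the second stream. -/
def Tree.NoP {B α : Type} (t : Tree B α) : Prop := ∀ ω x y P, (t.run ω x y P).2.p = P.p

theorem Tree.NoP.bind {B α β : Type} {t : Tree B α} {g : α → Tree B β} (ht : t.NoP)
    (hg : ∀ a, (g a).NoP) : (t.bind g).NoP := fun ω x y P => by
  rw [Tree.run_bind, hg, ht]

theorem Tree.NoP.ret {B α : Type} (a : α) : (Tree.ret a : Tree B α).NoP := fun _ _ _ _ => rfl

/-- Both the samples and the past of the simulated predictor are generated from the one stream of
clauses. -/
theorem Tree.NoP.subst {B B' α : Type} {g : Tree B' B} (hg : g.NoP) (t : Tree B α) :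
    (t.subst g).NoP := by
  induction t with
  | ret a => exact .ret a
  | coin f ih => exact fun ω x y P => ih (ω P.c) ω x y _
  | drawS f ih => exact hg.bind ih
  | drawP f ih => exact hg.bind ih

theorem Tree.NoP.branch {B α : Type} (k : ℕ) : ∀ {F : (Fin k → Bool) → Tree B α}
    (_ : ∀ w, (F w).NoP), (Tree.branch k F).NoP := by
  induction k with
  | zero => exact fun h => h _
  | succ k ih => exact fun h ω x y P => ih (fun w => h _) ω x y _

theorem noP_tabTree {B : Type} (k N : ℕ) : (tabTree (B := B) k N).NoP := by
  induction N with
  | zero => exact .ret _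
  | succ N ih => exact (Tree.NoP.branch k fun _ => .ret _).bind fun _ => ih.bind fun _ => .ret _

section Probability

variable {k M N n : ℕ} {off : ℕ} [NeZero n]

theorem noP_genTree (col : Fin k → Syn M) (τ : Fin N → Fin k → Bool) (B : ℕ) :
    (genTree (n := n) col off τ B).NoP := by
  refine Tree.NoP.branch k fun w => ?_
  induction B with
  | zero => exact .ret _
  | succ B ih =>
    intro ω x y P
    simp only [attempts, Tree.run]
    split_ifs with h
    · rfl
    · exact ih ω x y _

theorem noP_countTree (col : Fin k → Syn M) (B : ℕ) (p : Prog) (t J : ℕ) :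
    (countTree (n := n) col off N B p t J).NoP := by
  unfold countTree
  induction J with
  | zero => exact .ret _
  | succ J ih =>
    exact ih.bind fun _ => Tree.NoP.bind ((noP_tabTree k N).bind fun τ =>
      (noP_genTree col τ B).bind fun b => ((noP_genTree col τ B).subst _).bind fun _ => .ret _)
        fun _ => .ret _

theorem countTree_run_le {ω : ℕ → Bool} {C y : ℕ → Clause k n} (col : Fin k → Syn M) (hM : 0 < M)
    {B t S : ℕ} {p : Prog} (hp : ∀ φ < k + M, PredHalts (k + M) n p t S φ) (J : ℕ) :
    ((countTree col off N B p t J).run ω C y ⟨0, 0, 0⟩).2.s ≤ J * (B * (S + 1)) := by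
  unfold countTree
  induction J with
  | zero => simp [sumTree, Tree.run]
  | succ J ih =>
    simp only [sumTree, Tree.run_bind, Tree.run]
    refine (trialTree_run_le col (hp _ ?_) _).trans ?_
    · have := Nat.mod_lt J hM
      omega
    · rw [Nat.succ_mul]
      exact Nat.add_le_add_right ih _

variable {t' s' : ℕ}

-- The flattened list of clauses and the stream of clauses agree as far as the former reaches,
-- because every clause occupies `k` entries.
omit [NeZero n] in
theorem clauseEnv_eq_streamEnv [Inhabited (Clause k n)] (coins : Fin t' → Bool)
    (Cs : Fin s' → Clause k n) (src : Source) (i : ℕ) (hc : src = .coin → i < t')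
    (hs : src = .sample → i < k * s') :
    clauseEnv coins Cs src i = streamEnv (extend coins) (extend Cs) src i := by
  rcases src with _ | _ | _
  · have hi := hc rfl
    simp [clauseEnv, mkEnv, streamOf, streamEnv, extend, hi]
  · have hi := hs rfl
    have hk : 0 < k := Nat.pos_of_mul_pos_right (lt_of_le_of_lt (Nat.zero_le _) hi)
    have hq : i / k < s' := (Nat.div_lt_iff_lt_mul hk).2 (by rwa [Nat.mul_comm] at hi)
    simp only [clauseEnv, mkEnv, streamOf, streamEnv, extend, dif_pos hq]
    have key : ∀ (l : List (Clause k n)) (i : ℕ) (h : i / k < l.length),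
        (l.flatMap Clause.codes).getD i 0 = (l[i / k]).codes.getD (i % k) 0 := by
      intro l
      induction l with
      | nil => intro i h; simp at h
      | cons C l ih =>
        intro i h
        have hlen : C.codes.length = k := by simp [Clause.codes]
        rw [List.flatMap_cons]
        by_cases hik : i < k
        · rw [List.getD_append _ _ _ _ (by omega)]
          simp [Nat.div_eq_of_lt hik, Nat.mod_eq_of_lt hik]
        · obtain ⟨j, rfl⟩ := Nat.exists_eq_add_of_le (not_lt.1 hik)
          have hj : (k + j) / k = j / k + 1 := by rw [Nat.add_div_left _ hk]
          rw [List.getD_append_right _ _ _ _ (by omega), hlen, Nat.add_sub_cancel_left,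
            ih j (by rw [hj] at h; simpa using h)]
          simp [hj]
    rw [key _ _ (by simpa using hq)]
    simp
  · simp [clauseEnv, mkEnv, streamOf, streamEnv]

theorem exec_main [Inhabited (Clause k n)]
    (hoff : off < 2 * k) (hn : n = off + 2 * (k * N)) (hn4 : 4 ≤ n) (hM : 0 < M)
    (col : Fin k → Syn M) {B t S : ℕ} {p : Prog} (hp : ∀ φ < k + M, PredHalts (k + M) n p t S φ)
    {J : ℕ} (r : ℕ) (ht' : J * (trialCost k M n B t + 5) + 8 ≤ t') (hs' : J * (B * (S + 1)) ≤ s')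
    (coins : Fin t' → Bool) (Cs : Fin s' → Clause k n) (y : ℕ → Clause k n) :
    (exec (mainProg col B p J r) (clauseEnv coins Cs) n t').1 = [] ∧
    (exec (mainProg col B p J r) (clauseEnv coins Cs) n t').2.pos .sample ≤ k * s' ∧
    ((countTree col off N B p t J).run (extend coins) (extend Cs) y ⟨0, 0, 0⟩).2.c ≤ t' ∧
    (exec (mainProg col B p J r) (clauseEnv coins Cs) n t').2.top 0 =
      ((countTree col off N B p t J).run (extend coins) (extend Cs) y ⟨0, 0, 0⟩).1 - r := by
  obtain ⟨st', hr, hP, h0⟩ := reach_main (ω := extend coins) (C := extend Cs) y hoff hn hn4 hM col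
    (B := B) hp J r
  have e := iterate_eq_of_reach_nil (hr.mono ht')
  have hs := Nat.mul_le_mul_left k ((countTree_run_le (ω := extend coins) (C := extend Cs) (y := y)
    (off := off) (N := N) col hM (B := B) hp J).trans hs')
  have hc : st'.pos .coin ≤ t' := by
    have := iterate_pos_le (streamEnv (extend coins) (extend Cs))
      ([mainProg col B p J r], MState.init n) .coin t'
    rw [e] at this
    simpa [MState.init] using this
  rw [← hP.sample] at hs
  have e' : exec (mainProg col B p J r) (clauseEnv coins Cs) n t' = ([], st') := by
    rw [exec, ← e]
    refine iterate_congr fun src i hi => ?_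
    rw [e] at hi
    refine clauseEnv_eq_streamEnv coins Cs src i ?_ ?_
    · rintro rfl
      exact hi.trans_le hc
    · rintro rfl
      exact hi.trans_le hs
  rw [e']
  exact ⟨rfl, hs, by rw [← hP.coin]; exact hc, h0⟩

/-- The probability of an answer over clauses drawn beforehand is the mean of a tree, since the
program uses no more coins and clauses than are provided. -/
theorem plantedProb_main [Inhabited (Clause k n)]
    (hoff : off < 2 * k) (hn : n = off + 2 * (k * N)) (hn4 : 4 ≤ n) (hM : 0 < M)
    (col : Fin k → Syn M) {B t S : ℕ} {p : Prog} (hp : ∀ φ < k + M, PredHalts (k + M) n p t S φ)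
    {J : ℕ} (r : ℕ) (ht' : J * (trialCost k M n B t + 5) + 8 ≤ t') (hs' : J * (B * (S + 1)) ≤ s')
    {D : Clause k n → ℝ} (hD : ∑ C, D C = 1) :
    plantedProb (mainProg col B p J r) t' s' D =
      (countTree col off N B p t J).mean D fun a => if r < a then 1 else 0 := by
  classical
  -- At most one coin is read per step, so the time bound limits the coins as well.
  have hcoin : ∀ (ω : ℕ → Bool) (x y : ℕ → Clause k n),
      ((countTree col off N B p t J).run ω x y ⟨0, 0, 0⟩).2.c ≤ t' := by
    intro ω x y
    obtain ⟨st', hr, hP, h0⟩ := reach_main (ω := ω) (C := x) y hoff hn hn4 hM col (B := B) hp J r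
    have e := iterate_eq_of_reach_nil (hr.mono ht')
    have := iterate_pos_le (streamEnv ω x) ([mainProg col B p J r], MState.init n) .coin t'
    rw [e, ← hP.coin.symm] at this
    simpa [MState.init] using this
  rw [Tree.mean_eq_streamMean hD _ _ t' s' 0 fun ω x y => ⟨hcoin ω x y,
    (countTree_run_le col hM hp J).trans hs', (noP_countTree col B p t J ω x y _).le⟩]
  simp only [streamMean_eq_sum fair, streamMean_eq_sum D, streamMean]
  unfold plantedProb
  refine Finset.sum_congr rfl fun coins _ => ?_
  rw [Finset.mul_sum]
  refine Finset.sum_congr rfl fun Cs _ => ?_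
  have h := (exec_main hoff hn hn4 hM col hp r ht' hs' coins Cs fun _ => default).2.2.2
  simp only [AnswersPlanted, h, fair, Finset.prod_const, Finset.card_univ, Fintype.card_fin, ne_eq,
    Nat.sub_eq_zero_iff_le, not_le, mul_assoc]

end Probability

end SeqPred

namespace SeqPred

/-! ### The probability that a trial is successful -/

theorem mean_tabTree {B : Type} [Fintype B] (μ : B → ℝ) (k N : ℕ)
    (F : (Fin N → Fin k → Bool) → ℝ) :
    (tabTree k N).mean μ F = ∑ τ, ((1 / 2) ^ k) ^ N * F τ := by
  induction N with
  | zero =>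
    simp only [tabTree, Tree.mean, Finset.univ_unique, Finset.sum_singleton, pow_zero, one_mul]
    congr 1
  | succ N ih =>
    rw [tabTree, Tree.mean_bind, Tree.mean_branch, sum_snoc, Finset.sum_comm]
    refine Finset.sum_congr rfl fun row _ => ?_
    simp only [Tree.mean, Tree.mean_bind, ih, Finset.mul_sum]
    refine Finset.sum_congr rfl fun τ _ => ?_
    ring

theorem hitValue_le_one (n a : ℕ) (c : List Prog × MState) : hitValue n a c ≤ 1 := by
  unfold hitValue
  split_ifs <;> norm_num

/-- The first letter of maximal weight is unique, so one configuration hits at most one of several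
distinct letters. -/
theorem sum_hitValue_le {ι : Type} (s : Finset ι) {a : ι → ℕ} (ha : Set.InjOn a s) (n : ℕ)
    (c : List Prog × MState) : ∑ i ∈ s, (hitValue n (a i) c : ℝ) ≤ 1 := by
  classical
  by_cases h : ∃ i ∈ s, IsArgmax n (fun i => (c.2.reg 0).getD i 0) (a i)
  · obtain ⟨i, hi, hm⟩ := h
    rw [Finset.sum_eq_single_of_mem i hi fun j hj hji => ?_]
    · exact_mod_cast hitValue_le_one _ _ _
    · rw [hitValue, if_neg fun hm' => hji (ha hj hi (hm'.unique hm)), Nat.cast_zero]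
  · push Not at h
    rw [Finset.sum_eq_zero fun i hi => ?_]
    · norm_num
    · rw [hitValue, if_neg (h i hi), Nat.cast_zero]

section TrialMean

variable {k M N n : ℕ} [NeZero n]

/-- The probability that a program predicts the letter number `φ` of a block correctly. -/
noncomputable def blockHit (col : Fin k → Syn M) (off : ℕ) (η θ : ℝ) (p : Prog) (t φ : ℕ)
    (σ : Fin N → Fin k → Bool) : ℝ :=
  ∑ b : Fin (k + M) → Fin n, blockDist col off η θ σ b *
    (ptree t ([p], MState.init n) [] ((fwd b).take φ).reverse).mean
      (blockDist (n := n) col off η θ σ) fun c => (hitValue n ((fwd b).getD φ 0) c : ℝ)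

variable {col : Fin k → Syn M} {d : ℕ}

/-- The step from the worst case to the average case: the planted signs only permute the random
tables, so for every `σ` a trial behaves as on a uniformly random member of the family. -/
theorem mean_trialTree
    (hcol : ∀ u ≠ 0, d < (Finset.univ.filter fun i => pr u (col i) ≠ 0).card)
    (hN : 0 < N) (hn : k * N ≤ n) (hkn : k ≤ n) (η : ℝ) (σ : Fin n → Bool) (off B : ℕ) (p : Prog)
    (t φ : ℕ) :
    (trialTree col off N B p t φ).mean (noisyPlanted (codeDist col) η σ) (fun h => (h : ℝ)) =
      ∑ τ : Fin N → Fin k → Bool, ((1 / 2) ^ k) ^ N *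
        blockHit (n := n) col off η ((1 - acceptProb k N n) ^ B) p t φ τ := by
  have h1 := mean_genTree hcol hN hn hkn η σ off
  rw [trialTree, Tree.mean_bind, mean_tabTree]
  have e : ∀ τ : Fin N → Fin k → Bool, ((genTree col off τ B).bind fun b =>
      ((ptree t ([p], MState.init n) [] ((fwd b).take φ).reverse).subst (genTree col off τ B)).bind
        fun c => Tree.ret (hitValue n ((fwd b).getD φ 0) c)).mean
          (noisyPlanted (codeDist col) η σ) (fun h => (h : ℝ)) =
      blockHit (n := n) col off η ((1 - acceptProb k N n) ^ B) p t φ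
        (fun q i => xor (τ q i) (σ (blockVars hn (fun _ => q) i))) := by
    intro τ
    rw [Tree.mean_bind, h1 τ B, blockHit]
    refine Finset.sum_congr rfl fun b _ => ?_
    rw [Tree.mean_bind, Tree.mean_subst (h1 τ B)]
    rfl
  simp only [e]
  -- Adding the planted signs is an involution on the tables, and the tables are uniformly
  -- distributed.
  refine Fintype.sum_equiv (Function.Involutive.toPerm
    (fun (τ : Fin N → Fin k → Bool) q i => xor (τ q i) (σ (blockVars hn (fun _ => q) i)))
    fun τ => ?_) _ _ fun τ => rfl
  funext q i
  simp

theorem sum_add_eq (z₀ : Syn M) (f : Syn M → ℝ) : ∑ z, f (z + z₀) = ∑ z, f z :=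
  Fintype.sum_equiv (Equiv.addRight z₀) _ _ fun _ => rfl

/-- At noise rate one the syndrome is uniform and independent of the literals. Whatever precedes its
`j`-th letter, the four values are equally likely, while the prediction can match only one. Default
blocks add at most `θ`. -/
theorem blockHit_one_le (hN : 0 < N) (hn : 4 ≤ n) (off : ℕ) {θ : ℝ} (hθ₀ : 0 ≤ θ) (hθ₁ : θ ≤ 1)
    (p : Prog) (t : ℕ) (j : Fin M) (σ : Fin N → Fin k → Bool) :
    blockHit (n := n) col off 1 θ p t (k + j) σ ≤ 1 / 4 + θ := by
  set β := blockDist (n := n) col off 1 θ σ with hβ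
  have hβ₀ : ∀ b, 0 ≤ β b := blockDist_nonneg col off zero_le_one le_rfl hθ₀ hθ₁ σ
  have hβ₁ : ∑ b, β b = 1 := sum_blockDist col off 1 θ hN σ
  set F : (Fin (k + M) → Fin n) → ℝ := fun b =>
    (ptree t ([p], MState.init n) [] ((fwd b).take (k + j)).reverse).mean β
      fun c => (hitValue n ((fwd b).getD (k + j) 0) c : ℝ) with hF
  have hF₁ : ∀ b, F b ≤ 1 := fun b =>
    (Tree.mean_mono hβ₀ _ fun c => by exact_mod_cast hitValue_le_one _ _ c).trans
      (Tree.mean_const hβ₁ _ 1).le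
  -- Changing the `j`-th pair of the syndrome affects nothing visible before the test letter, so the
  -- same prediction is tested against four distinct letters.
  have key : ∀ (q : Fin k → Fin N) (v : Fin k → Bool) (z : Syn M),
      ∑ e : ZMod 2 × ZMod 2, F (mkBlock off σ q v (z + Pi.single j e)) ≤ 1 := by
    intro q v z
    have hpre : ∀ e : ZMod 2 × ZMod 2,
        (fwd (mkBlock (n := n) off σ q v (z + Pi.single j e))).take (k + j) =
        (fwd (mkBlock (n := n) off σ q v z)).take (k + j) := by
      intro e
      refine List.ext_getElem (by simp [fwd]) fun i h1 h2 => ?_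
      have hi : i < k + j := by simp [fwd] at h1; omega
      simp only [fwd, List.getElem_take, List.getElem_ofFn]
      by_cases hik : i < k
      · have : (⟨i, by omega⟩ : Fin (k + M)) = Fin.castAdd M ⟨i, hik⟩ := rfl
        rw [this, mkBlock_castAdd, mkBlock_castAdd]
      · have : (⟨i, by omega⟩ : Fin (k + M)) = Fin.natAdd k ⟨i - k, by omega⟩ :=
          Fin.ext (by simp; omega)
        rw [this, mkBlock_natAdd, mkBlock_natAdd, Pi.add_apply, Pi.single_eq_of_ne, add_zero]
        intro h
        have := congrArg Fin.val h
        simp at this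
        omega
    have hlet : ∀ e : ZMod 2 × ZMod 2,
        (fwd (mkBlock (n := n) off σ q v (z + Pi.single j e))).getD (k + j) 0 = code (z j + e) := by
      intro e
      have hj := j.2
      have hc := code_lt (z j + e)
      have : (⟨k + j, by omega⟩ : Fin (k + M)) = Fin.natAdd k j := rfl
      rw [fwd, List.getD_eq_getElem _ _ (by simp), List.getElem_ofFn, this, mkBlock_natAdd]
      rw [Pi.add_apply, Pi.single_eq_same]
      exact Nat.mod_eq_of_lt (by omega)
    simp only [hF, hpre, hlet]
    have hsum : ∀ (s : Finset (ZMod 2 × ZMod 2)) (T : Tree (Fin (k + M) → Fin n) (List Prog × MState)),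
        ∑ e ∈ s, T.mean β (fun c => (hitValue n (code (z j + e)) c : ℝ)) =
        T.mean β fun c => ∑ e ∈ s, (hitValue n (code (z j + e)) c : ℝ) := by
      intro s T
      induction s using Finset.cons_induction with
      | empty => simp [Tree.mean_const hβ₁]
      | cons a s ha ih => simp only [Finset.sum_cons, ih, Tree.mean_add]
    rw [hsum]
    refine (Tree.mean_mono hβ₀ _ fun c => ?_).trans (Tree.mean_const hβ₁ _ 1).le
    exact sum_hitValue_le _ (fun a _ b _ h => add_left_cancel (code_injective h)) n c
  have hz : ∀ (q : Fin k → Fin N) (v : Fin k → Bool),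
      ∑ z : Syn M, F (mkBlock off σ q v z) ≤ 4 ^ M / 4 := by
    intro q v
    have h1 : ∑ e : ZMod 2 × ZMod 2, ∑ z : Syn M, F (mkBlock off σ q v (z + Pi.single j e)) =
        4 * ∑ z : Syn M, F (mkBlock off σ q v z) := by
      simp only [fun e => sum_add_eq (Pi.single j e) fun z => F (mkBlock off σ q v z)]
      simp
    rw [Finset.sum_comm] at h1
    have h2 : ∑ z : Syn M, ∑ e : ZMod 2 × ZMod 2, F (mkBlock off σ q v (z + Pi.single j e)) ≤
        ∑ z : Syn M, 1 := Finset.sum_le_sum fun z _ => key q v z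
    simp only [Finset.sum_const, Finset.card_univ, card_syn, nsmul_eq_mul, mul_one] at h2
    push_cast at h2
    linarith
  have hN' : (N : ℝ) ≠ 0 := by positivity
  rw [blockHit, sum_blockDist_mul]
  have hmain : ∑ z : Syn M, noise M 1 z * ∑ v : Fin k → Bool, (1 / 2 : ℝ) ^ k *
      ∑ q : Fin k → Fin N, (1 / (N : ℝ)) ^ k * F (mkBlock off σ q v (z + syn col v)) ≤ 1 / 4 := by
    have hnoise : ∀ z : Syn M, noise M 1 z = 1 / 4 ^ M := fun z => by simp [noise]
    simp only [hnoise]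
    have h3 : ∀ v : Fin k → Bool,
        ∑ z : Syn M, ∑ q : Fin k → Fin N, F (mkBlock off σ q v (z + syn col v)) ≤
          N ^ k * (4 ^ M / 4) := by
      intro v
      rw [Finset.sum_comm]
      refine (Finset.sum_le_sum fun q _ => ((sum_add_eq (syn col v) fun z =>
        F (mkBlock off σ q v z)).le.trans (hz q v))).trans (le_of_eq ?_)
      simp
    have h4 : ∑ v : Fin k → Bool, ∑ z : Syn M, ∑ q : Fin k → Fin N,
        F (mkBlock off σ q v (z + syn col v)) ≤ 2 ^ k * (N ^ k * (4 ^ M / 4)) :=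
      (Finset.sum_le_sum fun v _ => h3 v).trans (le_of_eq (by simp))
    have h5 : (0 : ℝ) ≤ 1 / 4 ^ M * ((1 / 2) ^ k * (1 / N) ^ k) := by positivity
    have h6 := mul_le_mul_of_nonneg_left h4 h5
    have h7 : (1 : ℝ) / 4 ^ M * ((1 / 2) ^ k * (1 / N) ^ k) * (2 ^ k * (N ^ k * (4 ^ M / 4))) =
        1 / 4 := by
      rw [div_pow, div_pow, one_pow]
      field_simp
    rw [h7] at h6
    calc _ = 1 / 4 ^ M * ((1 / 2) ^ k * (1 / N) ^ k) * ∑ v : Fin k → Bool, ∑ z : Syn M,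
          ∑ q : Fin k → Fin N, F (mkBlock off σ q v (z + syn col v)) := by
            simp only [Finset.mul_sum]
            rw [Finset.sum_comm]
            refine Finset.sum_congr rfl fun v _ => Finset.sum_congr rfl fun z _ =>
              Finset.sum_congr rfl fun q _ => ?_
            ring
      _ ≤ _ := h6
  have h0 := hF₁ fun _ => 0
  nlinarith

end TrialMean

end SeqPred

namespace SeqPred

/-! ### Prediction algorithms on infinite sequences -/

section Sequences

variable {n : ℕ}

/-- `p` halts within `t` steps and reads at most `s` outputs. -/
def Runs (p : Prog) (n t s : ℕ) : Prop :=
  ∀ (coins : Fin t → Bool) (u : Fin s → Fin n) (x : List (Fin n)),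
    (exec p (predEnv coins u x) n t).1 = [] ∧
    (exec p (predEnv coins u x) n t).2.pos .sample + (exec p (predEnv coins u x) n t).2.pos .past ≤ s

theorem exec_congr {p : Prog} {t s : ℕ} (h : Runs p n t s) (coins : Fin t → Bool)
    (u : Fin s → Fin n) (x : List (Fin n)) {env : Source → ℕ → ℕ}
    (hc : ∀ i : Fin t, env .coin i = (coins i).toNat) (hs : ∀ i : Fin s, env .sample i = u i)
    (hp : ∀ i < s, env .past i = (x.reverse.map Fin.val).getD i 0) :
    (step env)^[t] ([p], MState.init n) = exec p (predEnv coins u x) n t := by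
  have hr := (h coins u x).2
  refine iterate_congr fun src i hi => ?_
  change i < (exec p (predEnv coins u x) n t).2.pos src at hi
  rcases src with _ | _ | _
  · have hle := iterate_pos_le (predEnv coins u x) ([p], MState.init n) .coin t
    have hi' : i < t := by
      refine hi.trans_le (hle.trans (by simp [MState.init]))
    rw [hc ⟨i, hi'⟩]
    simp [predEnv, mkEnv, streamOf, hi']
  · have hi' : i < s := by omega
    rw [hs ⟨i, hi'⟩]
    simp [predEnv, mkEnv, streamOf, hi']
  · rw [hp i (by omega)]
    rfl

/-- The streams made of sequences of coins and of letters. -/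
def seqEnv (ω : ℕ → Bool) (X Y : ℕ → Fin n) : Source → ℕ → ℕ
  | .coin => fun i => (ω i).toNat
  | .sample => fun i => X i
  | .past => fun i => Y i

theorem iterate_seqEnv {p : Prog} {t s : ℕ} (h : Runs p n t s) (ω : ℕ → Bool) (X Y : ℕ → Fin n) :
    (step (seqEnv ω X Y))^[t] ([p], MState.init n) =
      exec p (predEnv (fun i : Fin t => ω i) (fun i : Fin s => X i)
        (List.ofFn fun i : Fin s => Y i).reverse) n t :=
  exec_congr h _ _ _ (fun _ => rfl) (fun _ => rfl) fun i hi => by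
    simp [seqEnv, hi]

/-- Whether the prediction is the letter `a`. -/
noncomputable def hitSeq (p : Prog) (t : ℕ) (ω : ℕ → Bool) (X Y : ℕ → Fin n) (a : ℕ) : ℝ :=
  hitValue n a ((step (seqEnv ω X Y))^[t] ([p], MState.init n))

theorem hitSeq_congr {p : Prog} {t s : ℕ} (h : Runs p n t s) (ω : ℕ → Bool) {X X' : ℕ → Fin n}
    (Y : ℕ → Fin n) (a : ℕ) (hX : ∀ i < s, X i = X' i) : hitSeq p t ω X Y a = hitSeq p t ω X' Y a := by
  rw [hitSeq, hitSeq, iterate_seqEnv h, iterate_seqEnv h]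
  have e : (fun i : Fin s => X i) = fun i : Fin s => X' i := funext fun i => hX i i.2
  rw [e]

open Classical in
/-- The predicted letter in a final configuration. -/
noncomputable def modeOf (n : ℕ) [NeZero n] (c : List Prog × MState) : Fin n :=
  if h : ∃ a : Fin n, IsArgmax n (fun i => (c.2.reg 0).getD i 0) a then h.choose else 0

variable [NeZero n]

theorem modeOf_spec (c : List Prog × MState) :
    IsArgmax n (fun i => (c.2.reg 0).getD i 0) (modeOf n c) := by
  obtain ⟨a, ha⟩ := exists_isArgmax (NeZero.pos n) fun i => (c.2.reg 0).getD i 0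
  have h : ∃ a : Fin n, IsArgmax n (fun i => (c.2.reg 0).getD i 0) a := ⟨⟨a, ha.1⟩, ha⟩
  rw [modeOf, dif_pos h]
  exact h.choose_spec

theorem hitValue_eq (a : Fin n) (c : List Prog × MState) :
    hitValue n a c = if modeOf n c = a then 1 else 0 := by
  unfold hitValue
  by_cases h : modeOf n c = a
  · rw [if_pos h, if_pos (h ▸ modeOf_spec c)]
  · rw [if_neg h, if_neg fun h' => h (Fin.ext ((modeOf_spec c).unique h'))]

/-- The predicted letter. -/
noncomputable def predLetter (p : Prog) {t s : ℕ} (coins : Fin t → Bool) (u : Fin s → Fin n)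
    (x : List (Fin n)) : Fin n :=
  modeOf n (exec p (predEnv coins u x) n t)

theorem isMode_predLetter (p : Prog) {t s : ℕ} (coins : Fin t → Bool) (u : Fin s → Fin n)
    (x : List (Fin n)) : IsMode (predictor p coins u x) (predLetter p coins u x) :=
  (isMode_ofWeights (fun i => ((exec p (predEnv coins u x) n t).2.reg 0).getD i 0) _).2
    (modeOf_spec _)

variable {K : ℕ} [NeZero K]

omit [NeZero n] in
theorem buf_fwd (x : ℕ → Fin K → Fin n) (i : ℕ) : buf fwd x [] 0 i = flat x i := by
  have h : i % K < K := Nat.mod_lt _ (NeZero.pos K)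
  simp only [buf, List.length_nil, Nat.not_lt_zero, if_false, Nat.sub_zero, zero_add, fwd, flat]
  rw [List.getD_eq_getElem _ _ (by simpa using h), List.getElem_ofFn]
  rfl

omit [NeZero n] in
theorem buf_bwd (b : Fin K → Fin n) (y : ℕ → Fin K → Fin n) {φ : ℕ} (hφ : φ ≤ K) (i : ℕ) :
    buf bwd y ((fwd b).take φ).reverse 0 i = past b φ y i := by
  have hlen : ((fwd b).take φ).reverse.length = φ := by simp [fwd, hφ]
  unfold buf past
  rw [hlen]
  split_ifs with h
  · have h2 : φ - 1 - i < K := by omega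
    rw [List.getD_eq_getElem _ _ (by omega), List.getElem_reverse, List.getElem_take]
    simp only [fwd, List.getElem_ofFn, ofNat_eq_mk h2]
    congr 3
    simp [hφ]
  · have h1 : (i - φ) % K < K := Nat.mod_lt _ (NeZero.pos K)
    have h2 : K - 1 - (i - φ) % K < K := by omega
    rw [zero_add, List.getD_eq_getElem _ _ (by rw [length_bwd]; exact h1), ofNat_eq_mk h2]
    simp [bwd, fwd, List.getElem_reverse]

-- Combines the lazy simulation with the guarantees of the algorithm: on infinite sequences it also
-- halts in time, and the number of blocks drawn in both directions is bounded by `s`.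
omit [NeZero n] in
theorem run_ptree_eq (p : Prog) {t s : ℕ} (h : Runs p n t s) (b : Fin K → Fin n) {φ : ℕ}
    (hφ : φ ≤ K) (ω : ℕ → Bool) (x y : ℕ → Fin K → Fin n) :
    ((ptree t ([p], MState.init n) [] ((fwd b).take φ).reverse).run ω x y ⟨0, 0, 0⟩).1 =
      (step (seqEnv ω (flat x) (past b φ y)))^[t] ([p], MState.init n) ∧
    ((ptree t ([p], MState.init n) [] ((fwd b).take φ).reverse).run ω x y ⟨0, 0, 0⟩).1.1 = [] ∧
    ((ptree t ([p], MState.init n) [] ((fwd b).take φ).reverse).run ω x y ⟨0, 0, 0⟩).2.c ≤ t ∧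
    ((ptree t ([p], MState.init n) [] ((fwd b).take φ).reverse).run ω x y ⟨0, 0, 0⟩).2.s +
      ((ptree t ([p], MState.init n) [] ((fwd b).take φ).reverse).run ω x y ⟨0, 0, 0⟩).2.p ≤ s := by
  obtain ⟨h1, h2, h3, h4⟩ := run_ptree (NeZero.pos K) (ω := ω) (x := x) (y := y)
    (env := seqEnv ω (flat x) (past b φ y)) t ([p], MState.init n) []
    ((fwd b).take φ).reverse ⟨0, 0, 0⟩ (fun i => by simp [seqEnv, MState.init])
    (fun i => by simp [seqEnv, MState.init, buf_fwd])
    (fun i => by simp only [seqEnv, MState.init, zero_add]; rw [buf_bwd b y hφ])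
  have hr := h (fun i => ω i) (fun i => flat x i) (List.ofFn fun i : Fin s => past b φ y i).reverse
  rw [← iterate_seqEnv h] at hr
  refine ⟨h1, by rw [h1]; exact hr.1, by simpa using h2, ?_⟩
  have hr2 := hr.2
  simp only [MState.init, zero_add, add_zero] at h3 h4 hr2 ⊢
  omega

omit [NeZero n] in
theorem Runs.predHalts {p : Prog} {t s : ℕ} (h : Runs p n t s) {φ : ℕ} (hφ : φ ≤ K) :
    PredHalts K n p t s φ := fun b ω x y =>
  ⟨(run_ptree_eq p h b hφ ω x y).2.1, (run_ptree_eq p h b hφ ω x y).2.2.2⟩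

variable {T : ℕ} {m : HMM T n} {μ : (Fin K → Fin n) → ℝ}

/-- The right side is free of `q`: for fixed coins and training data the chance of a hit is periodic
in time, once `s` past outputs exist. -/
theorem hit_predLetter (hμ : ∑ b, μ b = 1)
    (hm : ∀ b w, m.prob (List.ofFn b ++ w) = μ b * m.prob w) {p : Prog} {t s : ℕ}
    (h : Runs p n t s) (coins : Fin t → Bool) (u : Fin s → Fin n) {q : ℕ} (hq : s ≤ q) (φ : Fin K) :
    m.hit (predLetter p coins u) (K * q + φ) = ∑ b, μ b * streamMean μ s fun V =>
      hitSeq p t (extend coins) (extend u) (past b φ V) (b φ) := by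
  rw [HMM.hit_eq_past hμ hm (s := s) (L := s)
    (Φ := fun y => predLetter p coins u (List.ofFn fun i : Fin s => y i).reverse) ?_ ?_ hq le_rfl]
  · refine Finset.sum_congr rfl fun b _ => congrArg _ (streamMean_congr _ _ fun V => ?_)
    have e1 : (fun i : Fin t => extend coins i) = coins := by funext i; simp [extend]
    have e2 : (fun i : Fin s => extend u i) = u := by funext i; simp [extend]
    rw [hitSeq, iterate_seqEnv h, e1, e2, hitValue_eq]
    change _ = ((if predLetter p coins u (List.ofFn fun i : Fin s => past b φ V i).reverse = b φ
      then 1 else 0 : ℕ) : ℝ)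
    rw [Nat.cast_ite, Nat.cast_one, Nat.cast_zero]
  · intro y y' hy
    have e : (fun i : Fin s => y i) = fun i : Fin s => y' i := funext fun i => hy i i.2
    simp only [e]
  · intro x y hx hy
    simp only [predLetter]
    congr 1
    symm
    refine exec_congr h _ _ _ ?_ ?_ ?_
    · intro i
      simp [predEnv, mkEnv, streamOf]
    · intro i
      simp [predEnv, mkEnv, streamOf]
    · intro i hi
      have e : (List.ofFn fun i : Fin s => y i).getD i (y 0) = y i := by
        rw [List.getD_eq_getElem _ _ (by simpa using hi), List.getElem_ofFn]
      simp only [predEnv, mkEnv, streamOf, List.getD_eq_getElem?_getD, List.getElem?_map, hy i hi]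
      simp [hi]

/-- On average over the coins and the training sequence, a letter is predicted correctly with the
probability that is determined by a computation with random blocks. -/
theorem sum_hit_predLetter (hμ : ∑ b, μ b = 1)
    (hm : ∀ b w, m.prob (List.ofFn b ++ w) = μ b * m.prob w) {p : Prog} {t s : ℕ}
    (h : Runs p n t s) (φ : Fin K) :
    ∑ coins : Fin t → Bool, ∑ u : Fin s → Fin n, (1 / 2 : ℝ) ^ t * m.prob (List.ofFn u) *
        m.hit (predLetter p coins u) (K * s + φ) =
      ∑ b, μ b * (ptree t ([p], MState.init n) [] ((fwd b).take φ).reverse).mean μ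
        fun c => (hitValue n (b φ) c : ℝ) := by
  have h1 : ∀ b : Fin K → Fin n,
      (ptree t ([p], MState.init n) [] ((fwd b).take φ).reverse).mean μ
        (fun c => (hitValue n (b φ) c : ℝ)) = streamMean fair t fun ω => streamMean μ s fun x =>
          streamMean μ s fun y => hitSeq p t ω (flat x) (past b φ y) (b φ) := by
    intro b
    rw [Tree.mean_eq_streamMean hμ _ _ t s s fun ω x y => ?_]
    · simp only [hitSeq, (run_ptree_eq p h b φ.2.le _ _ _).1]
    · obtain ⟨-, -, h2, h3⟩ := run_ptree_eq p h b φ.2.le ω x y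
      exact ⟨h2, by omega, by omega⟩
  have h2 : ∀ ω : ℕ → Bool, (streamMean μ s fun x => ∑ b, μ b * streamMean μ s fun y =>
      hitSeq p t ω (flat x) (past b φ y) (b φ)) = ∑ u : Fin s → Fin n, m.prob (List.ofFn u) *
        ∑ b, μ b * streamMean μ s fun y => hitSeq p t ω (extend u) (past b φ y) (b φ) := by
    intro ω
    refine streamMean_flat_of_le hm (Nat.le_mul_of_pos_left s (NeZero.pos K))
      (fun X => ∑ b, μ b * streamMean μ s fun y => hitSeq p t ω X (past b φ y) (b φ)) ?_
    intro X X' hX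
    refine Finset.sum_congr rfl fun b _ => congrArg _ (streamMean_congr _ _ fun V => ?_)
    exact hitSeq_congr h ω _ _ hX
  simp only [h1]
  rw [← streamMean_sum fair t Finset.univ μ]
  have h3 : ∀ ω : ℕ → Bool, (∑ b, μ b * streamMean μ s fun x => streamMean μ s fun y =>
      hitSeq p t ω (flat x) (past b φ y) (b φ)) = ∑ u : Fin s → Fin n, m.prob (List.ofFn u) *
        ∑ b, μ b * streamMean μ s fun y => hitSeq p t ω (extend u) (past b φ y) (b φ) := by
    intro ω
    rw [← h2, streamMean_sum μ s Finset.univ μ]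
  simp only [h3]
  rw [streamMean_eq_sum fair]
  refine Finset.sum_congr rfl fun coins _ => ?_
  rw [Finset.mul_sum]
  refine Finset.sum_congr rfl fun u _ => ?_
  rw [hit_predLetter hμ hm h coins u le_rfl]
  simp only [fair, Finset.prod_const, Finset.card_univ, Fintype.card_fin, mul_assoc]

end Sequences

/-! ### Small errors and correct predictions -/

section Noiseless

variable {k M N n : ℕ} [NeZero n]

/-- The values of the literals of a block, from their letters. -/
def decode (off : ℕ) (σ : Fin N → Fin k → Bool) (b : Fin (k + M) → Fin n) : Fin k → Bool :=
  fun i => if h : ((b (Fin.castAdd M i) : ℕ) - off) / 2 / k < N then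
    xor (decide (((b (Fin.castAdd M i) : ℕ) - off) % 2 = 1)) (σ ⟨_, h⟩ i) else false

/-- Whoever knows the table recovers the values of the literals, and hence the syndrome. This is the
advantage of the reference predictor. -/
theorem decode_mkBlock {off : ℕ} (hn : off + 2 * (k * N) ≤ n) (σ : Fin N → Fin k → Bool)
    (q : Fin k → Fin N) (v : Fin k → Bool) (z : Syn M) :
    decode off σ (mkBlock (n := n) off σ q v z) = v := by
  funext i
  have hk : 0 < k := i.pos
  have hle : k * (q i : ℕ) + i < k * N := by
    have h1 : k * ((q i : ℕ) + 1) ≤ k * N := Nat.mul_le_mul_left k (q i).2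
    have h2 := i.2
    rw [Nat.mul_add] at h1
    omega
  have hb := Bool.toNat_le (xor (v i) (σ (q i) i))
  have e1 : ((mkBlock (n := n) off σ q v z (Fin.castAdd M i) : Fin n) : ℕ) =
      off + 2 * (k * q i + i) + (xor (v i) (σ (q i) i)).toNat := by
    rw [mkBlock_castAdd, lit]
    exact Nat.mod_eq_of_lt (by omega)
  have e2 : ((mkBlock (n := n) off σ q v z (Fin.castAdd M i) : Fin n) : ℕ) - off =
      2 * (k * q i + i) + (xor (v i) (σ (q i) i)).toNat := by omega
  have e3 : (2 * (k * (q i : ℕ) + i) + (xor (v i) (σ (q i) i)).toNat) / 2 = k * q i + i := by omega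
  have e4 : (k * (q i : ℕ) + i) / k = q i := by
    rw [Nat.mul_add_div hk, Nat.div_eq_of_lt i.2, add_zero]
  have e5 : decide ((2 * (k * (q i : ℕ) + i) + (xor (v i) (σ (q i) i)).toNat) % 2 = 1) =
      xor (v i) (σ (q i) i) := by
    cases xor (v i) (σ (q i) i) <;> simp
  simp only [decode, e2, e3, e4, e5, (q i).2, dif_pos, Fin.eta]
  simp

variable {off : ℕ} {η θ : ℝ}

/-- The letters which are determined by the literals are mostly the right ones. -/
theorem sum_decode_ge (hη₀ : 0 ≤ η) (hη₁ : η ≤ 1) (hθ₀ : 0 ≤ θ) (hθ₁ : θ ≤ 1) (hN : 0 < N)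
    (hn : off + 2 * (k * N) ≤ n) (col : Fin k → Syn M) (σ : Fin N → Fin k → Bool) (j : Fin M) :
    1 - (η + θ) ≤ ∑ b : Fin (k + M) → Fin n, blockDist col off η θ σ b *
      if (Fin.ofNat n (code (syn col (decode off σ b) j))) = b (Fin.natAdd k j) then 1 else 0 := by
  have hN' : (N : ℝ) ≠ 0 := by positivity
  rw [sum_blockDist_mul]
  have h1 : 1 - η ≤ ∑ z : Syn M, noise M η z * ∑ v : Fin k → Bool, (1 / 2 : ℝ) ^ k *
      ∑ q : Fin k → Fin N, (1 / (N : ℝ)) ^ k *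
        if (Fin.ofNat n (code (syn col (decode off σ
          (mkBlock (n := n) off σ q v (z + syn col v))) j))) =
          mkBlock off σ q v (z + syn col v) (Fin.natAdd k j) then 1 else 0 := by
    have h0 : ∀ z ∈ (Finset.univ : Finset (Syn M)), 0 ≤ noise M η z * ∑ v : Fin k → Bool,
        (1 / 2 : ℝ) ^ k * ∑ q : Fin k → Fin N, (1 / (N : ℝ)) ^ k *
        if (Fin.ofNat n (code (syn col (decode off σ
          (mkBlock (n := n) off σ q v (z + syn col v))) j))) =
          mkBlock off σ q v (z + syn col v) (Fin.natAdd k j) then 1 else 0 := fun z _ =>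
      mul_nonneg (noise_nonneg hη₀ hη₁ z) (Finset.sum_nonneg fun v _ => mul_nonneg (by positivity)
        (Finset.sum_nonneg fun q _ => mul_nonneg (by positivity) (by split_ifs <;> norm_num)))
    -- Only the noiseless case is counted, where the decoded syndrome is certainly the one
    -- displayed; it has probability at least `1 - η`.
    refine le_trans ?_ (Finset.single_le_sum h0 (Finset.mem_univ 0))
    simp only [zero_add, decode_mkBlock hn, mkBlock_natAdd, if_true, mul_one]
    have h2 : ∑ q : Fin k → Fin N, (1 / (N : ℝ)) ^ k = 1 := by
      simp only [Finset.sum_const, Finset.card_univ, Fintype.card_fun, Fintype.card_fin, one_div,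
        inv_pow, nsmul_eq_mul, Nat.cast_pow]
      exact mul_inv_cancel₀ (by positivity)
    have h3 : ∑ v : Fin k → Bool, (1 / 2 : ℝ) ^ k = 1 := by simp
    simp only [h2, mul_one, h3, noise]
    have : 0 ≤ η * (1 / 4 ^ M) := by positivity
    simp
    positivity
  have h2 : 0 ≤ θ * (if (Fin.ofNat n (code (syn col (decode off σ (fun _ : Fin (k + M) => (0 : Fin n))) j)))
      = (0 : Fin n) then (1 : ℝ) else 0) := mul_nonneg hθ₀ (by split_ifs <;> norm_num)
  have h3 := mul_le_mul_of_nonneg_left h1 (sub_nonneg.2 hθ₁)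
  nlinarith

variable [NeZero (k + M)] {T : ℕ} {m : HMM T n}

/-- Only the errors at the syndrome letters are used. Against the reference predictor, which fails
with probability at most `η + θ`, each one is at least `2/3 (1 - H j) - 6 (η + θ)`, and together
they are at most `(k + M) ε`. Solving for the hits gives the factors `9` and `3/2`. -/
theorem sum_hit_ge_of_avgError_lt (hη₀ : 0 ≤ η) (hη₁ : η ≤ 1) (hθ₀ : 0 ≤ θ) (hθ₁ : θ ≤ 1)
    (hN : 0 < N) (hn : off + 2 * (k * N) ≤ n) (col : Fin k → Syn M) (σ : Fin N → Fin k → Bool)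
    (hm : ∀ b w, m.prob (List.ofFn b ++ w) = blockDist col off η θ σ b * m.prob w)
    {p : Prog} {t s : ℕ} (h : Runs p n t s) (coins : Fin t → Bool) (u : Fin s → Fin n) (L : Loss)
    {ε : ℝ} (hε : 0 < ε) (hA : avgError L m (predictor p coins u) s < ENNReal.ofReal ε) :
    M * (1 - 9 * (η + θ)) - 3 / 2 * ((k + M : ℕ) * ε) ≤
      ∑ j : Fin M, m.hit (predLetter p coins u) ((k + M) * s + Fin.natAdd k j) := by
  have hμ := sum_blockDist (n := n) col off η θ hN σ
  set H : Fin M → ℝ := fun j => m.hit (predLetter p coins u) ((k + M) * s + Fin.natAdd k j) with hH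
  have key : ∀ q, s ≤ q → ∀ j : Fin M, ENNReal.ofReal (2 / 3 * (1 - H j) - 6 * (η + θ)) ≤
      errorAt L m (predictor p coins u) ((k + M) * q + (k + j)) := by
    intro q hq j
    have h1 := errorAt_ge L m (A := predictor p coins u) (fun x => ofWeights_nonneg _)
      (fun x => sum_ofWeights (NeZero.pos n) _) (isMode_predLetter p coins u)
      (fun x => Fin.ofNat n (code (syn col (decode off σ
        fun i : Fin (k + M) => x.getD ((k + M) * q + i) 0) j)))
      ((k + M) * q + (Fin.natAdd k j : Fin (k + M)))
    rw [HMM.hit_eq_block hμ hm (Fin.natAdd k j)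
        (fun b => Fin.ofNat n (code (syn col (decode off σ b) j))) ?_ q,
      hit_predLetter hμ hm h coins u hq, ← hit_predLetter hμ hm h coins u le_rfl] at h1
    · refine le_trans (ENNReal.ofReal_le_ofReal ?_) h1
      have := sum_decode_ge hη₀ hη₁ hθ₀ hθ₁ hN hn col σ j
      simp only [hH]
      linarith
    · intro b b' hb
      have : decode off σ b = decode off σ b' := by
        funext i
        have := hb (Fin.castAdd M i) (by rw [Fin.lt_def]; simp; omega)
        simp only [decode, this]
      simp only [this]
  have hS : ∀ q, s ≤ q → ENNReal.ofReal (∑ j : Fin M, (2 / 3 * (1 - H j) - 6 * (η + θ))) ≤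
      ∑ φ ∈ Finset.range (k + M), errorAt L m (predictor p coins u) ((k + M) * q + φ) := by
    intro q hq
    have h1 : ENNReal.ofReal (∑ j : Fin M, (2 / 3 * (1 - H j) - 6 * (η + θ))) ≤
        ∑ j : Fin M, ENNReal.ofReal (2 / 3 * (1 - H j) - 6 * (η + θ)) := by
      induction (Finset.univ : Finset (Fin M)) using Finset.cons_induction with
      | empty => simp
      | cons a S ha ih =>
        rw [Finset.sum_cons, Finset.sum_cons]
        exact ENNReal.ofReal_add_le.trans (by gcongr)
    refine h1.trans ((Finset.sum_le_sum fun j _ => key q hq j).trans ?_)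
    rw [Finset.sum_range_add, Finset.sum_range
      (fun j => errorAt L m (predictor p coins u) ((k + M) * q + (k + j)))]
    exact le_add_self
  have := le_of_avgError_lt L m _ hε hS hA
  rw [Finset.sum_sub_distrib, ← Finset.mul_sum, Finset.sum_sub_distrib] at this
  simp only [Finset.sum_const, Finset.card_univ, Fintype.card_fin, nsmul_eq_mul, mul_one] at this
  linarith

-- Good coins and training data contribute the bound of `sum_hit_ge_of_avgError_lt`, the others at
-- least zero; the average of the hits is what a trial with generated blocks measures.
open Classical in
theorem success_mul_le (hη₀ : 0 ≤ η) (hη₁ : η ≤ 1) (hθ₀ : 0 ≤ θ) (hθ₁ : θ ≤ 1)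
    (hN : 0 < N) (hn : off + 2 * (k * N) ≤ n) (col : Fin k → Syn M) (σ : Fin N → Fin k → Bool)
    (hm : ∀ b w, m.prob (List.ofFn b ++ w) = blockDist col off η θ σ b * m.prob w)
    {p : Prog} {t s : ℕ} (h : Runs p n t s) (L : Loss) {ε : ℝ} (hε : 0 < ε) :
    (∑ coins : Fin t → Bool, ∑ u : Fin s → Fin n, (1 / 2 : ℝ) ^ t * m.prob (List.ofFn u) *
      if avgError L m (predictor p coins u) s < ENNReal.ofReal ε then 1 else 0) *
        (M * (1 - 9 * (η + θ)) - 3 / 2 * ((k + M : ℕ) * ε)) ≤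
      ∑ j : Fin M, blockHit (n := n) col off η θ p t (k + j) σ := by
  have hμ := sum_blockDist (n := n) col off η θ hN σ
  have e : ∀ j : Fin M, blockHit (n := n) col off η θ p t (k + j) σ =
      ∑ coins : Fin t → Bool, ∑ u : Fin s → Fin n, (1 / 2 : ℝ) ^ t * m.prob (List.ofFn u) *
        m.hit (predLetter p coins u) ((k + M) * s + Fin.natAdd k j) := by
    intro j
    rw [sum_hit_predLetter hμ hm h (Fin.natAdd k j), blockHit]
    refine Finset.sum_congr rfl fun b _ => ?_
    have e1 : (fwd b).getD (k + j) 0 = b (Fin.natAdd k j) := by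
      rw [fwd, List.getD_eq_getElem _ _ (by simp), List.getElem_ofFn]
      rfl
    rw [e1]
    rfl
  simp only [e]
  rw [Finset.sum_comm (s := (Finset.univ : Finset (Fin M))), Finset.sum_mul]
  refine Finset.sum_le_sum fun coins _ => ?_
  rw [Finset.sum_comm (s := (Finset.univ : Finset (Fin M))), Finset.sum_mul]
  refine Finset.sum_le_sum fun u _ => ?_
  rw [← Finset.mul_sum, mul_assoc]
  refine mul_le_mul_of_nonneg_left ?_ (mul_nonneg (by positivity) (m.prob_nonneg _))
  split_ifs with hA
  · rw [one_mul]
    exact sum_hit_ge_of_avgError_lt hη₀ hη₁ hθ₀ hθ₁ hN hn col σ hm h coins u L hε hA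
  · rw [zero_mul]
    exact Finset.sum_nonneg fun j _ => Finset.sum_nonneg fun x _ => m.prob_nonneg _

end Noiseless

end SeqPred

namespace SeqPred

/-! ### A good prediction algorithm distinguishes -/

theorem sum_range_mul_mod (f : ℕ → ℝ) (R M : ℕ) :
    ∑ i ∈ Finset.range (R * M), f (i % M) = R * ∑ j ∈ Finset.range M, f j := by
  induction R with
  | zero => simp
  | succ R ih =>
    rw [Nat.succ_mul, Finset.sum_range_add, ih, Nat.cast_succ, add_mul, one_mul]
    congr 1
    refine Finset.sum_congr rfl fun j hj => ?_
    rw [mul_comm, Nat.mul_add_mod, Nat.mod_eq_of_lt (Finset.mem_range.1 hj)]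

theorem sum_table_weights (k N : ℕ) :
    ∑ _τ : Fin N → Fin k → Bool, ((1 / 2 : ℝ) ^ k) ^ N = 1 := by
  simp only [Finset.sum_const, Finset.card_univ, Fintype.card_fun, Fintype.card_fin,
    Fintype.card_bool, nsmul_eq_mul, Nat.cast_pow, Nat.cast_ofNat]
  rw [← mul_pow, ← mul_pow]
  norm_num

section Distinguish

variable {k M N n off B d : ℕ} [NeZero n] {col : Fin k → Syn M}

-- The uniform case is the planted one at noise rate one, so a single analysis of the generator
-- covers both.
omit [NeZero n] in
theorem uniformClause_eq_noisyPlanted (Q : (Fin k → Bool) → ℝ) (σ : Fin n → Bool) :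
    uniformClause k n = noisyPlanted Q 1 σ := by
  funext C
  simp [noisyPlanted]

theorem mean_trialTree_sq_le
    (hcol : ∀ u ≠ 0, d < (Finset.univ.filter fun i => pr u (col i) ≠ 0).card)
    (hkn : k ≤ n) {η : ℝ} (hη₀ : 0 ≤ η) (hη₁ : η ≤ 1) (σ : Fin n → Bool) (p : Prog) (t φ : ℕ) :
    (trialTree col off N B p t φ).mean (noisyPlanted (codeDist col) η σ)
      (fun h => (h : ℝ) ^ 2) ≤ 1 := by
  have h0 := noisyPlanted_nonneg (n := n) hcol hη₀ hη₁ σ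
  have h1 := sum_noisyPlanted hcol hkn η σ
  simp only [trialTree, Tree.mean_bind, Tree.mean]
  refine (Tree.mean_mono h0 _ fun τ => ?_).trans (Tree.mean_const h1 _ 1).le
  refine (Tree.mean_mono h0 _ fun b => ?_).trans (Tree.mean_const h1 _ 1).le
  refine (Tree.mean_mono h0 _ fun c => ?_).trans (Tree.mean_const h1 _ 1).le
  have : (hitValue n ((fwd b).getD φ 0) c : ℝ) ≤ 1 := by exact_mod_cast hitValue_le_one _ _ c
  exact pow_le_one₀ (Nat.cast_nonneg _) this

/-- Trial number `i` tests the syndrome letter `i % M`, so `R * M` trials test each of them `R`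
times, and the variance of the count is at most the number of trials. -/
theorem mean_countTree_sq_le
    (hcol : ∀ u ≠ 0, d < (Finset.univ.filter fun i => pr u (col i) ≠ 0).card)
    (hN : 0 < N) (hn : k * N ≤ n) (hkn : k ≤ n) {η : ℝ} (hη₀ : 0 ≤ η) (hη₁ : η ≤ 1)
    (σ : Fin n → Bool) (p : Prog) (t R : ℕ) :
    (countTree col off N B p t (R * M)).mean (noisyPlanted (codeDist col) η σ)
      (fun a => ((a : ℝ) - R * ∑ τ : Fin N → Fin k → Bool, ((1 / 2) ^ k) ^ N *
        ∑ j : Fin M, blockHit (n := n) col off η ((1 - acceptProb k N n) ^ B) p t (k + j) τ) ^ 2) ≤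
      R * M := by
  have h := sumTree_mean_sq_le (sum_noisyPlanted hcol hkn η σ)
    (noisyPlanted_nonneg (n := n) hcol hη₀ hη₁ σ)
    (fun i => trialTree col off N B p t (k + i % M))
    (fun i => (fun j => ∑ τ : Fin N → Fin k → Bool, ((1 / 2) ^ k) ^ N *
        blockHit (n := n) col off η ((1 - acceptProb k N n) ^ B) p t (k + j) τ) (i % M)) (R * M)
    (fun i _ => mean_trialTree hcol hN hn hkn η σ off B p t _)
    (fun i _ => mean_trialTree_sq_le hcol hkn hη₀ hη₁ σ p t _)
  have e := sum_range_mul_mod (fun j => ∑ τ : Fin N → Fin k → Bool, ((1 / 2) ^ k) ^ N *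
    blockHit (n := n) col off η ((1 - acceptProb k N n) ^ B) p t (k + j) τ) R M
  beta_reduce at h e
  rw [e, Finset.sum_range, Finset.sum_comm] at h
  simp only [← Finset.mul_sum, Nat.cast_mul] at h ⊢
  exact h

/-- Of `4000 M` trials, on average at most `1002 M` succeed for uniform clauses and at least `1240
M` for planted ones. The threshold `1120 M` is at distance `118 M` or more from both ranges, and
since the variance is at most `4000 M`, Chebyshev's inequality keeps either error below `1/3`. -/
theorem distinguishes_mainProg [Inhabited (Clause k n)]
    (hcol : ∀ u ≠ 0, d < (Finset.univ.filter fun i => pr u (col i) ≠ 0).card)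
    (hM : 0 < M) (hN : 0 < N) (hoff : off < 2 * k) (hn : n = off + 2 * (k * N)) (hn4 : 4 ≤ n)
    {p : Prog} {t S t' s' : ℕ} [NeZero (k + M)] (hp : Runs p n t S) {θ : ℝ}
    (hθ : θ = (1 - acceptProb k N n) ^ B) (hθ₀ : 0 ≤ θ) (hθ₁ : θ ≤ 1 / 2000)
    (hmean : 31 / 100 * (M : ℝ) ≤ ∑ τ : Fin N → Fin k → Bool, ((1 / 2) ^ k) ^ N *
      ∑ j : Fin M, blockHit (n := n) col off (1 / 2000) θ p t (k + j) τ)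
    (ht' : 4000 * M * (trialCost k M n B t + 5) + 8 ≤ t')
    (hs' : 4000 * M * (B * (S + 1)) ≤ s') :
    Distinguishes (mainProg col B p (4000 * M) (1120 * M)) (codeDist col) (1 / 2000) n t' s' := by
  subst hθ
  have hpred : ∀ φ < k + M, PredHalts (k + M) n p t S φ := fun φ hφ => hp.predHalts hφ.le
  have hkN : k * N ≤ n := by omega
  have hkn : k ≤ n := (Nat.le_mul_of_pos_right k hN).trans hkN
  have hM' : (1 : ℝ) ≤ M := by exact_mod_cast hM
  have he := exec_main hoff hn hn4 hM col hpred (1120 * M) ht' hs'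
  refine ⟨fun coins Cs => (he coins Cs fun _ => default).1,
    fun coins Cs => (he coins Cs fun _ => default).2.1, ?_, fun σ => ?_⟩
  · rw [uniformClause_eq_noisyPlanted (codeDist col) fun _ => false]
    have h0 := noisyPlanted_nonneg (n := n) hcol zero_le_one le_rfl fun _ => false
    rw [plantedProb_main hoff hn hn4 hM col hpred (1120 * M) ht' hs'
      (sum_noisyPlanted hcol hkn 1 _)]
    have hb : ∑ τ : Fin N → Fin k → Bool, ((1 / 2 : ℝ) ^ k) ^ N *
        ∑ j : Fin M, blockHit (n := n) col off 1 ((1 - acceptProb k N n) ^ B) p t (k + j) τ ≤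
        M * (1 / 4 + 1 / 2000) := by
      calc _ ≤ ∑ τ : Fin N → Fin k → Bool, ((1 / 2 : ℝ) ^ k) ^ N * (M * (1 / 4 + 1 / 2000)) := by
            refine Finset.sum_le_sum fun τ _ => mul_le_mul_of_nonneg_left ?_ (by positivity)
            refine (Finset.sum_le_sum fun j _ => (blockHit_one_le hN hn4 off hθ₀
              (hθ₁.trans (by norm_num)) p t j τ).trans (add_le_add_right hθ₁ _)).trans ?_
            simp only [Finset.sum_const, Finset.card_univ, Fintype.card_fin, nsmul_eq_mul]
            exact le_rfl
        _ = _ := by rw [← Finset.sum_mul, sum_table_weights, one_mul]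
    have h := Tree.mean_indicator_le h0 (countTree col off N B p t (4000 * M))
      (fun a => 1120 * M < a) (g := 4000 * M * (295 / 10000)) (by positivity)
      (mean_countTree_sq_le hcol hN hkN hkn zero_le_one le_rfl (fun _ => false) p t 4000) ?_
    · refine le_trans ?_ (sub_le_sub_left h 1)
      rw [le_sub_comm, div_le_iff₀ (by positivity)]
      push_cast
      nlinarith
    · intro a ha
      have ha' : (1120 * M : ℝ) ≤ a := by exact_mod_cast ha.le
      refine le_trans ?_ (le_abs_self _)
      push_cast
      linarith
  · have h0 := noisyPlanted_nonneg (n := n) hcol (η := 1 / 2000) (by norm_num) (by norm_num) σ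
    have h1 := sum_noisyPlanted (n := n) hcol hkn (1 / 2000) σ
    rw [plantedProb_main hoff hn hn4 hM col hpred (1120 * M) ht' hs' h1]
    have h := Tree.mean_indicator_le h0 (countTree col off N B p t (4000 * M))
      (fun a => ¬ 1120 * M < a) (g := 4000 * M * (3 / 100)) (by positivity)
      (mean_countTree_sq_le hcol hN hkN hkn (by norm_num) (by norm_num) σ p t 4000) ?_
    · have hsum : (countTree col off N B p t (4000 * M)).mean
            (noisyPlanted (codeDist col) (1 / 2000) σ) (fun a => if 1120 * M < a then 1 else 0) +
          (countTree col off N B p t (4000 * M)).mean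
            (noisyPlanted (codeDist col) (1 / 2000) σ) (fun a => if ¬ 1120 * M < a then 1 else 0) =
          1 := by
        rw [← Tree.mean_add]
        refine Eq.trans ?_ (Tree.mean_const h1 (countTree col off N B p t (4000 * M)) 1)
        congr 1
        funext a
        by_cases ha : 1120 * M < a <;> simp [ha]
      have h2 : (4000 : ℕ) * (M : ℝ) / (4000 * M * (3 / 100)) ^ 2 ≤ 1 / 3 := by
        rw [div_le_iff₀ (by positivity)]
        push_cast
        nlinarith
      linarith
    · intro a ha
      have ha' : (a : ℝ) ≤ 1120 * M := by exact_mod_cast not_lt.1 ha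
      rw [abs_sub_comm]
      refine le_trans ?_ (le_abs_self _)
      push_cast
      linarith

-- The success probability over a random table, training sequence and coins is turned into a mean
-- number of hits.
open Classical in
theorem le_sum_blockHit_of_success [NeZero (k + M)] {T : ℕ} {m : (Fin N → Fin k → Bool) → HMM T n}
    {θ : ℝ} (hθ₀ : 0 ≤ θ) (hθ₁ : θ ≤ 1 / 2000) (hN : 0 < N) (hn : off + 2 * (k * N) ≤ n)
    (hm : ∀ σ b w, (m σ).prob (List.ofFn b ++ w) =
      blockDist col off (1 / 2000) θ σ b * (m σ).prob w)
    {p : Prog} {t s : ℕ} (h : Runs p n t s) (L : Loss) {ε : ℝ} (hε : 0 < ε)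
    (hKε : (k + M : ℕ) * ε ≤ 35 / 100 * M)
    (hsucc : 2 / 3 < ∑ σ, ((1 / 2) ^ k) ^ N * ∑ coins : Fin t → Bool, ∑ u : Fin s → Fin n,
      (1 / 2 : ℝ) ^ t * (m σ).prob (List.ofFn u) *
        if avgError L (m σ) (predictor p coins u) s < ENNReal.ofReal ε then 1 else 0) :
    31 / 100 * (M : ℝ) ≤ ∑ τ : Fin N → Fin k → Bool, ((1 / 2) ^ k) ^ N *
      ∑ j : Fin M, blockHit (n := n) col off (1 / 2000) θ p t (k + j) τ := by
  have h1 := Finset.sum_le_sum fun (σ : Fin N → Fin k → Bool) (_ : σ ∈ Finset.univ) =>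
    mul_le_mul_of_nonneg_left (success_mul_le (by norm_num) (by norm_num) hθ₀
      (hθ₁.trans (by norm_num)) hN hn col σ (hm σ) h L hε)
      (by positivity : (0 : ℝ) ≤ ((1 / 2) ^ k) ^ N)
  refine le_trans ?_ h1
  simp only [← mul_assoc]
  rw [← Finset.sum_mul]
  simp only [mul_assoc] at hsucc ⊢
  -- Here `1 - 9 / 1000 - 3/2 * 0.35 = 0.466`, and two thirds of this exceed `0.31`.
  have hA : 466 / 1000 * (M : ℝ) ≤
      M * (1 - 9 * (1 / 2000 + θ)) - 3 / 2 * ((k + M : ℕ) * ε) := by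
    nlinarith [Nat.cast_nonneg (α := ℝ) M]
  have hM : (0 : ℝ) ≤ M := Nat.cast_nonneg M
  nlinarith [mul_le_mul hsucc.le hA (by positivity) (by linarith)]

end Distinguish

end SeqPred

namespace SeqPred

/-! ### Bounds for the acceptance probability -/

theorem acceptProb_nonneg (k N n : ℕ) : 0 ≤ acceptProb k N n := by
  unfold acceptProb
  positivity

/-- From `k * N ≤ n` one gets `N ≤ n + 1 - k`, the smallest factor of the descending factorial. -/
theorem acceptProb_le_one {k N n : ℕ} (hN : 0 < N) (h : k * N ≤ n) : acceptProb k N n ≤ 1 := by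
  unfold acceptProb
  rw [Fintype.card_embedding_eq, Fintype.card_fin, Fintype.card_fin]
  refine div_le_one_of_le₀ ?_ (Nat.cast_nonneg _)
  rcases Nat.eq_zero_or_pos k with rfl | hk
  · simp
  have h1 : N ≤ n + 1 - k := by
    have : k + N ≤ k * N + 1 := by nlinarith
    omega
  exact_mod_cast (Nat.pow_le_pow_left h1 k).trans (Nat.pow_sub_le_descFactorial n k)

/-- Rounding loses at most a factor two, so `n ≤ 4 k N`. The bound does not involve `n`, so a
constant number `B` of attempts is enough. -/
theorem le_acceptProb {k n : ℕ} (hk : 0 < k) (h : 2 * k ≤ n) :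
    (1 / (4 * k : ℝ)) ^ k ≤ acceptProb k (n / (2 * k)) n := by
  unfold acceptProb
  rw [Fintype.card_embedding_eq, Fintype.card_fin, Fintype.card_fin]
  have hpos : 0 < n.descFactorial k := Nat.descFactorial_pos.2 (by omega)
  rw [le_div_iff₀ (by exact_mod_cast hpos)]
  have h1 : n ≤ 4 * k * (n / (2 * k)) := by
    have h2 := Nat.div_add_mod n (2 * k)
    have h3 := Nat.mod_lt n (by omega : 0 < 2 * k)
    have h4 : 1 ≤ n / (2 * k) := (Nat.one_le_div_iff (by omega)).2 h
    nlinarith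
  calc (1 / (4 * k : ℝ)) ^ k * n.descFactorial k
      ≤ (1 / (4 * k : ℝ)) ^ k * (4 * k * (n / (2 * k) : ℕ)) ^ k := by
        refine mul_le_mul_of_nonneg_left ?_ (by positivity)
        exact_mod_cast (Nat.descFactorial_le_pow n k).trans (Nat.pow_le_pow_left h1 k)
    _ = _ := by
        rw [← mul_pow, ← mul_assoc, one_div_mul_cancel (by positivity), one_mul]

/-! ### The family of hidden Markov models -/

/-- The hidden Markov model which outputs the same letter for ever. -/
noncomputable def constHMM (T n : ℕ) [NeZero T] [NeZero n] : HMM T n where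
  init := pt 0
  trans _ := pt 0
  emit _ := pt 0
  init_nonneg := pt_nonneg _
  trans_nonneg _ := pt_nonneg _
  emit_nonneg _ := pt_nonneg _
  init_sum := by simp [pt]
  trans_sum _ := by simp [pt]
  emit_sum _ := by simp [pt]

section Family

variable {k M T d : ℕ} (col : Fin k → Syn M) (B : ℕ)

/-- The probability of a default block. -/
noncomputable def defaultProb (k B n : ℕ) : ℝ := (1 - acceptProb k (n / (2 * k)) n) ^ B

variable {B} in
theorem one_sub_acceptProb_nonneg {n : ℕ} (h : 0 < n / (2 * k)) :
    0 ≤ 1 - acceptProb k (n / (2 * k)) n := by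
  refine sub_nonneg.2 (acceptProb_le_one h ?_)
  have := Nat.div_mul_le_self n (2 * k)
  nlinarith

theorem defaultProb_nonneg {n : ℕ} (h : 0 < n / (2 * k)) : 0 ≤ defaultProb k B n :=
  pow_nonneg (one_sub_acceptProb_nonneg h) B

theorem defaultProb_le_one {n : ℕ} (h : 0 < n / (2 * k)) : defaultProb k B n ≤ 1 :=
  pow_le_one₀ (one_sub_acceptProb_nonneg h) (sub_le_self _ (acceptProb_nonneg _ _ _))

/-- The family of the block models for all tables of signs. -/
noncomputable def blockFamily (hk : 0 < k) (hT : Fintype.card (Fin (k + M) × Memory M) ≤ T) :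
    HMMFamily T where
  Index n := {_σ : Fin (n / (2 * k)) → Fin k → Bool // 0 < n}
  fintypeIndex _ := inferInstance
  nonemptyIndex _ hn := ⟨⟨fun _ _ => false, hn⟩⟩
  model n i :=
    haveI : NeZero n := ⟨i.2.ne'⟩
    haveI : NeZero T := ⟨by
      have : 0 < Fintype.card (Fin (k + M) × Memory M) :=
        Fintype.card_pos_iff.2 ⟨(⟨0, by omega⟩, none)⟩
      omega⟩
    if h : 0 < n / (2 * k) then
      blockModel col (n % (2 * k)) (by norm_num : (0 : ℝ) ≤ 1 / 2000) (by norm_num)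
        (defaultProb_nonneg B h) (defaultProb_le_one B h) hk h hT i.1
    -- Alphabets smaller than `2 k` are irrelevant asymptotically; some model is needed to keep the
    -- family nonempty.
    else constHMM T n

variable {col B}

/-- With `N = n / (2 k)` and `off = n % (2 k)` the literals fill the letters from `off` on. Letters
of literals and syndromes may coincide; the position in the block tells them apart. -/
theorem blockFamily_distinguishes
    (hcol : ∀ u ≠ 0, d < (Finset.univ.filter fun i => pr u (col i) ≠ 0).card)
    (hk : 0 < k) (hM : 0 < M) (hT : Fintype.card (Fin (k + M) × Memory M) ≤ T)
    (hB : (1 - (1 / (4 * k : ℝ)) ^ k) ^ B ≤ 1 / 2000) {ε : ℝ} (hε : 0 < ε)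
    (hKε : (k + M : ℕ) * ε ≤ 35 / 100 * M) {L : Loss} {p : Prog} {n t s t' s' : ℕ}
    (hkn : 2 * k ≤ n) (hn4 : 4 ≤ n) (h : Predicts p L (blockFamily col B hk hT) ε n t s)
    (ht' : 4000 * M * (trialCost k M n B t + 5) + 8 ≤ t')
    (hs' : 4000 * M * (B * (s + 1)) ≤ s') :
    Distinguishes (mainProg col B p (4000 * M) (1120 * M)) (codeDist col) (1 / 2000) n t' s' := by
  classical
  have hn0 : 0 < n := by omega
  have : NeZero n := ⟨hn0.ne'⟩
  have : NeZero (k + M) := ⟨by omega⟩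
  let _ : Inhabited (Clause k n) := ⟨(Fin.castLEEmb (by omega), fun _ => false)⟩
  have hN : 0 < n / (2 * k) := Nat.div_pos hkn (by omega)
  have hn : n = n % (2 * k) + 2 * (k * (n / (2 * k))) := by
    rw [← mul_assoc, add_comm, Nat.div_add_mod]
  have hθ₁ : defaultProb k B n ≤ 1 / 2000 :=
    (pow_le_pow_left₀ (one_sub_acceptProb_nonneg hN)
      (sub_le_sub_left (le_acceptProb hk hkn) 1) B).trans hB
  have hr : Runs p n t s := fun coins u x => ⟨h.halts coins u x, h.reads coins u x⟩
  set m : (Fin (n / (2 * k)) → Fin k → Bool) → HMM T n := fun σ =>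
    blockModel col (n % (2 * k)) (by norm_num : (0 : ℝ) ≤ 1 / 2000) (by norm_num)
      (defaultProb_nonneg B hN) (defaultProb_le_one B hN) hk hN hT σ with hm
  let e : (Fin (n / (2 * k)) → Fin k → Bool) ≃ (blockFamily col B hk hT).Index n :=
    ⟨fun σ => ⟨σ, hn0⟩, fun i => i.1, fun _ => rfl, fun _ => rfl⟩
  have hmodel : ∀ σ, (blockFamily col B hk hT).model n (e σ) = m σ := fun σ => dif_pos hN
  have hcard : Fintype.card ((blockFamily col B hk hT).Index n) = (2 ^ k) ^ (n / (2 * k)) := by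
    rw [← Fintype.card_congr e]
    simp
  have hsucc := h.success
  unfold successProb at hsucc
  rw [← Fintype.sum_equiv e _ _ fun _ => rfl, hcard] at hsucc
  refine distinguishes_mainProg hcol hM hN (Nat.mod_lt _ (by omega)) hn hn4 hr rfl
    (defaultProb_nonneg B hN) hθ₁ ?_ ht' hs'
  refine le_sum_blockHit_of_success (m := m) (defaultProb_nonneg B hN) hθ₁ hN hn.ge
    (fun σ b w => blockModel_prob_append col _ _ _ _ _ hk hN hT σ b w) hr L hε hKε ?_
  refine hsucc.trans_eq (Finset.sum_congr rfl fun σ _ => ?_)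
  simp only [hmodel, Finset.mul_sum]
  refine Finset.sum_congr rfl fun coins _ => Finset.sum_congr rfl fun u _ => ?_
  push_cast
  rw [one_div, one_div, inv_pow, inv_pow, inv_pow]
  ring

end Family

/-! ### Polynomial bounds -/

/-- `F` is bounded by a polynomial on the positive integers. -/
def PolyBounded (F : ℕ → ℕ) : Prop := ∃ a b, ∀ n, 1 ≤ n → F n ≤ a * n ^ b

theorem PolyBounded.const (c : ℕ) : PolyBounded fun _ => c := ⟨c, 0, fun _ _ => by simp⟩

theorem PolyBounded.id : PolyBounded fun n => n := ⟨1, 1, fun _ _ => by simp⟩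

theorem PolyBounded.add {F G : ℕ → ℕ} (hF : PolyBounded F) (hG : PolyBounded G) :
    PolyBounded fun n => F n + G n := by
  obtain ⟨a, b, h⟩ := hF
  obtain ⟨a', b', h'⟩ := hG
  refine ⟨a + a', b + b', fun n hn => ?_⟩
  rw [add_mul]
  exact add_le_add
    ((h n hn).trans (Nat.mul_le_mul_left _ (Nat.pow_le_pow_right hn (Nat.le_add_right _ _))))
    ((h' n hn).trans (Nat.mul_le_mul_left _ (Nat.pow_le_pow_right hn (Nat.le_add_left _ _))))

theorem PolyBounded.mul {F G : ℕ → ℕ} (hF : PolyBounded F) (hG : PolyBounded G) :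
    PolyBounded fun n => F n * G n := by
  obtain ⟨a, b, h⟩ := hF
  obtain ⟨a', b', h'⟩ := hG
  refine ⟨a * a', b + b', fun n hn => ?_⟩
  rw [pow_add, mul_mul_mul_comm]
  exact Nat.mul_le_mul (h n hn) (h' n hn)

theorem polyBounded_cost (k M B f g : ℕ) :
    PolyBounded fun n => 4000 * M * (trialCost k M n B (f * n ^ g) + 5) + 8 := by
  have hc := PolyBounded.const
  have hi := PolyBounded.id
  have ht : PolyBounded fun n => f * n ^ g := ⟨f, g, fun _ _ => le_rfl⟩
  unfold trialCost genCost
  exact ((hc _).mul ((((hi.mul (hc _)).add ((ht.add (hc 1)).mul (((hc _).add (((hc B).mul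
    (((hc k).mul (((hc 28).mul hi).add (hc 11))).add (hc 2))).add (hc _))).add (hc 8)))).add
    ((hc 20).mul hi)).add (hc 50) |>.add (hc 5))).add (hc 8)

/-- A strict gap between the exponents absorbs the power of the logarithm and the constant factor in
the number of clauses. -/
theorem eventually_rpow_le {x y c : ℝ} (hx : x < y) (hc : 0 < c) (e : ℕ) {A : ℕ} (hx₀ : 0 ≤ x)
    {s : ℕ → ℕ}
    (h : ∀ᶠ n : ℕ in atTop, c * (n : ℝ) ^ y / Real.log n ^ e ≤ (A * (s n + 1) : ℕ)) :
    ∀ᶠ n : ℕ in atTop, (n : ℝ) ^ x ≤ s n := by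
  have hA : (0 : ℝ) < 2 * (A + 1) := by positivity
  have h1 := (isLittleO_log_rpow_rpow_atTop (s := y - x) e (sub_pos.2 hx)).def
    (c := c / (2 * (A + 1))) (by positivity)
  filter_upwards [h, tendsto_natCast_atTop_atTop.eventually h1, eventually_ge_atTop 3]
    with n hn hn1 hn3
  have hn3' : (3 : ℝ) ≤ n := by exact_mod_cast hn3
  have hlog : 0 < Real.log n := Real.log_pos (by linarith)
  have hn0 : (0 : ℝ) < n := by linarith
  rw [Real.rpow_natCast, Real.norm_of_nonneg (by positivity), Real.norm_of_nonneg (by positivity),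
    Real.rpow_sub hn0, div_mul_div_comm, le_div_iff₀ (by positivity)] at hn1
  rw [div_le_iff₀ (by positivity)] at hn
  have h1x : 1 ≤ (n : ℝ) ^ x := Real.one_le_rpow (by linarith) hx₀
  have hp : 0 < Real.log n ^ e := by positivity
  push_cast at hn
  have h2 : Real.log n ^ e * (2 * (A + 1) * (n : ℝ) ^ x) ≤
      Real.log n ^ e * (A * (s n + 1)) := by linarith
  have h3 := le_of_mul_le_mul_left h2 hp
  have hA0 : (0 : ℝ) ≤ A := Nat.cast_nonneg A
  by_contra hlt
  push Not at hlt
  nlinarith [mul_le_mul_of_nonneg_left hlt.le hA0]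

/-! ### The choice of the parameters -/

/-- Take tenth powers and use `17 ^ 10 ≤ 2 ^ 41`: it remains to compare `20 M + 41 k + 40 d` with
`50 k`. -/
theorem code_rate {M k d : ℕ} (h : 20 * M + 40 * d < 9 * k) :
    4 ^ M * 17 ^ k * 16 ^ d < 32 ^ k := by
  refine lt_of_pow_lt_pow_left₀ 10 (by positivity) ?_
  calc (4 ^ M * 17 ^ k * 16 ^ d) ^ 10 = 2 ^ (20 * M) * (17 ^ 10) ^ k * 2 ^ (40 * d) := by
        rw [mul_pow, mul_pow, ← pow_mul, ← pow_mul, ← pow_mul, ← pow_mul, mul_comm k 10,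
          show 4 = 2 ^ 2 by norm_num, show 16 = 2 ^ 4 by norm_num, ← pow_mul, ← pow_mul]
        ring_nf
    _ ≤ 2 ^ (20 * M) * (2 ^ 41) ^ k * 2 ^ (40 * d) := by
        exact Nat.mul_le_mul_right _ (Nat.mul_le_mul_left _ (Nat.pow_le_pow_left (by norm_num) k))
    _ = 2 ^ (20 * M + 41 * k + 40 * d) := by rw [← pow_mul, ← pow_add, ← pow_add]
    _ < 2 ^ (50 * k) := Nat.pow_lt_pow_right (by norm_num) (by omega)
    _ = (32 ^ k) ^ 10 := by
        rw [← pow_mul, show 32 = 2 ^ 5 by norm_num, ← pow_mul]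
        ring_nf

theorem exists_parameters : ∃ T₀ : ℕ, ∀ T : ℕ, T₀ ≤ T → ∀ ε : ℝ,
    1 / (T : ℝ) ^ (1 / 4 : ℝ) < ε → ε ≤ 1 / 10 →
    0 < ε ∧ 0 ≤ Real.log T ∧ ∃ k M d : ℕ, 0 < k ∧ 0 < M ∧ 20 * M + 40 * d < 9 * k ∧
      Fintype.card (Fin (k + M) × Memory M) ≤ T ∧ (k + M : ℕ) * ε ≤ 35 / 100 * M ∧
      1 / 30000 * Real.log T / ε < ((d + 1 : ℕ) : ℝ) / 2 := by
  have h1 := (isLittleO_log_rpow_atTop (r := 2 / 5) (by norm_num)).def (c := 2 / 3) (by norm_num)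
  obtain ⟨T₀, hT₀⟩ := eventually_atTop.1 ((tendsto_natCast_atTop_atTop.eventually h1).and
    ((Real.tendsto_log_atTop.comp tendsto_natCast_atTop_atTop).eventually_ge_atTop 80))
  refine ⟨max T₀ 1, fun T hT ε hε hε₁ => ?_⟩
  obtain ⟨ha, hb⟩ := hT₀ T ((le_max_left _ _).trans hT)
  have hT1 : (1 : ℝ) ≤ T := by exact_mod_cast (le_max_right _ _).trans hT
  have hT0 : (0 : ℝ) < T := by linarith
  simp only [Function.comp_apply] at hb
  set l := Real.log T with hl
  rw [Real.norm_of_nonneg (by linarith), Real.norm_of_nonneg (by positivity)] at ha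
  have hε₀ : 0 < ε := lt_trans (by positivity) hε
  set q := (T : ℝ) ^ (1 / 4 : ℝ) with hq
  have hq1 : 1 ≤ q := Real.one_le_rpow hT1 (by norm_num)
  have hqε : 1 < ε * q := by rwa [div_lt_iff₀ (by linarith)] at hε
  -- This gives `4 ^ M ≤ T ^ (7/20)`, as `log 4 ≤ 7/5`.
  set M := ⌊l / 4⌋₊ with hMdef
  have hM1 : (M : ℝ) ≤ l / 4 := Nat.floor_le (by linarith)
  have hM2 : l / 4 < M + 1 := Nat.lt_floor_add_one _
  have hM10 : (10 : ℝ) ≤ M := by linarith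
  -- Hence `k ε ≤ M / 4`, and with `M ε ≤ M / 10` the errors in a block are at most `0.35 M`;
  -- moreover `k` is of order `log T / ε`.
  set k := ⌊(M : ℝ) / (4 * ε)⌋₊ with hkdef
  have hk1 : (k : ℝ) ≤ M / (4 * ε) := Nat.floor_le (by positivity)
  have hk2 : (M : ℝ) / (4 * ε) < k + 1 := Nat.lt_floor_add_one _
  rw [le_div_iff₀ (by positivity)] at hk1
  rw [div_lt_iff₀ (by positivity)] at hk2
  have hk3 : 5 / 2 * (M : ℝ) < k + 1 := by nlinarith
  have hk4 : k ≤ M * q := by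
    have h0 : (0 : ℝ) ≤ k := Nat.cast_nonneg k
    nlinarith [mul_le_mul_of_nonneg_right hk1 (by linarith : 0 ≤ q), mul_le_mul_of_nonneg_left hqε.le h0]
  have hd1 : ((k / 200 : ℕ) : ℝ) ≤ k / 200 := Nat.cast_div_le
  refine ⟨hε₀, by linarith, k, M, k / 200, ?_, ?_, ?_, ?_, ?_, ?_⟩
  · have : (0 : ℝ) < k := by linarith
    exact_mod_cast this
  · have : (0 : ℝ) < M := by linarith
    exact_mod_cast this
  · have : 20 * (M : ℝ) + 40 * ((k / 200 : ℕ) : ℝ) < 9 * k := by linarith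
    exact_mod_cast this
  · have h4 : (4 : ℝ) ^ M ≤ (T : ℝ) ^ (7 / 20 : ℝ) := by
      rw [← Real.rpow_natCast, Real.rpow_def_of_pos hT0, Real.rpow_def_of_pos (by norm_num)]
      refine Real.exp_le_exp.2 ?_
      have : Real.log 4 ≤ 7 / 5 := by
        rw [show (4 : ℝ) = 2 ^ 2 by norm_num, Real.log_pow]
        have := Real.log_two_lt_d9
        push_cast
        linarith
      nlinarith
    -- The states are accounted for as follows: `T ^ (1/4)` for `1 / ε`, `T ^ (7/20)` for the
    -- syndromes, and `T ^ (2/5)` for the factor `6 M`.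
    have e : (T : ℝ) = (T : ℝ) ^ (2 / 5 : ℝ) * (q * (T : ℝ) ^ (7 / 20 : ℝ)) := by
      rw [hq, ← Real.rpow_add hT0, ← Real.rpow_add hT0]
      norm_num
    have h5 : (1 : ℝ) ≤ 4 ^ M := one_le_pow₀ (by norm_num)
    have : ((k + M : ℕ) : ℝ) * (2 * 4 ^ M + 1) ≤ T := by
      rw [e]
      push_cast
      calc ((k : ℝ) + M) * (2 * 4 ^ M + 1) ≤ (M * q + M * q) * (3 * 4 ^ M) := by
            refine mul_le_mul ?_ (by linarith) (by positivity) (by positivity)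
            nlinarith
        _ = 6 * M * (q * 4 ^ M) := by ring
        _ ≤ (T : ℝ) ^ (2 / 5 : ℝ) * (q * (T : ℝ) ^ (7 / 20 : ℝ)) := by
            gcongr
            linarith
    have h6 : Fintype.card (Fin (k + M) × Memory M) = (k + M) * (2 * 4 ^ M + 1) := by
      rw [Fintype.card_prod, Fintype.card_fin, Fintype.card_option, Fintype.card_prod, card_syn,
        Fintype.card_bool]
    rw [h6]
    exact_mod_cast this
  · push_cast
    nlinarith
  -- Up to rounding, `(d + 1) / 2` is `k / 400`, about `log T / (6400 ε)`; the constant `30000`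
  -- leaves room for the roundings.
  · have hd2 : (k : ℝ) < 200 * ((k / 200 : ℕ) + 1) := by
      have : k < 200 * (k / 200 + 1) := by omega
      exact_mod_cast this
    rw [div_lt_iff₀ hε₀]
    push_cast
    nlinarith

end SeqPred

/-! ### The lower bound on the number of samples -/

theorem theorem2 (conjecture : SeqPred.CSPHardness) :
    ∃ c c' : ℝ, 0 < c ∧ 0 < c' ∧ ∃ T₀ : ℕ, ∀ T : ℕ, T₀ ≤ T → ∀ ε : ℝ,
      1 / (T : ℝ) ^ c < ε → ε ≤ 1 / 10 →
      ∃ 𝓗 : SeqPred.HMMFamily T,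
        ∀ (L : SeqPred.Loss) (f g : ℕ → ℝ → ℕ) (p : SeqPred.Prog) (s : ℕ → ℕ),
          (∀ᶠ n in atTop, SeqPred.Predicts p L 𝓗 ε n (f T ε * n ^ g T ε) (s n)) →
          ∀ᶠ n : ℕ in atTop, (n : ℝ) ^ (c' * Real.log T / ε) ≤ s n := by
  obtain ⟨T₀, hT₀⟩ := SeqPred.exists_parameters
  refine ⟨1 / 4, 1 / 30000, by norm_num, by norm_num, T₀, fun T hT ε hε hε₁ => ?_⟩
  obtain ⟨hε₀, hl, k, M, d, hk, hM, hrate, hstates, hKε, hexp⟩ := hT₀ T hT ε hε hε₁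
  obtain ⟨col, hcol⟩ := SeqPred.exists_code (SeqPred.code_rate hrate)
  obtain ⟨r, hr, hQ⟩ := SeqPred.exists_hasComplexity hM hcol
  -- The number of attempts depends on `k` only, so it enters the clause count as a constant.
  obtain ⟨B, hB⟩ := exists_pow_lt_of_lt_one (show (0 : ℝ) < 1 / 2000 by norm_num)
    (show 1 - (1 / (4 * k : ℝ)) ^ k < 1 from sub_lt_self _ (by positivity))
  refine ⟨SeqPred.blockFamily col B hk hstates, fun L f g p s h => ?_⟩
  obtain ⟨a, b, hab⟩ := SeqPred.polyBounded_cost k M B (f T ε) (g T ε)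
  obtain ⟨c, e, hc, hbound⟩ := conjecture k (SeqPred.codeDist col) r (1 / 2000)
    (SeqPred.isDistribution_codeDist hcol) hQ (by norm_num) (by norm_num)
    -- For fixed `T` and `ε` the algorithm and all parameters are constants, so this is a single
    -- program with a polynomial time bound, as the conjecture requires.
    (SeqPred.mainProg col B p (4000 * M) (1120 * M)) a b (fun n => 4000 * M * (B * (s n + 1))) (by
      filter_upwards [h, eventually_ge_atTop (2 * k), eventually_ge_atTop 4] with n hn hkn hn4
      exact SeqPred.blockFamily_distinguishes hcol hk hM hstates hB.le hε₀ hKε hkn hn4 hn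
        (hab n (by omega)) le_rfl)
  simp only [← mul_assoc (4000 * M) B] at hbound
  refine SeqPred.eventually_rpow_le (hexp.trans_le ?_) hc e (by positivity) hbound
  have : ((d + 1 : ℕ) : ℝ) ≤ r := by exact_mod_cast hr
  linarith
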